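/- **Circuits.** A quantum circuit acts on finitely many qubits and consists of a sequence of stages; in each stage finitely many gates act in parallel on pairwise disjoint sets of qubits. The gates are the Hadamard gate, the rotations $R_k=\mathrm{diag}(1,e^{2\pi i/2^k})$ ($k\in\mathbb N$), the two-qubit controlled-$R_k$ gates, and their inverses. The size of a circuit is its number of gates, its depth is its number of stages. **Multiplication.** For $n,M\in\mathbb N$ we say that multiplication by $M$ has simultaneous size $s$ and depth $d$ if some quantum circuit of size at most $s$ and depth at most $d$, which may use any number of additional qubits that are $0$ at the start and at the end, maps $|M\rangle|j\rangle|0\rangle\mapsto|M\rangle|j\rangle|Mj\rangle$ for this $M$ and every $n$-bit integer $0\le j<2^n$. An $n$-bit approximation $\widetilde{x}$ to a real number $x$ is a number $\widetilde x=m/2^e$ with $m,e\in\mathbb N$ such that $m$ has exactly $n$ binary digits and $|x-m/2^e|\le 2^{-e}$; multiplication by $\widetilde x$ means multiplication by its mantissa $m$ (the position of the binary point being fixed). **QFT.** For a unit vector $|\alpha\rangle=\sum_{j<N}\alpha_j|j\rangle$ let $|\hat\alpha\rangle=\sum_{k<N}\hat\alpha_k|k\rangle$ with $\hat\alpha_k=N^{-1/2}\sum_{j<N}\alpha_j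 e^{2\pi i jk/N}$. A circuit on an $n$-qubit register (with $N\le 2^n$) and some further qubits, initially $0$, approximates the QFT over $\mathbb Z_N$ to within $\varepsilon$ if there is a unit vector $|\eta\rangle$ of the further qubits such that for every unit vector $|\alpha\rangle$ the output $|\gamma\rangle$ of the circuit on input $|\alpha\rangle|0\rangle$ satisfies $\big\||\gamma\rangle-|\hat\alpha\rangle|\eta\rangle\big\|<\varepsilon$. **Theorem.** Let $p$ be a real polynomial with $p(n)>0$ for all integers $n\ge1$. There is a constant $K>0$, depending only on $p$, such that the following holds for every integer $N\ge1$, where $n$ is the number of binary digits of $N$. Let $\widetilde{1/N}$ be any $n$-bit approximation to $1/N$. If multiplication by $N$ has simultaneous size $s(N)$ and depth $d(N)$, and multiplication by $\widetilde{1/N}$ has simultaneous size $s(\widetilde{1/N})$ and depth $d(\widetilde{1/N})$, then there is a single quantum circuit of size at most $$K\left(s(N)+s(\widetilde{1/N})+n\log_2 n\right)$$ and depth at most $$K\left(d(N)+d(\widetilde{1/N})+\log_2 n\right)$$ which approximates the QFT over $\mathbb Z_N$ to within $1/p(n)$. -/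

import Mathlib

noncomputable section

namespace QuantumCircuit

/-- Pure states of a set `W` of qubits (wires): vectors indexed by the bit strings on `W`,
with the Euclidean norm. -/
abbrev State (W : Type) : Type := EuclideanSpace ℂ (W → Bool)

/-- The elementary gates: Hadamard, the single qubit rotations
`R_k = diag (1, e ^ (2 π i / 2 ^ k))`, the controlled rotations, and the gates run in reverse
(the Hadamard gate is its own inverse). -/
inductive Gate (W : Type) : Type where
  | had (a : W) : Gate W
  | rot (k : ℕ) (a : W) : Gate W
  | rotInv (k : ℕ) (a : W) : Gate W
  | crot (k : ℕ) (a b : W) (hab : a ≠ b) : Gate W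
  | crotInv (k : ℕ) (a b : W) (hab : a ≠ b) : Gate W

/-- The phase `e ^ (2 π i / 2 ^ k)`. -/
def phase (k : ℕ) : ℂ := Complex.exp (2 * Real.pi * Complex.I / 2 ^ k)

/-- The set of qubits on which a gate acts. -/
def Gate.support {W : Type} [DecidableEq W] : Gate W → Finset W
  | .had a => {a}
  | .rot _ a => {a}
  | .rotInv _ a => {a}
  | .crot _ a b _ => {a, b}
  | .crotInv _ a b _ => {a, b}

/-- The unitary action of a gate (tensored with the identity on the other qubits) on states. -/
def Gate.apply {W : Type} [DecidableEq W] : Gate W → State W → State W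
  | .had a, ψ => WithLp.toLp 2 fun x =>
      (1 / (Real.sqrt 2 : ℂ)) *
        (ψ (Function.update x a false) +
          (if x a = true then -1 else 1) * ψ (Function.update x a true))
  | .rot k a, ψ => WithLp.toLp 2 fun x =>
      (if x a = true then phase k else 1) * ψ x
  | .rotInv k a, ψ => WithLp.toLp 2 fun x =>
      (if x a = true then (phase k)⁻¹ else 1) * ψ x
  | .crot k a b _, ψ => WithLp.toLp 2 fun x =>
      (if x a = true ∧ x b = true then phase k else 1) * ψ x
  | .crotInv k a b _, ψ => WithLp.toLp 2 fun x =>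
      (if x a = true ∧ x b = true then (phase k)⁻¹ else 1) * ψ x

/-- A quantum circuit on the qubits `W`: a sequence of stages, each a list of gates that act on
pairwise disjoint sets of qubits and are performed in parallel. -/
structure Circuit (W : Type) [DecidableEq W] : Type where
  stages : List (List (Gate W))
  parallel : ∀ L ∈ stages, L.Pairwise fun g h => Disjoint g.support h.support

namespace Circuit

variable {W : Type} [DecidableEq W]

/-- The total number of gates. -/
def size (C : Circuit W) : ℕ := (C.stages.map List.length).sum

/-- The number of stages. -/
def depth (C : Circuit W) : ℕ := C.stages.length

/-- The output state of the circuit; the first gate of the first stage is applied first. -/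
def run (C : Circuit W) (ψ : State W) : State W :=
  C.stages.foldl (fun φ L => L.foldl (fun χ g => g.apply χ) φ) ψ

end Circuit

/-- The computational basis state `|x⟩`. -/
def ket {W : Type} [Fintype W] [DecidableEq W] (x : W → Bool) : State W :=
  EuclideanSpace.single x 1

/-- The content of a register of `w` qubits that holds the binary digits of `x`. -/
def bits (w x : ℕ) : Fin w → Bool := fun i => x.testBit i

/-- The product state `|ψ⟩|φ⟩`. -/
def tensor {V W : Type} (ψ : State V) (φ : State W) : State (V ⊕ W) :=
  WithLp.toLp 2 fun x => ψ (fun v => x (Sum.inl v)) * φ (fun w => x (Sum.inr w))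

/-- The superposition `∑_{j < N} α_j |j⟩` in a register of `w` qubits. -/
def superposition (w : ℕ) {N : ℕ} (α : EuclideanSpace ℂ (Fin N)) : State (Fin w) :=
  ∑ j : Fin N, α j • ket (bits w j)

/-- The quantum Fourier transform over `ℤ / N`:
`α̂_k = N ^ (-1/2) ∑_{j < N} α_j e ^ (2 π i j k / N)`. -/
def qft {N : ℕ} (α : EuclideanSpace ℂ (Fin N)) : EuclideanSpace ℂ (Fin N) :=
  WithLp.toLp 2 fun k => (1 / (Real.sqrt N : ℂ)) *
    ∑ j : Fin N, α j * Complex.exp (2 * Real.pi * Complex.I * ((j : ℕ) * (k : ℕ)) / N)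

/-- Qubits of a circuit that multiplies `n`-bit integers by `M`: a register for `M`, one for the
`n`-bit integer, one for the product, and `c` further clean qubits. -/
abbrev MulWires (n M c : ℕ) : Type :=
  Fin M.size ⊕ (Fin n ⊕ (Fin (M.size + n) ⊕ Fin c))

/-- The basis state `|M⟩|j⟩|y⟩|0⟩`. -/
def mulKet (n M c j y : ℕ) : State (MulWires n M c) :=
  ket (Sum.elim (bits M.size M)
    (Sum.elim (bits n j) (Sum.elim (bits (M.size + n) y) fun _ => false)))

/-- Multiplication of arbitrary `n`-bit integers by `M`, that is `|M⟩|j⟩|0⟩ ⟶ |M⟩|j⟩|M j⟩` for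
all `j < 2 ^ n`, is computed by a quantum circuit with at most `s` gates and at most `d` stages. -/
def HasMulCircuit (n M s d : ℕ) : Prop :=
  ∃ (c : ℕ) (C : Circuit (MulWires n M c)), C.size ≤ s ∧ C.depth ≤ d ∧
    ∀ j : ℕ, j < 2 ^ n → C.run (mulKet n M c j 0) = mulKet n M c j (M * j)

/-- `m / 2 ^ e` is an `n`-bit approximation to the real number `x`: the mantissa `m` has exactly
`n` binary digits and the error is at most one unit in the last place. -/
def IsBitApprox (n m e : ℕ) (x : ℝ) : Prop :=
  m.size = n ∧ |x - m / 2 ^ e| ≤ 1 / 2 ^ e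

/-- The circuit `C`, which acts on a register of `w` qubits and `c` clean qubits, approximates the
quantum Fourier transform over `ℤ / N` to within (less than) `ε`: up to an error of norm less than
`ε` it maps `|α⟩|0⟩` to `|α̂⟩|η⟩`, for every unit vector `α`, where the superposition `|η⟩` of the
clean qubits does not depend on `α`. -/
def ApproximatesQFT (N : ℕ) {w c : ℕ} (C : Circuit (Fin w ⊕ Fin c)) (ε : ℝ) : Prop :=
  ∃ η : State (Fin c), ‖η‖ = 1 ∧ ∀ α : EuclideanSpace ℂ (Fin N), ‖α‖ = 1 →
    ‖C.run (tensor (superposition w α) (ket fun _ => false)) -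
      tensor (superposition w (qft α)) η‖ < ε

end QuantumCircuit

end

/-!
# The quantum Fourier transform over `ℤ / N` in logarithmic depth

All arithmetic is done reversibly, and exactly, by circuits of size `O(n log n)` and depth `O(log n)`
together with a bounded number of calls of the two given multiplication circuits. The Fourier basis state
`∑ F, e ^ (2 π i j F / N) |F⟩` that belongs to an input `|j⟩` is prepared, and then `j` is erased with the
help of the Fourier basis state.

*The number `F`.* It is the sum of a number `blockSum κ` and of a number `r` with `n + s` digits, where the
stride `s` is a large multiple of `log n`. The bits `κ` form `n / s + 1` blocks of `3 s` qubits, and the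
`i`-th block contributes `2 ^ (s i)` times its content to `blockSum κ`, so that consecutive blocks overlap.
All these bits are put in uniform superposition. The binary digits of `j / N` are computed by two rounds of
multiplication by the reciprocal (`comp_quotientDigits`, `abs_quotient_sub_le`), and the phase
`e ^ (2 π i j F / N)` is produced by controlled rotations between the digits of `j / N` and those of `F`, of
which only those with an angle of at least `2 π / 2 ^ s` are carried out (`impl_mul_phase`); these are
`O(n s)` gates in `O(s)` stages.

*Erasing `j`.* The state of the blocks is a product state, since the phase is linear in `F`. Each block is
in an approximate Fourier basis state for the fractional part of `2 ^ (s i) j / N`, hence the inverse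
Fourier transforms of the single blocks, which have depth `O(s)` (`exists_blockQFT`), yield approximations
of these fractional parts to within `2 ^ (-s)`, up to a failure probability of `O(2 ^ (-s))` for each block
(`sum_norm_prod_blockAmp_sq_le`). A fixed shift of the phases makes all the errors one-sided. Since the
blocks overlap, the carry from one block to the previous one can be read off from two bits
(`borrow_dichotomy`), and one subtraction recovers `j / N`, that is `j` (`reconstruct_spec`). Adding this
value to the register of `j` erases it. In case of failure there remain wrong values; they do not interfere
for different `j`, because the phases `e ^ (2 π i j r / N)`, averaged over `r`, are almost orthogonal
(`sum_norm_sq_cis_le`). So the total error is governed by the failure probability for a single `j`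
(`norm_erase_sq_le`).

*Cleaning up.* After the block transforms are undone, the first register is filled with `F % N` and a
further one with the quotient `t = F / N` (`comp_divMod`). Since `F` is determined by these two,
`r = F - blockSum κ` can be reset to `0`. The amplitude at `k = F % N` is the Fourier transform of the
input at `k`, and the bits `κ` and `t` are subject to the condition that `k + N t - blockSum κ` has at most
`n + s` digits. Up to a proportion `O(2 ^ (-s))` of the values of `(κ, t)`, that condition does not depend
on `k`, so that the state is almost a product state (`exists_product_state`).

The error is at most `102 √(n / 2 ^ s)` (`error_le`), which is less than `1 / p n` if `s` is a suitable
multiple of the number of digits of `n`. For the finitely many `n` for which this stride is too large, the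
same algorithm, with a single block and arbitrary circuits for the arithmetic, gives some circuit
(`exists_approximatesQFT`), and its cost is absorbed in the constant.
-/

set_option linter.unusedSectionVars false

noncomputable section

namespace QuantumCircuit

/-! ### Gates and circuits as linear isometries -/

section Basic

variable {W : Type} [DecidableEq W]

/-- The factor by which a diagonal gate multiplies the amplitude of `|x⟩` (for the Hadamard gate,
which is not diagonal, the value is irrelevant). -/
def Gate.factor : Gate W → (W → Bool) → ℂ
  | .had _, _ => 1
  | .rot k a, x => if x a = true then phase k else 1
  | .rotInv k a, x => if x a = true then (phase k)⁻¹ else 1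
  | .crot k a b _, x => if x a = true ∧ x b = true then phase k else 1
  | .crotInv k a b _, x => if x a = true ∧ x b = true then (phase k)⁻¹ else 1

/-- All gates but the Hadamard gate are diagonal. -/
def Gate.IsDiag : Gate W → Prop
  | .had _ => False
  | _ => True

theorem Gate.IsDiag.apply_eq {g : Gate W} (hg : g.IsDiag) (ψ : State W) :
    g.apply ψ = WithLp.toLp 2 fun x => g.factor x * ψ x := by
  cases g <;> first | rfl | exact hg.elim

theorem norm_phase (k : ℕ) : ‖phase k‖ = 1 := by
  have : phase k = Complex.exp (((2 * Real.pi / 2 ^ k : ℝ) : ℂ) * Complex.I) := by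
    unfold phase; congr 1; push_cast; ring
  rw [this, Complex.norm_exp_ofReal_mul_I]

theorem phase_ne_zero (k : ℕ) : phase k ≠ 0 := by
  rw [← norm_ne_zero_iff, norm_phase]; exact one_ne_zero

theorem Gate.norm_factor (g : Gate W) (x : W → Bool) : ‖g.factor x‖ = 1 := by
  cases g <;> simp only [Gate.factor] <;> (try split_ifs) <;> simp [norm_phase]

theorem Gate.apply_add (g : Gate W) (ψ φ : State W) :
    g.apply (ψ + φ) = g.apply ψ + g.apply φ := by
  ext x
  cases g <;> simp only [Gate.apply, PiLp.add_apply] <;> ring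

theorem Gate.apply_smul (g : Gate W) (c : ℂ) (ψ : State W) :
    g.apply (c • ψ) = c • g.apply ψ := by
  ext x
  cases g <;> simp only [Gate.apply, PiLp.smul_apply, smul_eq_mul] <;> ring

/-- The gate that undoes `g`. -/
def Gate.inv : Gate W → Gate W
  | .had a => .had a
  | .rot k a => .rotInv k a
  | .rotInv k a => .rot k a
  | .crot k a b h => .crotInv k a b h
  | .crotInv k a b h => .crot k a b h

theorem Gate.support_inv (g : Gate W) : g.inv.support = g.support := by cases g <;> rfl

theorem one_div_sqrt_two_mul_self : (1 / (Real.sqrt 2 : ℂ)) * (1 / (Real.sqrt 2 : ℂ)) = 1 / 2 := by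
  have : (Real.sqrt 2 : ℂ) * (Real.sqrt 2 : ℂ) = 2 := by
    rw [← Complex.ofReal_mul, Real.mul_self_sqrt (by norm_num)]; norm_num
  rw [div_mul_div_comm, this, one_mul]

theorem Gate.inv_apply_apply (g : Gate W) (ψ : State W) : g.inv.apply (g.apply ψ) = ψ := by
  ext x
  cases g with
  | had a =>
    have h2 := one_div_sqrt_two_mul_self
    simp only [Gate.inv, Gate.apply, Function.update_self, Function.update_idem]
    simp only [Bool.false_eq_true, if_false, if_true]
    cases hx : x a
    · have : Function.update x a false = x := by rw [← hx]; exact Function.update_eq_self a x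
      rw [this]
      simp only [Bool.false_eq_true, if_false]
      linear_combination (2 * ψ x) * h2
    · have : Function.update x a true = x := by rw [← hx]; exact Function.update_eq_self a x
      rw [this]
      simp only [if_true]
      linear_combination (2 * ψ x) * h2
  | rot k a => simp only [Gate.inv, Gate.apply]; split_ifs <;> simp [phase_ne_zero]
  | rotInv k a => simp only [Gate.inv, Gate.apply]; split_ifs <;> simp [phase_ne_zero]
  | crot k a b h => simp only [Gate.inv, Gate.apply]; split_ifs <;> simp [phase_ne_zero]
  | crotInv k a b h => simp only [Gate.inv, Gate.apply]; split_ifs <;> simp [phase_ne_zero]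

/-- Negation of one bit, as a permutation of the bit strings. -/
def flipEquiv (a : W) : (W → Bool) ≃ (W → Bool) where
  toFun x := Function.update x a (!x a)
  invFun x := Function.update x a (!x a)
  left_inv x := by simp
  right_inv x := by simp

theorem Gate.norm_apply [Fintype W] (g : Gate W) (ψ : State W) : ‖g.apply ψ‖ = ‖ψ‖ := by
  have key : ‖g.apply ψ‖ ^ 2 = ‖ψ‖ ^ 2 := by
    rw [EuclideanSpace.norm_sq_eq, EuclideanSpace.norm_sq_eq]
    by_cases hg : g.IsDiag
    · rw [hg.apply_eq]
      refine Finset.sum_congr rfl fun x _ => ?_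
      simp [Gate.norm_factor]
    · cases g with
      | had a =>
        have h2 : ∀ f : (W → Bool) → ℝ, 2 * ∑ x, f x = ∑ x, (f x + f (flipEquiv a x)) := by
          intro f
          rw [Finset.sum_add_distrib, (flipEquiv a).sum_comp f]; ring
        have : ∀ u v : ℂ, ‖(1 / (Real.sqrt 2 : ℂ)) * (u + v)‖ ^ 2 +
            ‖(1 / (Real.sqrt 2 : ℂ)) * (u - v)‖ ^ 2 = ‖u‖ ^ 2 + ‖v‖ ^ 2 := by
          intro u v
          have hp := parallelogram_law_with_norm ℝ u v
          have hs : ‖(1 / (Real.sqrt 2 : ℂ))‖ ^ 2 = 1 / 2 := by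
            rw [sq, ← norm_mul, one_div_sqrt_two_mul_self]; simp
          rw [norm_mul, norm_mul, mul_pow, mul_pow, hs]
          linear_combination (1 / 2) * hp
        refine mul_left_cancel₀ (two_ne_zero (α := ℝ)) ?_
        rw [h2, h2]
        refine Finset.sum_congr rfl fun x _ => ?_
        simp only [Gate.apply, flipEquiv, Equiv.coe_fn_mk, Function.update_idem,
          Function.update_self]
        cases hx : x a
        · have h : Function.update x a false = x := by rw [← hx]; exact Function.update_eq_self a x
          simp only [Bool.not_false, if_true, Bool.false_eq_true, if_false, h]
          rw [one_mul, neg_one_mul, ← sub_eq_add_neg]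
          have := this (ψ x) (ψ (Function.update x a true))
          linarith
        · have h : Function.update x a true = x := by rw [← hx]; exact Function.update_eq_self a x
          simp only [Bool.not_true, if_true, Bool.false_eq_true, if_false, h]
          rw [one_mul, neg_one_mul, ← sub_eq_add_neg]
          have := this (ψ (Function.update x a false)) (ψ x)
          linarith
      | _ => exact (hg trivial).elim
  exact (sq_eq_sq₀ (norm_nonneg _) (norm_nonneg _)).1 key

/-- The action of a list of gates, the first one being applied first. -/
def runList (l : List (Gate W)) (ψ : State W) : State W := l.foldl (fun χ g => g.apply χ) ψ

@[simp] theorem runList_nil (ψ : State W) : runList [] ψ = ψ := rfl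

@[simp] theorem runList_cons (g : Gate W) (l : List (Gate W)) (ψ : State W) :
    runList (g :: l) ψ = runList l (g.apply ψ) := rfl

theorem runList_append (l l' : List (Gate W)) (ψ : State W) :
    runList (l ++ l') ψ = runList l' (runList l ψ) := List.foldl_append

theorem runList_flatten (L : List (List (Gate W))) (ψ : State W) :
    runList L.flatten ψ = L.foldl (fun φ l => runList l φ) ψ := List.foldl_flatten

theorem Circuit.run_eq (C : Circuit W) (ψ : State W) : C.run ψ = runList C.stages.flatten ψ :=
  (runList_flatten _ _).symm

theorem runList_add (l : List (Gate W)) (ψ φ : State W) :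
    runList l (ψ + φ) = runList l ψ + runList l φ := by
  induction l generalizing ψ φ with
  | nil => rfl
  | cons g l ih => simp [Gate.apply_add, ih]

theorem runList_smul (l : List (Gate W)) (c : ℂ) (ψ : State W) :
    runList l (c • ψ) = c • runList l ψ := by
  induction l generalizing ψ with
  | nil => rfl
  | cons g l ih => simp [Gate.apply_smul, ih]

theorem runList_inv (l : List (Gate W)) (ψ : State W) :
    runList (l.map Gate.inv).reverse (runList l ψ) = ψ := by
  induction l generalizing ψ with
  | nil => rfl
  | cons g l ih =>
    rw [List.map_cons, List.reverse_cons, runList_append, runList_cons g l, ih]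
    simp [Gate.inv_apply_apply]

namespace Circuit

/-- The action of a circuit as a linear map. -/
def lin (C : Circuit W) : State W →ₗ[ℂ] State W where
  toFun := C.run
  map_add' ψ φ := by simp only [run_eq, runList_add]
  map_smul' c ψ := by simp only [run_eq, runList_smul, RingHom.id_apply]

@[simp] theorem lin_apply (C : Circuit W) (ψ : State W) : C.lin ψ = C.run ψ := rfl

theorem run_sub (C : Circuit W) (ψ φ : State W) : C.run (ψ - φ) = C.run ψ - C.run φ :=
  C.lin.map_sub ψ φ

theorem norm_run [Fintype W] (C : Circuit W) (ψ : State W) : ‖C.run ψ‖ = ‖ψ‖ := by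
  rw [run_eq]
  induction C.stages.flatten generalizing ψ with
  | nil => rfl
  | cons g l ih => rw [runList_cons, ih, Gate.norm_apply]

/-- The circuit without gates. -/
def empty : Circuit W := ⟨[], by simp⟩

@[simp] theorem run_empty (ψ : State W) : (empty : Circuit W).run ψ = ψ := rfl
@[simp] theorem size_empty : (empty : Circuit W).size = 0 := rfl
@[simp] theorem depth_empty : (empty : Circuit W).depth = 0 := rfl

/-- First `C`, then `C'`. -/
def append (C C' : Circuit W) : Circuit W :=
  ⟨C.stages ++ C'.stages, fun L hL => (List.mem_append.1 hL).elim (C.parallel L) (C'.parallel L)⟩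

@[simp] theorem run_append (C C' : Circuit W) (ψ : State W) :
    (C.append C').run ψ = C'.run (C.run ψ) := by
  simp [run_eq, append, runList_append]

@[simp] theorem size_append (C C' : Circuit W) : (C.append C').size = C.size + C'.size := by
  simp [size, append]

@[simp] theorem depth_append (C C' : Circuit W) : (C.append C').depth = C.depth + C'.depth := by
  simp [depth, append]

/-- The circuit run backwards. -/
def inv (C : Circuit W) : Circuit W where
  stages := (C.stages.map fun L => (L.map Gate.inv).reverse).reverse
  parallel L hL := by
    simp only [List.mem_reverse, List.mem_map] at hL
    obtain ⟨L, hL, rfl⟩ := hL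
    rw [List.pairwise_reverse, List.pairwise_map]
    refine (C.parallel L hL).imp ?_
    intro g h hgh
    rw [Gate.support_inv, Gate.support_inv]; exact hgh.symm

@[simp] theorem size_inv (C : Circuit W) : C.inv.size = C.size := by
  simp [size, inv, List.sum_reverse, Function.comp_def]

@[simp] theorem depth_inv (C : Circuit W) : C.inv.depth = C.depth := by
  simp [depth, inv]

@[simp] theorem inv_run_run (C : Circuit W) (ψ : State W) : C.inv.run (C.run ψ) = ψ := by
  have : C.inv.stages.flatten = (C.stages.flatten.map Gate.inv).reverse := by
    simp only [inv]
    induction C.stages with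
    | nil => rfl
    | cons L M ih => simp [ih]
  rw [run_eq, run_eq, this, runList_inv]

end Circuit

end Basic

/-! ### Circuits on a larger set of qubits -/

section Map

variable {W W' : Type} [DecidableEq W] [DecidableEq W']

/-- A gate moved to other wires. -/
def Gate.map (f : W ↪ W') : Gate W → Gate W'
  | .had a => .had (f a)
  | .rot k a => .rot k (f a)
  | .rotInv k a => .rotInv k (f a)
  | .crot k a b h => .crot k (f a) (f b) (f.injective.ne h)
  | .crotInv k a b h => .crotInv k (f a) (f b) (f.injective.ne h)

theorem Gate.support_map (f : W ↪ W') (g : Gate W) : (g.map f).support = g.support.map f := by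
  cases g <;> simp [Gate.map, Gate.support]

/-- The part of a state in which the wires outside of the range of `f` have the values given
by `X`. -/
def slice (f : W ↪ W') (X : W' → Bool) (Ψ : State W') : State W :=
  WithLp.toLp 2 fun x => Ψ (Function.extend f x X)

theorem extend_update (f : W ↪ W') (X : W' → Bool) (x : W → Bool) (a : W) (b : Bool) :
    Function.extend f (Function.update x a b) X =
      Function.update (Function.extend f x X) (f a) b := by
  funext w
  by_cases hw : ∃ v, f v = w
  · obtain ⟨v, rfl⟩ := hw
    rw [f.injective.extend_apply]
    by_cases hv : v = a
    · subst hv; simp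
    · rw [Function.update_of_ne hv, Function.update_of_ne (f.injective.ne hv),
        f.injective.extend_apply]
  · rw [Function.extend_apply' _ _ _ hw, Function.update_of_ne, Function.extend_apply' _ _ _ hw]
    rintro rfl; exact hw ⟨a, rfl⟩

theorem slice_map_apply (f : W ↪ W') (X : W' → Bool) (g : Gate W) (Ψ : State W') :
    slice f X ((g.map f).apply Ψ) = g.apply (slice f X Ψ) := by
  ext x
  cases g <;>
    simp [slice, Gate.map, Gate.apply, extend_update, f.injective.extend_apply]

theorem slice_runList_map (f : W ↪ W') (X : W' → Bool) (l : List (Gate W)) (Ψ : State W') :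
    slice f X (runList (l.map (Gate.map f)) Ψ) = runList l (slice f X Ψ) := by
  induction l generalizing Ψ with
  | nil => rfl
  | cons g l ih => simp [ih, slice_map_apply]

/-- A circuit moved to other wires. -/
def Circuit.map (f : W ↪ W') (C : Circuit W) : Circuit W' where
  stages := C.stages.map (List.map (Gate.map f))
  parallel L hL := by
    obtain ⟨L', hL', rfl⟩ := List.mem_map.1 hL
    rw [List.pairwise_map]
    refine (C.parallel L' hL').imp ?_
    intro g h hgh
    rw [Gate.support_map, Gate.support_map, Finset.disjoint_map]; exact hgh

@[simp] theorem Circuit.size_map (f : W ↪ W') (C : Circuit W) : (C.map f).size = C.size := by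
  simp [Circuit.size, Circuit.map, Function.comp_def]

@[simp] theorem Circuit.depth_map (f : W ↪ W') (C : Circuit W) : (C.map f).depth = C.depth := by
  simp [Circuit.depth, Circuit.map]

theorem Circuit.slice_run_map (f : W ↪ W') (X : W' → Bool) (C : Circuit W) (Ψ : State W') :
    slice f X ((C.map f).run Ψ) = C.run (slice f X Ψ) := by
  rw [Circuit.run_eq, Circuit.run_eq, ← slice_runList_map]
  simp [Circuit.map, List.map_flatten]

/-- On each slice, in which the wires outside of the range of `f` are fixed, the moved circuit acts like
the original one. -/
theorem Circuit.run_map_apply (f : W ↪ W') (C : Circuit W) (Ψ : State W') (X : W' → Bool) :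
    (C.map f).run Ψ X = C.run (slice f X Ψ) (fun v => X (f v)) := by
  rw [← Circuit.slice_run_map]
  simp only [slice]
  refine congrArg ((C.map f).run Ψ) ?_
  funext w
  by_cases hw : ∃ v, f v = w
  · obtain ⟨v, rfl⟩ := hw; rw [f.injective.extend_apply]
  · rw [Function.extend_apply' _ _ _ hw]

variable [Fintype W] [Fintype W']

theorem ket_apply (x y : W → Bool) : ket x y = if y = x then 1 else 0 := by
  simp [ket]

theorem state_eq_sum (ψ : State W) : ψ = ∑ x, ψ x • ket x := by
  ext y
  simp [ket_apply]

/-- If a circuit maps `|x⟩` to `|y⟩`, then, moved to the wires `f v` of a larger set, it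
overwrites the bits `x` on these wires by `y`. -/
theorem Circuit.run_map_ket (f : W ↪ W') {C : Circuit W} {x y : W → Bool}
    (h : C.run (ket x) = ket y) {X Y : W' → Bool} (hX : ∀ v, X (f v) = x v)
    (hY : ∀ v, Y (f v) = y v) (hXY : ∀ w, (∀ v, f v ≠ w) → Y w = X w) :
    (C.map f).run (ket X) = ket Y := by
  ext Z
  rw [Circuit.run_map_apply, ket_apply]
  by_cases hZ : ∀ w, (∀ v, f v ≠ w) → Z w = X w
  · have : slice f Z (ket X) = ket x := by
      ext u
      simp only [slice, ket_apply]
      congr 1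
      apply propext
      constructor
      · intro hu; funext v; rw [← hX, ← hu, f.injective.extend_apply]
      · rintro rfl; funext w
        by_cases hw : ∃ v, f v = w
        · obtain ⟨v, rfl⟩ := hw; rw [f.injective.extend_apply, hX]
        · rw [Function.extend_apply' _ _ _ hw, hZ]; intro v hv; exact hw ⟨v, hv⟩
    rw [this, h, ket_apply]
    congr 1
    apply propext
    constructor
    · intro hu; funext w
      by_cases hw : ∃ v, f v = w
      · obtain ⟨v, rfl⟩ := hw; rw [hY, ← hu]
      · have hw : ∀ v, f v ≠ w := fun v hv => hw ⟨v, hv⟩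
        rw [hZ w hw, hXY w hw]
    · rintro rfl; funext v; rw [hY]
  · have : slice f Z (ket X) = 0 := by
      ext u
      simp only [slice, ket_apply, PiLp.zero_apply, ite_eq_right_iff]
      intro hu; exfalso; apply hZ; intro w hw
      rw [← hu, Function.extend_apply' _ _ _ (by rintro ⟨v, hv⟩; exact hw v hv)]
    rw [this, ← Circuit.lin_apply, map_zero, if_neg, PiLp.zero_apply]
    rintro rfl; exact hZ hXY

end Map

/-! ### Layers of diagonal gates and of Hadamard gates -/

section Layers

variable {W : Type} [DecidableEq W]

theorem runList_diag {l : List (Gate W)} (hl : ∀ g ∈ l, g.IsDiag) (ψ : State W) (x : W → Bool) :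
    runList l ψ x = (l.map fun g => g.factor x).prod * ψ x := by
  induction l generalizing ψ with
  | nil => simp
  | cons g l ih =>
    rw [runList_cons, ih (fun g hg => hl g (List.mem_cons_of_mem _ hg)),
      (hl g List.mem_cons_self).apply_eq]
    simp; ring

/-- Diagonal gates that are distributed over `k` slots, such that gates in the same slot act on
disjoint sets of qubits, form a circuit of depth `k`. -/
theorem exists_diag_circuit {ι : Type} [Fintype ι] {k : ℕ} (g : ι → Gate W)
    (hg : ∀ i, (g i).IsDiag) (slot : ι → Fin k)
    (hslot : ∀ i j, i ≠ j → slot i = slot j → Disjoint (g i).support (g j).support) :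
    ∃ C : Circuit W, C.size = Fintype.card ι ∧ C.depth = k ∧
      ∀ ψ x, C.run ψ x = (∏ i, (g i).factor x) * ψ x := by
  classical
  refine ⟨⟨(List.finRange k).map fun c =>
    ((Finset.univ.filter fun i => slot i = c).toList.map g), ?_⟩, ?_, ?_, ?_⟩
  · intro L hL
    obtain ⟨c, -, rfl⟩ := List.mem_map.1 hL
    rw [List.pairwise_map]
    refine List.Pairwise.imp_of_mem (R := fun i j => i ≠ j) ?_ (Finset.nodup_toList _)
    intro i j hi hj hij
    simp only [Finset.mem_toList, Finset.mem_filter, Finset.mem_univ, true_and] at hi hj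
    exact hslot i j hij (hi.trans hj.symm)
  · simp only [Circuit.size, List.map_map, Function.comp_def, List.length_map,
      Finset.length_toList]
    rw [← List.ofFn_eq_map, List.sum_ofFn, ← Finset.card_univ,
      ← Finset.card_eq_sum_card_fiberwise (fun i _ => Finset.mem_univ (slot i))]
  · simp [Circuit.depth]
  · intro ψ x
    rw [Circuit.run_eq, runList_diag]
    · congr 1
      rw [List.map_flatten, List.prod_flatten, List.map_map, List.map_map]
      simp only [Function.comp_def, List.map_map, Finset.prod_map_toList]
      rw [← List.ofFn_eq_map, List.prod_ofFn, Finset.prod_fiberwise]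
    · intro h hh
      simp only [List.mem_flatten, List.mem_map] at hh
      obtain ⟨_, ⟨c, -, rfl⟩, hh⟩ := hh
      obtain ⟨i, -, rfl⟩ := List.mem_map.1 hh
      exact hg i

/-- Hadamard gates on all qubits in `S`, in parallel. -/
def hadLayer (S : Finset W) : Circuit W where
  stages := [S.toList.map Gate.had]
  parallel L hL := by
    obtain rfl := List.mem_singleton.1 hL
    rw [List.pairwise_map]
    refine (Finset.nodup_toList S).imp ?_
    intro i j hij
    simpa [Gate.support] using hij

@[simp] theorem size_hadLayer (S : Finset W) : (hadLayer S).size = S.card := by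
  simp [hadLayer, Circuit.size]

@[simp] theorem depth_hadLayer (S : Finset W) : (hadLayer S).depth = 1 := rfl

/-- The matrix entries of the Hadamard gate. -/
def hadEntry (b c : Bool) : ℂ := (1 / (Real.sqrt 2 : ℂ)) * if b = true ∧ c = true then -1 else 1

theorem runList_had (l : List W) (hl : l.Nodup) (x : W → Bool) (f : (W → Bool) → ℂ)
    (hf : ∀ z, ∀ w ∈ l, ∀ b, f (Function.update z w b) = f z) :
    runList (l.map Gate.had)
      (WithLp.toLp 2 fun z => f z * (l.map fun w => if z w = x w then (1 : ℂ) else 0).prod) =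
    WithLp.toLp 2 fun z => f z * (l.map fun w => hadEntry (z w) (x w)).prod := by
  induction l generalizing f with
  | nil => simp
  | cons a l ih =>
    obtain ⟨ha, hl⟩ := List.nodup_cons.1 hl
    rw [List.map_cons, runList_cons]
    have h1 : ∀ z b, (l.map fun w => if Function.update z a b w = x w then (1 : ℂ) else 0) =
        l.map fun w => if z w = x w then (1 : ℂ) else 0 := by
      intro z b
      refine List.map_congr_left fun w hw => ?_
      rw [Function.update_of_ne (by rintro rfl; exact ha hw)]
    have h2 : (Gate.had a).apply (WithLp.toLp 2 fun z => f z *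
        ((a :: l).map fun w => if z w = x w then (1 : ℂ) else 0).prod) =
        WithLp.toLp 2 fun z => (f z * hadEntry (z a) (x a)) *
          (l.map fun w => if z w = x w then (1 : ℂ) else 0).prod := by
      ext z
      simp only [Gate.apply, List.map_cons, List.prod_cons, Function.update_self, h1,
        hf z a List.mem_cons_self]
      cases hx : x a <;> cases hz : z a <;> simp [hadEntry] <;> ring
    rw [h2, ih hl]
    · ext z; simp [mul_assoc]
    · intro z w hw b
      rw [hf z w (List.mem_cons_of_mem _ hw), Function.update_of_ne (by rintro rfl; exact ha hw)]

/-- A layer of Hadamard gates on a state that is a basis state on the wires in `S`. -/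
theorem run_hadLayer (S : Finset W) (x : W → Bool) (f : (W → Bool) → ℂ)
    (hf : ∀ z, ∀ w ∈ S, ∀ b, f (Function.update z w b) = f z) :
    (hadLayer S).run
      (WithLp.toLp 2 fun z => f z * ∏ w ∈ S, if z w = x w then (1 : ℂ) else 0) =
    WithLp.toLp 2 fun z => f z * ∏ w ∈ S, hadEntry (z w) (x w) := by
  have := runList_had S.toList (Finset.nodup_toList S) x f (by simpa using hf)
  simpa [Circuit.run_eq, hadLayer] using this

theorem run_hadLayer_ket [Fintype W] (S : Finset W) (x : W → Bool) (z : W → Bool) :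
    (hadLayer S).run (ket x) z =
      (if ∀ w, w ∉ S → z w = x w then 1 else 0) * ∏ w ∈ S, hadEntry (z w) (x w) := by
  have h : ket x = WithLp.toLp 2 fun z => (if ∀ w, w ∉ S → z w = x w then 1 else 0) *
      ∏ w ∈ S, if z w = x w then (1 : ℂ) else 0 := by
    ext z
    rw [ket_apply]
    simp only [Finset.prod_ite_zero, Finset.prod_const_one]
    by_cases hz : z = x
    · subst hz; simp
    · rw [if_neg hz]
      symm
      rw [mul_eq_zero]
      by_contra hne
      simp only [ite_eq_right_iff, one_ne_zero, imp_false, not_or, not_not] at hne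
      exact hz (funext fun w => by by_cases hw : w ∈ S; exacts [hne.2 w hw, hne.1 w hw])
  rw [h, run_hadLayer]
  intro z w hw b
  congr 1
  apply propext
  refine forall_congr' fun v => forall_congr' fun hv => ?_
  rw [Function.update_of_ne (by rintro rfl; exact hv hw)]

end Layers

/-! ### Reversible computation of Boolean functions -/

section Comp

variable {V U : Type} [Fintype V] [DecidableEq V] [Fintype U] [DecidableEq U]

/-- The Boolean function `f` is computed, on the inputs that satisfy `P`, by a circuit with at
most `s` gates and at most `d` stages: with the help of clean qubits, it maps `|x⟩|y⟩` to
`|x⟩|y ⊕ f x⟩`. -/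
def CompOn (P : (V → Bool) → Prop) (f : (V → Bool) → U → Bool) (s d : ℕ) : Prop :=
  ∃ (A : Type) (_ : Fintype A) (_ : DecidableEq A) (C : Circuit (V ⊕ (U ⊕ A))),
    C.size ≤ s ∧ C.depth ≤ d ∧ ∀ x y, P x →
      C.run (ket (Sum.elim x (Sum.elim y fun _ => false))) =
        ket (Sum.elim x (Sum.elim (fun u => xor (y u) (f x u)) fun _ => false))

/-- Computation on all inputs. -/
abbrev Comp (f : (V → Bool) → U → Bool) (s d : ℕ) : Prop := CompOn (fun _ => True) f s d

theorem CompOn.mono {P : (V → Bool) → Prop} {f : (V → Bool) → U → Bool} {s d s' d' : ℕ}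
    (h : CompOn P f s d) (hs : s ≤ s') (hd : d ≤ d') : CompOn P f s' d' := by
  obtain ⟨A, i1, i2, C, h1, h2, h3⟩ := h
  exact ⟨A, i1, i2, C, h1.trans hs, h2.trans hd, h3⟩

theorem Comp.congr {f g : (V → Bool) → U → Bool} {s d : ℕ} (h : Comp f s d)
    (hfg : ∀ x u, f x u = g x u) : Comp g s d := by
  have : f = g := funext fun x => funext (hfg x)
  exact this ▸ h

/-- Diagonal gates between inputs and targets, conjugated by Hadamard gates on the targets,
compute `f` if their total phase is `(-1) ^ (z ⬝ f x)`. -/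
theorem compOn_of_phases {P : (V → Bool) → Prop} {f : (V → Bool) → U → Bool} {k : ℕ}
    (g : U → Fin k → Gate (V ⊕ (U ⊕ Empty))) (hg : ∀ u i, (g u i).IsDiag)
    (hslot : ∀ i u u', u ≠ u' → Disjoint (g u i).support (g u' i).support)
    (hf : ∀ x z u, P x → ∏ i, (g u i).factor (Sum.elim x z) =
      if z (Sum.inl u) = true ∧ f x u = true then -1 else 1) :
    CompOn P f ((k + 2) * Fintype.card U) (k + 2) := by
  obtain ⟨D, hD1, hD2, hD3⟩ := exists_diag_circuit (fun p : U × Fin k => g p.1 p.2)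
    (fun p => hg _ _) (fun p => p.2) (by
      rintro ⟨u, i⟩ ⟨u', i'⟩ hne h
      obtain rfl : i = i' := h
      exact hslot i u u' (by rintro rfl; exact hne rfl))
  let S : Finset (V ⊕ (U ⊕ Empty)) := Finset.univ.image fun u => Sum.inr (Sum.inl u)
  have hinj : Function.Injective fun u : U => (Sum.inr (Sum.inl u) : V ⊕ (U ⊕ Empty)) :=
    Sum.inr_injective.comp Sum.inl_injective
  have hS : S.card = Fintype.card U := by
    rw [Finset.card_image_of_injective _ hinj, Finset.card_univ]
  refine ⟨Empty, inferInstance, inferInstance,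
    ((hadLayer S).append D).append (hadLayer S).inv, ?_, ?_, ?_⟩
  · simp [hD1, hS]; apply le_of_eq; ring
  · simp [hD2]; omega
  · intro x y hx
    rw [Circuit.run_append, Circuit.run_append]
    have : D.run ((hadLayer S).run (ket (Sum.elim x (Sum.elim y fun _ => false)))) =
        (hadLayer S).run (ket (Sum.elim x (Sum.elim (fun u => xor (y u) (f x u))
          fun _ => false))) := by
      ext z
      rw [hD3, run_hadLayer_ket, run_hadLayer_ket]
      have h1 : ∀ y' : U → Bool, (∀ w, w ∉ S → z w =
          (Sum.elim x (Sum.elim y' fun _ => false) : V ⊕ (U ⊕ Empty) → Bool) w) ↔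
          ∀ v, z (Sum.inl v) = x v := by
        intro y'
        constructor
        · intro h v; exact h (Sum.inl v) (by simp [S])
        · rintro h (v | u | e) hw
          · exact h v
          · exact (hw (by simp [S])).elim
          · exact e.elim
      simp only [h1]
      split_ifs with hz
      · have hz' : z = Sum.elim x (fun w => z (Sum.inr w)) := by
          funext w; rcases w with v | w
          · exact hz v
          · rfl
        have h2 : ∏ p : U × Fin k, (g p.1 p.2).factor z =
            ∏ u, if z (Sum.inr (Sum.inl u)) = true ∧ f x u = true then (-1 : ℂ) else 1 := by
          rw [Fintype.prod_prod_type]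
          refine Finset.prod_congr rfl fun u _ => ?_
          rw [← hf x (fun w => z (Sum.inr w)) u hx, ← hz']
        rw [h2]
        simp only [S]
        rw [Finset.prod_image (fun a _ b _ h => hinj h),
          Finset.prod_image (fun a _ b _ h => hinj h), one_mul, one_mul, ← Finset.prod_mul_distrib]
        refine Finset.prod_congr rfl fun u _ => ?_
        simp only [hadEntry, Sum.elim_inr, Sum.elim_inl]
        by_cases h3 : z (Sum.inr (Sum.inl u)) = true <;> by_cases h4 : y u = true <;>
          by_cases h5 : f x u = true <;> simp [h3, h4, h5]
      · simp
    rw [this, Circuit.inv_run_run]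

/-- Use of a computed function in a further computation; the intermediate result is computed into
clean qubits and erased afterwards. -/
theorem Comp.bindOn {U₂ : Type} [Fintype U₂] [DecidableEq U₂] {f : (V → Bool) → U → Bool}
    {g : (V ⊕ U → Bool) → U₂ → Bool} {s d s' d' : ℕ} (hf : Comp f s d)
    (hg : CompOn (fun z => ∀ u, z (Sum.inr u) = f (fun v => z (Sum.inl v)) u) g s' d') :
    Comp (fun x => g (Sum.elim x (f x))) (2 * s + s') (2 * d + d') := by
  obtain ⟨A, i1, i2, C, h1, h2, h3⟩ := hf
  obtain ⟨B, j1, j2, D, k1, k2, k3⟩ := hg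
  let e : V ⊕ (U ⊕ A) ↪ V ⊕ (U₂ ⊕ (U ⊕ (A ⊕ B))) :=
    ⟨Sum.elim Sum.inl (Sum.elim (fun u => Sum.inr (Sum.inr (Sum.inl u)))
      fun a => Sum.inr (Sum.inr (Sum.inr (Sum.inl a)))), by
      rintro (v | u | a) (v' | u' | a') h <;> simp_all⟩
  let e' : (V ⊕ U) ⊕ (U₂ ⊕ B) ↪ V ⊕ (U₂ ⊕ (U ⊕ (A ⊕ B))) :=
    ⟨Sum.elim (Sum.elim Sum.inl (fun u => Sum.inr (Sum.inr (Sum.inl u))))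
      (Sum.elim (fun u => Sum.inr (Sum.inl u))
      fun a => Sum.inr (Sum.inr (Sum.inr (Sum.inr a)))), by
      rintro ((v | u) | u | a) ((v' | u') | u' | a') h <;> simp_all⟩
  refine ⟨U ⊕ (A ⊕ B), inferInstance, inferInstance,
    ((C.map e).append (D.map e')).append (C.map e), ?_, ?_, ?_⟩
  · simp; omega
  · simp; omega
  · intro x y _
    rw [Circuit.run_append, Circuit.run_append]
    rw [Circuit.run_map_ket e (h3 x (fun _ => false) trivial)
      (Y := Sum.elim x (Sum.elim y (Sum.elim (f x) fun _ => false)))]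
    rw [Circuit.run_map_ket e' (k3 (Sum.elim x (f x)) y (fun u => rfl))
      (Y := Sum.elim x (Sum.elim (fun u => xor (y u) (g (Sum.elim x (f x)) u))
        (Sum.elim (f x) fun _ => false)))]
    rw [Circuit.run_map_ket e (h3 x (f x) trivial)
      (Y := Sum.elim x (Sum.elim (fun u => xor (y u) (g (Sum.elim x (f x)) u))
        (Sum.elim (fun _ => false) fun _ => false)))]
    · congr 1; funext w; rcases w with v | u | u | a | b <;> rfl
    · rintro (v | u | a) <;> rfl
    · rintro (v | u | a); exacts [rfl, (Bool.xor_self _).symm, rfl]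
    · rintro (v | u | u | a | b) h
      · rfl
      · rfl
      · exact (h (Sum.inr (Sum.inl u)) rfl).elim
      · rfl
      · rfl
    · rintro ((v | u) | u | a) <;> rfl
    · rintro ((v | u) | u | a) <;> rfl
    · rintro (v | u | u | a | b) h
      · rfl
      · exact (h (Sum.inr (Sum.inl u)) rfl).elim
      · rfl
      · rfl
      · rfl
    · rintro (v | u | a) <;> rfl
    · rintro (v | u | a); exacts [rfl, (Bool.false_xor _).symm, rfl]
    · rintro (v | u | u | a | b) h
      · rfl
      · rfl
      · exact (h (Sum.inr (Sum.inl u)) rfl).elim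
      · rfl
      · rfl

theorem Comp.bind {U₂ : Type} [Fintype U₂] [DecidableEq U₂] {f : (V → Bool) → U → Bool}
    {g : (V ⊕ U → Bool) → U₂ → Bool} {s d s' d' : ℕ} (hf : Comp f s d) (hg : Comp g s' d') :
    Comp (fun x => g (Sum.elim x (f x))) (2 * s + s') (2 * d + d') := by
  obtain ⟨B, j1, j2, D, k1, k2, k3⟩ := hg
  exact hf.bindOn ⟨B, j1, j2, D, k1, k2, fun x y _ => k3 x y trivial⟩

/-- A function of some of the inputs. -/
theorem Comp.comap {V' : Type} [Fintype V'] [DecidableEq V'] {f : (V → Bool) → U → Bool} {s d : ℕ}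
    (hf : Comp f s d) (i : V ↪ V') : Comp (fun x => f fun v => x (i v)) s d := by
  obtain ⟨A, i1, i2, C, h1, h2, h3⟩ := hf
  let e : V ⊕ (U ⊕ A) ↪ V' ⊕ (U ⊕ A) :=
    ⟨Sum.map i id, Sum.map_injective.2 ⟨i.injective, Function.injective_id⟩⟩
  refine ⟨A, i1, i2, C.map e, by simpa, by simpa, fun x y _ => ?_⟩
  apply Circuit.run_map_ket e (h3 (fun v => x (i v)) y trivial)
  · rintro (v | u | a) <;> rfl
  · rintro (v | u | a) <;> rfl
  · rintro (v | u | a) h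
    · rfl
    · exact (h (Sum.inr (Sum.inl u)) rfl).elim
    · rfl

/-- Composition of functions. -/
theorem Comp.comp {U₂ : Type} [Fintype U₂] [DecidableEq U₂] {f : (V → Bool) → U → Bool}
    {g : (U → Bool) → U₂ → Bool} {s d s' d' : ℕ} (hg : Comp g s' d') (hf : Comp f s d) :
    Comp (fun x => g (f x)) (2 * s + s') (2 * d + d') :=
  hf.bind (g := fun z => g fun u => z (Sum.inr u)) (hg.comap ⟨Sum.inr, Sum.inr_injective⟩)

/-- Value of a constant or of a wire. -/
def lit (x : V → Bool) : Bool ⊕ V → Bool := Sum.elim id x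

theorem phase_one : phase 1 = -1 := by
  rw [phase, ← Complex.exp_pi_mul_I]; congr 1; ring

theorem phase_two_mul_self : phase 2 * phase 2 = -1 := by
  rw [← phase_one, phase, phase, ← Complex.exp_add]; congr 1; ring

theorem phase_zero : phase 0 = 1 := by
  rw [phase, ← Complex.exp_two_pi_mul_I]; congr 1; ring

/-- Constants and copies of wires. -/
theorem comp_lit (src : U → Bool ⊕ V)
    (hsrc : ∀ u u' v, src u = Sum.inr v → src u' = Sum.inr v → u = u') :
    Comp (fun x u => lit x (src u)) (3 * Fintype.card U) 3 := by
  refine (compOn_of_phases (k := 1) (fun u _ => match src u with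
    | .inl b => .rot (if b then 1 else 0) (Sum.inr (Sum.inl u))
    | .inr v => .crot 1 (Sum.inl v) (Sum.inr (Sum.inl u)) (by simp)) ?_ ?_ ?_)
  · intro u i
    cases src u <;> trivial
  · intro _ u u' hu
    cases h : src u <;> cases h' : src u' <;> simp [Gate.support, hu, Ne.symm hu]
    exact fun hv => (hu (hsrc _ _ _ h (hv ▸ h'))).elim
  · intro x z u _
    rw [Fin.prod_univ_one]
    cases h : src u with
    | inl b => cases b <;> simp [Gate.factor, lit, phase_one, phase_zero]
    | inr v => simp [Gate.factor, lit, phase_one, and_comm]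

theorem comp_xor_wires (a b : U ↪ V) :
    Comp (fun x u => xor (x (a u)) (x (b u))) (4 * Fintype.card U) 4 := by
  refine (compOn_of_phases (k := 2) (fun u i =>
    .crot 1 (Sum.inl (if i = 0 then a u else b u)) (Sum.inr (Sum.inl u)) (by simp)) ?_ ?_ ?_)
  · intros; trivial
  · intro i u u' hu
    simp only [Gate.support]
    split_ifs <;> simp [Ne.symm hu]
  · intro x z u _
    rw [Fin.prod_univ_two]
    simp only [Gate.factor, phase_one]
    cases hz : z (Sum.inl u) <;> cases ha : x (a u) <;> cases hb : x (b u) <;> simp [hz, ha, hb]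

/-- Conjunction: the phase `(-1) ^ (a b c)` is a product of controlled rotations by a quarter turn
between `c` and `a`, `b`, `a ⊕ b`, since `2 a b = a + b - (a ⊕ b)`. -/
theorem comp_and_wires (a b : U ↪ V) :
    Comp (fun x u => x (a u) && x (b u)) (13 * Fintype.card U) 13 := by
  have h := (comp_xor_wires a b).bindOn
    (g := fun z u => z (Sum.inl (a u)) && z (Sum.inl (b u)))
    (compOn_of_phases (k := 3) (fun u i => if i = 0 then
      .crot 2 (Sum.inl (Sum.inl (a u))) (Sum.inr (Sum.inl u)) (by simp) else if i = 1 then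
      .crot 2 (Sum.inl (Sum.inl (b u))) (Sum.inr (Sum.inl u)) (by simp) else
      .crotInv 2 (Sum.inl (Sum.inr u)) (Sum.inr (Sum.inl u)) (by simp)) ?_ ?_ ?_)
  · refine h.mono ?_ ?_ <;> omega
  · intro u i
    split_ifs <;> trivial
  · intro i u u' hu
    split_ifs <;> simp [Gate.support, Ne.symm hu]
  · intro x z u hx
    rw [Fin.prod_univ_three]
    have h0 := phase_ne_zero 2
    have h2 := phase_two_mul_self
    simp only [Gate.factor, if_true, one_ne_zero, if_false, Sum.elim_inl, Sum.elim_inr, hx,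
      show (2 : Fin 3) ≠ 0 by decide, show (2 : Fin 3) ≠ 1 by decide]
    by_cases hz : z (Sum.inl u) = true <;> by_cases ha : x (Sum.inl (a u)) = true <;>
      by_cases hb : x (Sum.inl (b u)) = true <;> simp [h0, h2, hz, ha, hb]

variable {f g : (V → Bool) → U → Bool} {s d s' d' : ℕ}

/-- A bitwise operation on the values of two functions. -/
theorem Comp.binop (hf : Comp f s d) (hg : Comp g s' d') {op : Bool → Bool → Bool} {k : ℕ}
    (hop : Comp (fun (x : (V ⊕ U) ⊕ U → Bool) u => op (x (Sum.inl (Sum.inr u))) (x (Sum.inr u)))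
      (k * Fintype.card U) k) :
    Comp (fun x u => op (f x u) (g x u)) (2 * s + 2 * s' + k * Fintype.card U)
      (2 * d + 2 * d' + k) := by
  have h := hf.bind ((hg.comap ⟨Sum.inl, Sum.inl_injective⟩).bind hop)
  exact h.mono (by omega) (by omega)

theorem Comp.xor (hf : Comp f s d) (hg : Comp g s' d') :
    Comp (fun x u => xor (f x u) (g x u)) (2 * s + 2 * s' + 4 * Fintype.card U)
      (2 * d + 2 * d' + 4) :=
  hf.binop hg (op := fun a b => Bool.xor a b) (comp_xor_wires ⟨fun u => Sum.inl (Sum.inr u),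
    Sum.inl_injective.comp Sum.inr_injective⟩ ⟨Sum.inr, Sum.inr_injective⟩)

theorem Comp.and (hf : Comp f s d) (hg : Comp g s' d') :
    Comp (fun x u => f x u && g x u) (2 * s + 2 * s' + 13 * Fintype.card U)
      (2 * d + 2 * d' + 13) :=
  hf.binop hg (op := fun a b => a && b) (comp_and_wires ⟨fun u => Sum.inl (Sum.inr u),
    Sum.inl_injective.comp Sum.inr_injective⟩ ⟨Sum.inr, Sum.inr_injective⟩)

/-- Two functions side by side. -/
theorem Comp.sumElim {U₂ : Type} [Fintype U₂] [DecidableEq U₂] {h : (V → Bool) → U₂ → Bool}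
    (hf : Comp f s d) (hh : Comp h s' d') :
    Comp (fun x => Sum.elim (f x) (h x)) (s + s') (d + d') := by
  obtain ⟨A, i1, i2, C, h1, h2, h3⟩ := hf
  obtain ⟨B, j1, j2, D, k1, k2, k3⟩ := hh
  let e : V ⊕ (U ⊕ A) ↪ V ⊕ ((U ⊕ U₂) ⊕ (A ⊕ B)) :=
    ⟨Sum.map id (Sum.map Sum.inl Sum.inl), by
      rintro (v | u | a) (v' | u' | a') h <;> simp_all⟩
  let e' : V ⊕ (U₂ ⊕ B) ↪ V ⊕ ((U ⊕ U₂) ⊕ (A ⊕ B)) :=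
    ⟨Sum.map id (Sum.map Sum.inr Sum.inr), by
      rintro (v | u | a) (v' | u' | a') h <;> simp_all⟩
  refine ⟨A ⊕ B, inferInstance, inferInstance, (C.map e).append (D.map e'), ?_, ?_, ?_⟩
  · simp; omega
  · simp; omega
  · intro x y _
    rw [Circuit.run_append]
    rw [Circuit.run_map_ket e (h3 x (fun u => y (Sum.inl u)) trivial)
      (Y := Sum.elim x (Sum.elim (Sum.elim (fun u => Bool.xor (y (Sum.inl u)) (f x u))
        (fun u => y (Sum.inr u))) fun _ => false))]
    rw [Circuit.run_map_ket e' (k3 x (fun u => y (Sum.inr u)) trivial)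
      (Y := Sum.elim x (Sum.elim (Sum.elim (fun u => Bool.xor (y (Sum.inl u)) (f x u))
        (fun u => Bool.xor (y (Sum.inr u)) (h x u))) fun _ => false))]
    · congr 1; funext w; rcases w with v | (u | u) | a | b <;> rfl
    · rintro (v | u | a) <;> rfl
    · rintro (v | u | a) <;> rfl
    · rintro (v | (u | u) | a | b) h <;> first | rfl | exact (h (Sum.inr (Sum.inl u)) rfl).elim
    · rintro (v | u | a) <;> rfl
    · rintro (v | u | a) <;> rfl
    · rintro (v | (u | u) | a | b) h <;> first | rfl | exact (h (Sum.inr (Sum.inl u)) rfl).elim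

/-- Selection (and padding with constants) of output bits. -/
theorem Comp.select {U₂ : Type} [Fintype U₂] [DecidableEq U₂] (hf : Comp f s d)
    (src : U₂ → Bool ⊕ U) (hsrc : ∀ u u' v, src u = Sum.inr v → src u' = Sum.inr v → u = u') :
    Comp (fun x u => lit (f x) (src u)) (2 * s + 3 * Fintype.card U₂) (2 * d + 3) :=
  (comp_lit src hsrc).comp hf

/-- Every Boolean function is computed by some circuit. -/
theorem exists_comp (f : (V → Bool) → U → Bool) : ∃ s d, Comp f s d := by
  classical
  -- An indicator function of one string is a conjunction of literals.
  have h1 : ∀ (a : V → Bool) (l : List V), ∃ s d, Comp (U := Unit)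
      (fun x _ => decide (∀ v ∈ l, x v = a v)) s d := by
    intro a l
    induction l with
    | nil => exact ⟨_, _, (comp_lit (fun _ => Sum.inl true) (by simp)).congr (by simp [lit])⟩
    | cons v l ih =>
      obtain ⟨s, d, h⟩ := ih
      have h' : Comp (V := V) (U := Unit) (fun x _ => Bool.xor (x v) (!a v)) _ _ :=
        (comp_lit (U := Unit) (V := V) (fun _ => Sum.inr v) (by simp)).xor
          (comp_lit (U := Unit) (V := V) (fun _ => Sum.inl (!a v)) (by simp))
      refine ⟨_, _, (h'.and h).congr ?_⟩
      intro x _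
      by_cases hv : x v = a v
      · simp [hv]
      · have : (x v ^^ !a v) = false := by
          revert hv; cases x v <;> cases a v <;> simp
        simp [this, hv]
  have h2 : ∀ (T : Finset (V → Bool)) (F : (V → Bool) → U → Bool), ∃ s d,
      Comp (fun x u => if x ∈ T then F x u else false) s d := by
    intro T F
    induction T using Finset.induction_on with
    | empty => exact ⟨_, _, (comp_lit (fun _ => Sum.inl false) (by simp)).congr (by simp [lit])⟩
    | insert a T ha ih =>
      obtain ⟨s, d, h⟩ := ih
      have h4 : ∃ s d, Comp (fun x u => decide (x = a) && F a u) s d := by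
        have h5 : ∀ R : Finset U, ∃ s d,
            Comp (fun x u => decide (x = a) && (F a u && decide (u ∈ R))) s d := by
          intro R
          induction R using Finset.induction_on with
          | empty =>
            exact ⟨_, _, (comp_lit (fun _ => Sum.inl false) (by simp)).congr (by simp [lit])⟩
          | insert w R hw ih =>
            obtain ⟨s, d, h⟩ := ih
            obtain ⟨s1, d1, hi⟩ := h1 a Finset.univ.toList
            have h6 := (hi.select (fun u : U => if u = w ∧ F a w = true then Sum.inr () else
              Sum.inl false) (by
                intro u u' _ hu hu'
                split_ifs at hu hu' with q q'
                exact q.1.trans q'.1.symm))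
            refine ⟨_, _, (h.xor h6).congr ?_⟩
            intro x u
            have hx : (∀ v ∈ Finset.univ.toList, x v = a v) ↔ x = a := by
              simp [funext_iff]
            simp only [hx]
            by_cases hu : u = w
            · subst hu; cases hF : F a u <;> simp [lit, hw]
            · simp [lit, hu]
        obtain ⟨s, d, h⟩ := h5 Finset.univ
        exact ⟨s, d, h.congr (by simp)⟩
      obtain ⟨s', d', h'⟩ := h4
      refine ⟨_, _, (h.xor h').congr ?_⟩
      intro x u
      by_cases hx : x = a
      · subst hx; simp [ha]
      · simp [hx]
  obtain ⟨s, d, h⟩ := h2 Finset.univ f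
  exact ⟨s, d, h.congr (by simp)⟩

end Comp

/-! ### Reversible arithmetic -/

section Adder

variable {w : ℕ}

/-- One step of the parallel prefix computation of carries. The bits `z (inl i)` and `z (inr i)`
say whether a window of positions that ends in `i` generates or propagates a carry; the step
combines windows at distance `s`. -/
def prefixStep (s : ℕ) (z : Fin w ⊕ Fin w → Bool) : Fin w ⊕ Fin w → Bool :=
  Sum.elim
    (fun i => xor (z (Sum.inl i))
      (z (Sum.inr i) && if s ≤ i then z (Sum.inl ⟨i - s, by omega⟩) else false))
    (fun i => z (Sum.inr i) && if s ≤ i then z (Sum.inr ⟨i - s, by omega⟩) else false)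

theorem comp_prefixStep (s : ℕ) : Comp (prefixStep (w := w) s) (85 * w) 85 := by
  have hG : Comp (V := Fin w ⊕ Fin w) (U := Fin w) (fun z i => z (Sum.inl i)) _ _ :=
    comp_lit (fun i => Sum.inr (Sum.inl i)) (by simp_all)
  have hP : Comp (V := Fin w ⊕ Fin w) (U := Fin w) (fun z i => z (Sum.inr i)) _ _ :=
    comp_lit (fun i => Sum.inr (Sum.inr i)) (by simp_all)
  have hS : ∀ j : Fin w → Fin w ⊕ Fin w, Function.Injective j →
      Comp (V := Fin w ⊕ Fin w) (U := Fin w)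
        (fun z i => if s ≤ i then z (j ⟨i - s, by omega⟩) else false)
        (3 * Fintype.card (Fin w)) 3 := by
    intro j hj
    refine Comp.congr (comp_lit (fun i : Fin w => if s ≤ i then
      Sum.inr (j ⟨i - s, by omega⟩) else Sum.inl false) ?_) ?_
    · intro u u' v hu hu'
      split_ifs at hu hu' with h1 h2
      have := hj ((Sum.inr_injective hu).trans (Sum.inr_injective hu').symm)
      simp only [Fin.mk.injEq] at this
      ext; omega
    · intro x u
      split_ifs <;> rfl
  have := (hG.xor (hP.and (hS Sum.inl Sum.inl_injective))).sumElim
    (hP.and (hS Sum.inr Sum.inr_injective))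
  simp only [Fintype.card_fin] at this
  exact this.mono (by omega) (by omega)

/-- `r` steps of the parallel prefix computation, with distances `s, 2 s, 4 s, …`. -/
def prefixIter : ℕ → ℕ → (Fin w ⊕ Fin w → Bool) → Fin w ⊕ Fin w → Bool
  | 0, _, z => z
  | r + 1, s, z => prefixIter r (2 * s) (prefixStep s z)

theorem comp_prefixIter (r s : ℕ) :
    Comp (prefixIter (w := w) r s) (170 * (w * r) + 6 * w) (170 * r + 3) := by
  induction r generalizing s with
  | zero =>
    have := comp_lit (V := Fin w ⊕ Fin w) (U := Fin w ⊕ Fin w) Sum.inr (by simp_all)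
    simp only [Fintype.card_sum, Fintype.card_fin] at this
    exact this.mono (by omega) (by omega)
  | succ r ih => exact ((ih (2 * s)).comp (comp_prefixStep s)).mono (by ring_nf; omega) (by omega)

/-- The parallel prefix steps solve the recursion `c (i + 1) = g i ⊕ p i c i` of the carries: after `r`
steps the windows have length `2 ^ r s`, and those of length at least `w` start with the carry `0`. -/
theorem prefixIter_carry (c : ℕ → Bool) (hc : c 0 = false) (r s : ℕ) (z : Fin w ⊕ Fin w → Bool)
    (hz : ∀ i : Fin w, c (i + 1) = xor (z (Sum.inl i)) (z (Sum.inr i) && c (i + 1 - s)))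
    (hw : w ≤ 2 ^ r * s) (i : Fin w) : prefixIter r s z (Sum.inl i) = c (i + 1) := by
  induction r generalizing s z with
  | zero =>
    rw [hz i, show (i : ℕ) + 1 - s = 0 by omega, hc]; simp [prefixIter]
  | succ r ih =>
    refine ih (2 * s) _ (fun i => ?_) (by rw [pow_succ] at hw; linarith)
    rw [hz i]
    simp only [prefixStep, Sum.elim_inl, Sum.elim_inr]
    split_ifs with h
    · have := hz ⟨i - s, by omega⟩
      simp only at this
      rw [show (i : ℕ) - s + 1 = i + 1 - s by omega] at this
      rw [this, show (i : ℕ) + 1 - s - s = i + 1 - 2 * s by omega]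
      cases z (Sum.inl i) <;> cases z (Sum.inr i) <;> simp
    · rw [show (i : ℕ) + 1 - s = 0 by omega, hc]; simp

theorem testBit_ofBits_add (x y : Fin w → Bool) (i : Fin w) :
    (Nat.ofBits x + Nat.ofBits y).testBit i =
      xor (xor (x i) (y i))
        (BitVec.carry i (BitVec.ofNat w (Nat.ofBits x)) (BitVec.ofNat w (Nat.ofBits y)) false) := by
  have h := BitVec.getLsbD_add (w := w) i.isLt (BitVec.ofNat w (Nat.ofBits x))
    (BitVec.ofNat w (Nat.ofBits y))
  rw [← BitVec.ofNat_add, BitVec.getLsbD_ofNat, BitVec.getLsbD_ofNat, BitVec.getLsbD_ofNat] at h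
  simpa using h

/-- Addition modulo `2 ^ w` in logarithmic depth. -/
theorem comp_add {r : ℕ} (hr : 1 ≤ r) (hw : w ≤ 2 ^ r) :
    Comp (fun z : Fin w ⊕ Fin w → Bool => bits w
      (Nat.ofBits (fun i => z (Sum.inl i)) + Nat.ofBits fun i => z (Sum.inr i)))
      (900 * (w * r)) (900 * r) := by
  let a : Fin w ↪ Fin w ⊕ Fin w := ⟨Sum.inl, Sum.inl_injective⟩
  let b : Fin w ↪ Fin w ⊕ Fin w := ⟨Sum.inr, Sum.inr_injective⟩
  have h := (comp_xor_wires a b).xor ((((comp_prefixIter r 1).comp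
    ((comp_and_wires a b).sumElim (comp_xor_wires a b))).select
      (fun i : Fin w => if h : 1 ≤ (i : ℕ) then Sum.inr (Sum.inl ⟨i - 1, by omega⟩)
        else Sum.inl false) (by
          intro u u' v hu hu'
          split_ifs at hu hu'
          have := Sum.inl_injective ((Sum.inr_injective hu).trans (Sum.inr_injective hu').symm)
          simp only [Fin.mk.injEq] at this
          ext; omega)))
  simp only [Fintype.card_fin] at h
  refine (Comp.congr (h.mono ?_ ?_) ?_)
  · have : w ≤ w * r := Nat.le_mul_of_pos_right w hr
    omega
  · omega
  · intro z i
    rw [bits, testBit_ofBits_add]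
    congr 1
    set c : ℕ → Bool := fun j => BitVec.carry j
      (BitVec.ofNat w (Nat.ofBits fun i => z (Sum.inl i)))
      (BitVec.ofNat w (Nat.ofBits fun i => z (Sum.inr i))) false
    have hc : c 0 = false := by simp [c]
    have key := prefixIter_carry c hc r 1
      (Sum.elim (fun u => z (a u) && z (b u)) (fun u => xor (z (a u)) (z (b u)))) (by
        intro i
        simp only [c, BitVec.carry_succ, BitVec.getLsbD_ofNat, Nat.testBit_ofBits_lt _ _ i.isLt,
          i.isLt, a, b, Sum.elim_inl, Sum.elim_inr, Function.Embedding.coeFn_mk, Bool.atLeastTwo,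
          Nat.add_sub_cancel]
        cases z (Sum.inl i) <;> cases z (Sum.inr i) <;> simp) (by simpa using hw)
    split_ifs with hi
    · simp only [lit, Sum.elim_inr]
      rw [key]
      simp only
      rw [Nat.sub_add_cancel hi]
    · rw [show (i : ℕ) = 0 by omega]; exact hc.symm

end Adder

theorem ofBits_bits (w a : ℕ) : Nat.ofBits (bits w a) = a % 2 ^ w := Nat.ofBits_testBit a w

theorem bits_congr {w a b : ℕ} (h : a % 2 ^ w = b % 2 ^ w) : bits w a = bits w b := by
  funext i
  have := congrArg (fun m => m.testBit i) h
  simpa [bits, Nat.testBit_mod_two_pow, i.isLt] using this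

theorem bits_ofBits {w : ℕ} (x : Fin w → Bool) : bits w (Nat.ofBits x) = x := by
  funext i; simp [bits]

section CompN

variable {V : Type} [Fintype V] [DecidableEq V]

/-- The last `w` binary digits of the number `F x` are computed from the bit string `x` by a
circuit with at most `k u` gates and at most `k t` stages. The units `u`, `t` are chosen so that
each step of the arithmetic costs a constant number of units. -/
def CompN (u t w : ℕ) (F : (V → Bool) → ℕ) (k : ℕ) : Prop :=
  Comp (fun x => bits w (F x)) (k * u) (k * t)

/-- Units for arithmetic on numbers with at most `m` digits: `u` is at least `m log m` and `t`
is at least `log m`. -/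
structure CostUnit (u t m r : ℕ) : Prop where
  one_le : 1 ≤ r
  le_two_pow : m ≤ 2 ^ r
  mul_le : m * r ≤ u
  le : r ≤ t

theorem CostUnit.le_u {u t m r w : ℕ} (h : CostUnit u t m r) (hw : w ≤ m) : w ≤ u :=
  hw.trans ((Nat.le_mul_of_pos_right m h.one_le).trans h.mul_le)

theorem CostUnit.one_le_t {u t m r : ℕ} (h : CostUnit u t m r) : 1 ≤ t := h.one_le.trans h.le

variable {u t m r w : ℕ} {F G : (V → Bool) → ℕ} {k l : ℕ}

theorem CompN.mono (hF : CompN u t w F k) (h : k ≤ l) : CompN u t w F l :=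
  CompOn.mono hF (Nat.mul_le_mul_right _ h) (Nat.mul_le_mul_right _ h)

/-- Only the last `w` digits of the result matter. -/
theorem CompN.congr (hF : CompN u t w F k) (h : ∀ x, F x % 2 ^ w = G x % 2 ^ w) :
    CompN u t w G k :=
  Comp.congr hF fun x i => by rw [bits_congr (h x)]

theorem CostUnit.const (hu : CostUnit u t m r) (hw : w ≤ m) (c : ℕ) :
    CompN (V := V) u t w (fun _ => c) 3 := by
  have h := comp_lit (V := V) (U := Fin w) (fun i => Sum.inl (bits w c i)) (by simp)
  refine CompOn.mono h ?_ ?_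
  · have := hu.le_u hw; simp; omega
  · have := hu.one_le_t; omega

/-- A number whose digits are constants or distinct wires. -/
theorem CostUnit.wires (hu : CostUnit u t m r) (hw : w ≤ m) (src : Fin w → Bool ⊕ V)
    (hsrc : ∀ i i' v, src i = Sum.inr v → src i' = Sum.inr v → i = i') :
    CompN u t w (fun x => Nat.ofBits fun i => lit x (src i)) 3 := by
  refine Comp.congr (CompOn.mono (comp_lit src hsrc) ?_ ?_) ?_
  · have := hu.le_u hw; simp; omega
  · have := hu.one_le_t; omega
  · intro x i; rw [bits_ofBits]

/-- The content of a register of `w'` qubits. -/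
theorem CostUnit.register (hu : CostUnit u t m r) (hw : w ≤ m) {w' : ℕ} (e : Fin w' ↪ V) :
    CompN u t w (fun x => Nat.ofBits fun i => x (e i)) 3 := by
  refine (hu.wires hw (fun i : Fin w => if h : (i : ℕ) < w' then Sum.inr (e ⟨i, h⟩)
    else Sum.inl false) ?_).congr ?_
  · intro i i' v hi hi'
    split_ifs at hi hi'
    have := e.injective ((Sum.inr_injective hi).trans (Sum.inr_injective hi').symm)
    simp only [Fin.mk.injEq] at this
    ext; exact this
  · intro x
    apply Nat.eq_of_testBit_eq
    intro i
    simp only [Nat.testBit_mod_two_pow]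
    by_cases hi : i < w
    · simp only [hi, decide_true, Bool.true_and, Nat.testBit_ofBits]
      split_ifs <;> simp_all [lit]
    · simp [hi]

theorem CompN.add (hu : CostUnit u t m r) (hw : w ≤ m) (hF : CompN u t w F k)
    (hG : CompN u t w G l) : CompN u t w (fun x => F x + G x) (2 * k + 2 * l + 900) := by
  have h := (comp_add hu.one_le (hw.trans hu.le_two_pow)).comp (Comp.sumElim hF hG)
  refine Comp.congr (h.mono ?_ ?_) ?_
  · have := (Nat.mul_le_mul_right r hw).trans hu.mul_le
    ring_nf at this ⊢; omega
  · have := hu.le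
    ring_nf; omega
  · intro x i
    refine congrFun (bits_congr ?_) i
    simp only [Sum.elim_inl, Sum.elim_inr]
    rw [ofBits_bits, ofBits_bits, ← Nat.add_mod]

theorem Comp.not {U : Type} [Fintype U] [DecidableEq U] {f : (V → Bool) → U → Bool} {s d : ℕ}
    (hf : Comp f s d) : Comp (fun x u => !f x u) (2 * s + 10 * Fintype.card U) (2 * d + 10) :=
  Comp.congr ((hf.xor (comp_lit (fun _ => Sum.inl true) (by simp))).mono (by omega) (by omega))
    (by simp [lit])

theorem not_bits (w a : ℕ) (i : Fin w) : (!bits w a i) = bits w (2 ^ w - 1 - a % 2 ^ w) i := by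
  have h : a % 2 ^ w < 2 ^ w := Nat.mod_lt _ (by positivity)
  rw [bits, bits, show 2 ^ w - 1 - a % 2 ^ w = 2 ^ w - (a % 2 ^ w + 1) by omega,
    Nat.testBit_two_pow_sub_succ h]
  simp [Nat.testBit_mod_two_pow]

/-- Subtraction, as the complement of a sum with the complement. -/
theorem CompN.sub (hu : CostUnit u t m r) (hw : w ≤ m) (hF : CompN u t w F k)
    (hG : CompN u t w G l) (hGF : ∀ x, G x ≤ F x) :
    CompN u t w (fun x => F x - G x) (8 * k + 4 * l + 1850) := by
  have hwu := hu.le_u hw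
  have h1 := hu.one_le_t
  have h2 : CompN u t w (fun x => 2 ^ w - 1 - F x % 2 ^ w) (2 * k + 10) := by
    refine Comp.congr (CompOn.mono (Comp.not hF) ?_ ?_) (fun x i => not_bits w _ i)
    · simp; nlinarith
    · nlinarith
  have h3 := h2.add hu hw hG
  refine Comp.congr (CompOn.mono (Comp.not h3) ?_ ?_) (fun x i => (not_bits w _ i).trans ?_)
  · simp; nlinarith
  · nlinarith
  · refine congrFun (bits_congr ?_) i
    obtain ⟨c, hc⟩ := Nat.exists_eq_add_of_le (hGF x)
    have hM : 0 < 2 ^ w := by positivity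
    simp only [hc, Nat.add_sub_cancel_left]
    set M := 2 ^ w
    set T := M - 1 - (G x + c) % M + G x with hT
    have h4 : (G x + c) % M < M := Nat.mod_lt _ hM
    have h5 : T % M < M := Nat.mod_lt _ hM
    have h6 := Nat.mod_add_div (G x + c) M
    have h7 : T + (c + 1) = M * ((G x + c) / M + 1) := by
      rw [mul_add, mul_one]; omega
    have h8 : T % M + (c + 1) ≡ 0 [MOD M] :=
      ((Nat.mod_modEq T M).add_right (c + 1)).trans (by
        rw [h7]; exact (Nat.modEq_zero_iff_dvd.2 (dvd_mul_right _ _)))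
    refine Nat.ModEq.add_right_cancel' (T % M + 1) ?_
    rw [show M - 1 - T % M + (T % M + 1) = M by omega, show c + (T % M + 1) = T % M + (c + 1) by ring]
    exact (Nat.modEq_zero_iff_dvd.2 dvd_rfl).trans h8.symm

theorem CompN.shiftRight (hu : CostUnit u t m r) (hw : w ≤ m) (c : ℕ)
    (hF : CompN u t (w + c) F k) : CompN u t w (fun x => F x / 2 ^ c) (2 * k + 3) := by
  have h := Comp.select hF (fun i : Fin w => Sum.inr ⟨i + c, by omega⟩) (by
    intro i i' v hi hi'
    have := (Sum.inr_injective hi).trans (Sum.inr_injective hi').symm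
    simp only [Fin.mk.injEq] at this
    ext; omega)
  refine Comp.congr (h.mono ?_ ?_) ?_
  · have := hu.le_u hw; simp; nlinarith
  · have := hu.one_le_t; nlinarith
  · intro x i
    simp [lit, bits, Nat.testBit_div_two_pow]

theorem CompN.shiftLeft (hu : CostUnit u t m r) (hw : w ≤ m) (c : ℕ)
    (hF : CompN u t w F k) : CompN u t w (fun x => F x * 2 ^ c) (2 * k + 3) := by
  have h := Comp.select hF (fun i : Fin w => if c ≤ i then Sum.inr ⟨i - c, by omega⟩ else
    Sum.inl false) (by
    intro i i' v hi hi'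
    split_ifs at hi hi'
    have := (Sum.inr_injective hi).trans (Sum.inr_injective hi').symm
    simp only [Fin.mk.injEq] at this
    ext; omega)
  refine Comp.congr (h.mono ?_ ?_) ?_
  · have := hu.le_u hw; simp; nlinarith
  · have := hu.one_le_t; nlinarith
  · intro x i
    rw [bits]
    simp only [mul_comm _ (2 ^ c), Nat.testBit_two_pow_mul]
    split_ifs with hi
    · simp [lit, bits, hi]
    · simp [lit, hi]

/-- A number with at most `w'` digits, seen as a number with more or fewer digits. -/
theorem CompN.resize (hu : CostUnit u t m r) (hw : w ≤ m) {w' : ℕ}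
    (hF : CompN u t w' F k) (hF' : ∀ x, F x < 2 ^ w') : CompN u t w F (2 * k + 3) := by
  have h := Comp.select hF (fun i : Fin w => if h : (i : ℕ) < w' then Sum.inr ⟨i, h⟩ else
    Sum.inl false) (by
    intro i i' v hi hi'
    split_ifs at hi hi'
    have := (Sum.inr_injective hi).trans (Sum.inr_injective hi').symm
    simp only [Fin.mk.injEq] at this
    ext; omega)
  refine Comp.congr (h.mono ?_ ?_) ?_
  · have := hu.le_u hw; simp; nlinarith
  · have := hu.one_le_t; nlinarith
  · intro x i
    rw [bits]
    split_ifs with hi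
    · simp [lit, bits]
    · simp only [lit, Sum.elim_inl, id]
      rw [Nat.testBit_lt_two_pow]
      exact (hF' x).trans_le (Nat.pow_le_pow_right (by norm_num) (by omega))

theorem CompN.mod (hu : CostUnit u t m r) (hw : w ≤ m) {w' : ℕ} (hF : CompN u t w' F k) :
    CompN u t w (fun x => F x % 2 ^ w') (2 * k + 3) :=
  (CompN.congr (G := fun x => F x % 2 ^ w') hF (by simp)).resize hu hw
    (fun _ => Nat.mod_lt _ (by positivity))

/-- A circuit that writes `h x` onto clean qubits can be followed by a copy and run backwards. -/
theorem comp_of_run {B U : Type} [Fintype B] [DecidableEq B] [Fintype U] [DecidableEq U]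
    (D : Circuit (V ⊕ B)) (h : (V → Bool) → B → Bool)
    (hD : ∀ x, D.run (ket (Sum.elim x fun _ => false)) = ket (Sum.elim x (h x))) (i : U ↪ B) :
    Comp (fun x u => h x (i u)) (2 * D.size + 3 * Fintype.card U) (2 * D.depth + 3) := by
  obtain ⟨A, i1, i2, C, h1, h2, h3⟩ := comp_lit (V := B) (U := U) (fun u => Sum.inr (i u))
    (fun u u' v hu hu' => i.injective ((Sum.inr_injective hu).trans (Sum.inr_injective hu').symm))
  let e : V ⊕ B ↪ V ⊕ (U ⊕ (B ⊕ A)) :=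
    ⟨Sum.map id (fun b => Sum.inr (Sum.inl b)), by rintro (v | u) (v' | u') h <;> simp_all⟩
  let e' : B ⊕ (U ⊕ A) ↪ V ⊕ (U ⊕ (B ⊕ A)) :=
    ⟨Sum.elim (fun b => Sum.inr (Sum.inr (Sum.inl b)))
      (Sum.elim (fun u => Sum.inr (Sum.inl u)) fun a => Sum.inr (Sum.inr (Sum.inr a))), by
      rintro (v | u | a) (v' | u' | a') h <;> simp_all⟩
  refine ⟨B ⊕ A, inferInstance, inferInstance,
    ((D.map e).append (C.map e')).append (D.inv.map e), ?_, ?_, ?_⟩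
  · simp; omega
  · simp; omega
  · intro x y _
    have hD' : D.inv.run (ket (Sum.elim x (h x))) = ket (Sum.elim x fun _ => false) := by
      rw [← hD, Circuit.inv_run_run]
    rw [Circuit.run_append, Circuit.run_append]
    rw [Circuit.run_map_ket e (hD x)
      (Y := Sum.elim x (Sum.elim y (Sum.elim (h x) fun _ => false)))]
    rw [Circuit.run_map_ket e' (h3 (h x) y trivial)
      (Y := Sum.elim x (Sum.elim (fun u => xor (y u) (h x (i u))) (Sum.elim (h x) fun _ => false)))]
    rw [Circuit.run_map_ket e hD'
      (Y := Sum.elim x (Sum.elim (fun u => xor (y u) (h x (i u)))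
        (Sum.elim (fun _ => false) fun _ => false)))]
    · congr 1; funext w; rcases w with v | u | b | a <;> rfl
    · rintro (v | b) <;> rfl
    · rintro (v | b) <;> rfl
    · rintro (v | u | b | a) h
      · rfl
      · rfl
      · exact (h (Sum.inr b) rfl).elim
      · rfl
    · rintro (v | u | a) <;> rfl
    · rintro (v | u | a) <;> rfl
    · rintro (v | u | b | a) h
      · rfl
      · exact (h (Sum.inr (Sum.inl u)) rfl).elim
      · rfl
      · rfl
    · rintro (v | b) <;> rfl
    · rintro (v | b) <;> rfl
    · rintro (v | u | b | a) h
      · rfl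
      · rfl
      · exact (h (Sum.inr b) rfl).elim
      · rfl

/-- A multiplication circuit, made to work with arbitrary initial contents of the product
register. -/
theorem HasMulCircuit.comp {n M s d : ℕ} (hM : HasMulCircuit n M s d) :
    Comp (fun x : Fin n → Bool => bits (M.size + n) (M * Nat.ofBits x))
      (2 * s + 9 * (M.size + n)) (2 * d + 9) := by
  obtain ⟨c, C, h1, h2, h3⟩ := hM
  obtain ⟨A, i1, i2, D, k1, k2, k3⟩ := comp_lit (V := Empty) (U := Fin M.size)
    (fun i => Sum.inl (bits M.size M i)) (by simp)
  let e : Empty ⊕ (Fin M.size ⊕ A) ↪ Fin n ⊕ (Fin (M.size + n) ⊕ (Fin M.size ⊕ (Fin c ⊕ A))) :=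
    ⟨Sum.elim Empty.elim (Sum.elim (fun b => Sum.inr (Sum.inr (Sum.inl b)))
      fun a => Sum.inr (Sum.inr (Sum.inr (Sum.inr a)))), by
      rintro (v | u | a) (v' | u' | a') h <;> first | exact v.elim | exact v'.elim | simp_all⟩
  let e' : MulWires n M c ↪ Fin n ⊕ (Fin (M.size + n) ⊕ (Fin M.size ⊕ (Fin c ⊕ A))) :=
    ⟨Sum.elim (fun b => Sum.inr (Sum.inr (Sum.inl b))) (Sum.elim Sum.inl
      (Sum.elim (fun u => Sum.inr (Sum.inl u)) fun a => Sum.inr (Sum.inr (Sum.inr (Sum.inl a))))), by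
      rintro (v | u | a | b) (v' | u' | a' | b') h <;> simp_all⟩
  have h := comp_of_run ((D.map e).append (C.map e'))
    (fun x => Sum.elim (bits (M.size + n) (M * Nat.ofBits x))
      (Sum.elim (bits M.size M) fun _ => false)) ?_
    (⟨Sum.inl, Sum.inl_injective⟩ : Fin (M.size + n) ↪ _)
  · refine CompOn.mono h ?_ ?_
    · simp at k1 ⊢; omega
    · simp; omega
  · intro x
    rw [Circuit.run_append]
    rw [Circuit.run_map_ket e (k3 Empty.elim (fun _ => false) trivial)
      (Y := Sum.elim x (Sum.elim (fun _ => false) (Sum.elim (bits M.size M) fun _ => false)))]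
    · refine Circuit.run_map_ket e' (h3 (Nat.ofBits x) (Nat.ofBits_lt_two_pow x)) ?_ ?_ ?_
      · rintro (v | u | a | b)
        · rfl
        · exact (congrFun (bits_ofBits x) u).symm
        · exact (Nat.zero_testBit _).symm
        · rfl
      · rintro (v | u | a | b)
        · rfl
        · exact (congrFun (bits_ofBits x) u).symm
        · rfl
        · rfl
      · rintro (v | u | a | b | b) h
        · rfl
        · exact (h (Sum.inr (Sum.inr (Sum.inl u))) rfl).elim
        · rfl
        · rfl
        · rfl
    · rintro (v | u | a); exacts [v.elim, rfl, rfl]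
    · rintro (v | u | a); exacts [v.elim, (Bool.false_xor _).symm, rfl]
    · rintro (v | u | a | b | b) h
      · rfl
      · rfl
      · exact (h (Sum.inr (Sum.inl a)) rfl).elim
      · rfl
      · rfl

/-- Multiplication by `M`, if the cost of the multiplication circuit is at most one unit. -/
theorem CompN.mul (hu : CostUnit u t m r) (hw : w ≤ m) {n M s d : ℕ} (hM : HasMulCircuit n M s d)
    (hMm : M.size + n ≤ m) (hs : s ≤ u) (hd : d ≤ t) (hF : CompN u t n F k) (hFn : ∀ x, F x < 2 ^ n) :
    CompN u t w (fun x => M * F x) (4 * k + 25) := by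
  have h : CompN u t (M.size + n) (fun x => M * F x) (2 * k + 11) := by
    refine Comp.congr (CompOn.mono (hM.comp.comp hF) ?_ ?_) ?_
    · have := hu.le_u hMm; nlinarith
    · have := hu.one_le_t; nlinarith
    · intro x i; rw [ofBits_bits, Nat.mod_eq_of_lt (hFn x)]
  refine (h.resize hu hw fun x => ?_).mono (by omega)
  rw [pow_add]
  exact Nat.mul_lt_mul'' (Nat.lt_size_self M) (hFn x)

end CompN

/-! ### Phases -/

/-- The phase `e ^ (2 π i x)`. -/
def cis (x : ℝ) : ℂ := Complex.exp (2 * Real.pi * Complex.I * x)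

theorem cis_add (x y : ℝ) : cis (x + y) = cis x * cis y := by
  rw [cis, cis, cis, ← Complex.exp_add]; congr 1; push_cast; ring

theorem cis_zero : cis 0 = 1 := by simp [cis]

theorem cis_neg (x : ℝ) : cis (-x) = (cis x)⁻¹ := by
  rw [cis, cis, ← Complex.exp_neg]; congr 1; push_cast; ring

theorem cis_intCast (k : ℤ) : cis k = 1 := by
  rw [cis, Complex.exp_eq_one_iff]
  exact ⟨k, by push_cast; ring⟩

theorem cis_natCast (k : ℕ) : cis k = 1 := by exact_mod_cast cis_intCast k

theorem cis_add_intCast (x : ℝ) (k : ℤ) : cis (x + k) = cis x := by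
  rw [cis_add, cis_intCast, mul_one]

theorem norm_cis (x : ℝ) : ‖cis x‖ = 1 := by
  rw [cis, show 2 * (Real.pi : ℂ) * Complex.I * x = ((2 * Real.pi * x : ℝ) : ℂ) * Complex.I by
    push_cast; ring, Complex.norm_exp_ofReal_mul_I]

theorem cis_sum {ι : Type} (s : Finset ι) (f : ι → ℝ) : cis (∑ i ∈ s, f i) = ∏ i ∈ s, cis (f i) := by
  classical
  induction s using Finset.induction_on with
  | empty => simp [cis_zero]
  | insert a s ha ih => rw [Finset.sum_insert ha, Finset.prod_insert ha, cis_add, ih]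

/-- If the exponent `c - a` is negative, the phase is trivial, in accordance with the truncated
subtraction. -/
theorem phase_sub (c a : ℕ) : phase (c - a) = cis (2 ^ a / 2 ^ c) := by
  rcases le_total a c with h | h
  · obtain ⟨k, rfl⟩ := Nat.exists_eq_add_of_le h
    rw [Nat.add_sub_cancel_left, pow_add, div_mul_eq_div_div, div_self (by positivity), phase, cis]
    congr 1; push_cast; ring
  · obtain ⟨k, rfl⟩ := Nat.exists_eq_add_of_le h
    rw [show c - (c + k) = 0 by omega, pow_add, mul_div_cancel_left₀ _ (by positivity), phase_zero]
    exact_mod_cast (cis_natCast (2 ^ k)).symm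

theorem hadEntry_eq (b c : Bool) :
    hadEntry b c = (1 / (Real.sqrt 2 : ℂ)) * if b = true ∧ c = true then (phase 1)⁻¹ else 1 := by
  rw [hadEntry, phase_one]; norm_num

/-! ### The inverse Fourier transform on blocks of qubits -/

section BlockQFT

variable {ι : Type} [Fintype ι] [DecidableEq ι] {q : ℕ}

/-- The amplitudes after `σ` steps of the transform, if the initial state is `|x⟩`: the qubits
`i < σ` of each block are already transformed, and the rotations between the qubits `i < j`
with `i + j ≤ 2 σ` have been done. -/
def partialKernel (σ : ℕ) (x z : ι × Fin q → Bool) : ℂ :=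
  (∏ p : ι × Fin q, if (p.2 : ℕ) < σ then hadEntry (z p) (x p) else
    if z p = x p then (1 : ℂ) else 0) *
  ∏ p : ι × (Fin q × Fin q),
    if p.2.1 < p.2.2 ∧ ((p.2.1 : ℕ) + p.2.2 - 1) / 2 < σ then
      (if z (p.1, p.2.1) = true ∧ x (p.1, p.2.2) = true then
        (phase (p.2.2 - p.2.1 + 1))⁻¹ else 1) else 1

/-- Step `σ` consists of the Hadamard gates on the qubits `σ` and of the rotations between the qubits
`i < j` with `i + j = 2 σ + 1` or `i + j = 2 σ + 2`, which form two stages: for a fixed sum `i + j` the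
pairs are disjoint. Thus the depth is linear in `q`. -/
theorem exists_partialKernel_circuit (σ : ℕ) : ∃ C : Circuit (ι × Fin q),
    C.size ≤ σ * ((2 * q + 1) * Fintype.card ι) ∧
    C.depth ≤ 3 * σ ∧ ∀ x z, C.run (ket x) z = partialKernel σ x z := by
  induction σ with
  | zero =>
    refine ⟨Circuit.empty, by simp, by simp, fun x z => ?_⟩
    rw [Circuit.run_empty, ket_apply, partialKernel]
    simp only [not_lt_zero, if_false, and_false, Finset.prod_const_one, mul_one]
    simp only [Finset.prod_ite_zero, Finset.prod_const_one]
    congr 1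
    simp [funext_iff]
  | succ σ ih =>
    obtain ⟨C, h1, h2, h3⟩ := ih
    let S : Finset (ι × Fin q) := Finset.univ.filter fun p => (p.2 : ℕ) = σ
    let T := {p : ι × (Fin q × Fin q) // p.2.1 < p.2.2 ∧ ((p.2.1 : ℕ) + p.2.2 - 1) / 2 = σ}
    obtain ⟨D, k1, k2, k3⟩ := exists_diag_circuit (k := 2)
      (fun p : T => Gate.crotInv (p.1.2.2 - p.1.2.1 + 1) (p.1.1, p.1.2.1) (p.1.1, p.1.2.2)
        (fun h => (ne_of_lt p.2.1) (Prod.ext_iff.1 h).2)) (fun _ => trivial)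
      (fun p => ⟨((p.1.2.1 : ℕ) + p.1.2.2 - 1) % 2, Nat.mod_lt _ (by norm_num)⟩) (by
        rintro ⟨⟨β, i, j⟩, hij, hs⟩ ⟨⟨β', i', j'⟩, hij', hs'⟩ hne hslot
        replace hij : (i : ℕ) < j := hij
        replace hs : ((i : ℕ) + j - 1) / 2 = σ := hs
        replace hij' : (i' : ℕ) < j' := hij'
        replace hs' : ((i' : ℕ) + j' - 1) / 2 = σ := hs'
        replace hslot : ((i : ℕ) + j - 1) % 2 = ((i' : ℕ) + j' - 1) % 2 := congrArg Fin.val hslot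
        simp only [Gate.support, Finset.disjoint_insert_left, Finset.mem_insert,
          Finset.mem_singleton, Prod.mk.injEq, Fin.ext_iff, Finset.disjoint_singleton_left]
        by_cases hβ : β = β'
        · subst hβ
          have : ¬ ((i : ℕ) = i' ∧ (j : ℕ) = j') := by
            rintro ⟨h, h'⟩
            obtain rfl := Fin.ext h
            obtain rfl := Fin.ext h'
            exact hne rfl
          simp only [true_and]; omega
        · simp [hβ])
    refine ⟨(C.append (hadLayer S)).append D, ?_, ?_, ?_⟩
    · have hS : S.card ≤ Fintype.card ι := by
        rw [← Finset.card_univ]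
        refine Finset.card_le_card_of_injOn Prod.fst (by simp) ?_
        rintro ⟨β, i⟩ hi ⟨β', i'⟩ hi' h
        simp only [S, Finset.coe_filter, Finset.mem_univ, true_and, Set.mem_ofPred_eq] at hi hi' h
        ext1
        · exact h
        · ext; simp only; omega
      have hT : Fintype.card T ≤ 2 * q * Fintype.card ι := by
        have := Fintype.card_le_of_injective (β := (Fin 2 × Fin q) × ι) (fun p : T =>
          ((⟨((p.1.2.1 : ℕ) + p.1.2.2 - 1) % 2, Nat.mod_lt _ (by norm_num)⟩, p.1.2.1), p.1.1)) (by
            rintro ⟨⟨β, i, j⟩, hij, hs⟩ ⟨⟨β', i', j'⟩, hij', hs'⟩ h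
            replace hij : (i : ℕ) < j := hij
            replace hs : ((i : ℕ) + j - 1) / 2 = σ := hs
            replace hij' : (i' : ℕ) < j' := hij'
            replace hs' : ((i' : ℕ) + j' - 1) / 2 = σ := hs'
            simp only [Prod.mk.injEq, Fin.ext_iff] at h
            obtain ⟨⟨h4, h5⟩, rfl⟩ := h
            obtain rfl := Fin.ext h5
            obtain rfl : j = j' := by ext; omega
            rfl)
        simpa using this
      simp only [Circuit.size_append, size_hadLayer, k1]
      nlinarith
    · simp [k2]; omega
    · intro x z
      rw [Circuit.run_append, Circuit.run_append, k3]
      have hC : C.run (ket x) = WithLp.toLp 2 fun z =>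
          ((∏ p : ι × Fin q, if (p.2 : ℕ) < σ then hadEntry (z p) (x p) else
            if (p.2 : ℕ) = σ then 1 else if z p = x p then (1 : ℂ) else 0) *
          ∏ p : ι × (Fin q × Fin q),
            if p.2.1 < p.2.2 ∧ ((p.2.1 : ℕ) + p.2.2 - 1) / 2 < σ then
              (if z (p.1, p.2.1) = true ∧ x (p.1, p.2.2) = true then
                (phase (p.2.2 - p.2.1 + 1))⁻¹ else 1) else 1) *
          ∏ w ∈ S, if z w = x w then (1 : ℂ) else 0 := by
        ext z
        rw [h3, partialKernel]
        simp only
        rw [mul_right_comm]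
        congr 1
        rw [Finset.prod_filter, ← Finset.prod_mul_distrib]
        refine Finset.prod_congr rfl fun p _ => ?_
        by_cases h4 : (p.2 : ℕ) < σ
        · simp [h4, h4.ne]
        · by_cases h5 : (p.2 : ℕ) = σ <;> simp [h4, h5]
      rw [hC, run_hadLayer]
      · simp only
        rw [mul_right_comm, Finset.prod_filter, ← Finset.prod_mul_distrib, partialKernel]
        have e1 : (∏ p : ι × Fin q, (if (p.2 : ℕ) < σ then hadEntry (z p) (x p) else
            if (p.2 : ℕ) = σ then 1 else if z p = x p then (1 : ℂ) else 0) *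
            if (p.2 : ℕ) = σ then hadEntry (z p) (x p) else 1) =
            ∏ p : ι × Fin q, if (p.2 : ℕ) < σ + 1 then hadEntry (z p) (x p) else
              if z p = x p then (1 : ℂ) else 0 := by
          refine Finset.prod_congr rfl fun p _ => ?_
          by_cases h4 : (p.2 : ℕ) < σ
          · simp [h4, h4.ne, h4.trans (Nat.lt_succ_self σ)]
          · by_cases h5 : (p.2 : ℕ) = σ
            · simp [h5]
            · simp [h4, h5, show ¬ (p.2 : ℕ) < σ + 1 by omega]
        rw [e1]
        by_cases hz : ∀ p : ι × Fin q, σ + 1 ≤ (p.2 : ℕ) → z p = x p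
        · rw [mul_left_comm]
          congr 1
          have e2 : (∏ p : T, (Gate.crotInv (p.1.2.2 - p.1.2.1 + 1) (p.1.1, p.1.2.1)
              (p.1.1, p.1.2.2) (fun h => (ne_of_lt p.2.1) (Prod.ext_iff.1 h).2)).factor z) =
              ∏ p : ι × (Fin q × Fin q),
                if p.2.1 < p.2.2 ∧ ((p.2.1 : ℕ) + p.2.2 - 1) / 2 = σ then
                  (if z (p.1, p.2.1) = true ∧ x (p.1, p.2.2) = true then
                    (phase (p.2.2 - p.2.1 + 1))⁻¹ else 1) else 1 := by
            rw [← Finset.prod_filter]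
            rw [Finset.prod_subtype (p := fun p : ι × (Fin q × Fin q) =>
              p.2.1 < p.2.2 ∧ ((p.2.1 : ℕ) + p.2.2 - 1) / 2 = σ) _ (by simp)]
            refine Finset.prod_congr rfl fun p _ => ?_
            simp only [Gate.factor]
            rw [hz (p.1.1, p.1.2.2)]
            have := p.2
            simp only [Fin.lt_def] at this
            simp only; omega
          rw [e2, ← Finset.prod_mul_distrib]
          refine Finset.prod_congr rfl fun p _ => ?_
          by_cases h4 : p.2.1 < p.2.2
          · by_cases h5 : ((p.2.1 : ℕ) + p.2.2 - 1) / 2 < σ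
            · simp [h4, h5, h5.ne, h5.trans (Nat.lt_succ_self σ)]
            · by_cases h6 : ((p.2.1 : ℕ) + p.2.2 - 1) / 2 = σ
              · simp [h4, h6]
              · simp [h4, h5, h6, show ¬ ((p.2.1 : ℕ) + p.2.2 - 1) / 2 < σ + 1 by omega]
          · simp [h4]
        · push Not at hz
          obtain ⟨p, hp, hzp⟩ := hz
          have : (∏ p : ι × Fin q, if (p.2 : ℕ) < σ + 1 then hadEntry (z p) (x p) else
              if z p = x p then (1 : ℂ) else 0) = 0 :=
            Finset.prod_eq_zero (Finset.mem_univ p)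
              (by simp [hzp, show ¬ (p.2 : ℕ) < σ + 1 by omega])
          rw [this, zero_mul, zero_mul, mul_zero]
      · intro z w hw b
        have hw' : (w.2 : ℕ) = σ := by simpa [S] using hw
        congr 1
        · refine Finset.prod_congr rfl fun p _ => ?_
          by_cases h5 : (p.2 : ℕ) = σ
          · simp [h5]
          · rw [Function.update_of_ne]
            rintro rfl; exact h5 hw'
        · refine Finset.prod_congr rfl fun p _ => ?_
          split_ifs with h4 <;> try rfl
          all_goals
            rename_i h5 h6
            first
            | (exfalso
               rw [Function.update_of_ne] at h5
               · exact h6 h5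
               · rintro rfl; simp only [Fin.lt_def] at h4 hw'; omega)
            | (exfalso
               rw [Function.update_of_ne] at h5
               · exact h5 h6
               · rintro rfl; simp only [Fin.lt_def] at h4 hw'; omega)

/-- The number in a block of `q` qubits that holds its binary digits in reverse order. -/
def revVal (x : Fin q → Bool) : ℕ := ∑ j, (x j).toNat * 2 ^ (q - 1 - j)

theorem ofBits_eq_sum (x : Fin q → Bool) : Nat.ofBits x = ∑ j, (x j).toNat * 2 ^ (j : ℕ) := by
  induction q with
  | zero => rfl
  | succ q ih =>
    rw [Nat.ofBits_succ, ih, Fin.sum_univ_succ, Finset.mul_sum, add_comm]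
    simp only [Fin.val_zero, pow_zero, mul_one, Function.comp_apply, Fin.val_succ, pow_succ]
    congr 1
    refine Finset.sum_congr rfl fun j _ => ?_
    ring

/-- The digits of `revVal x` are those of `x` in reverse order, so that the rotations between `i` and
`j ≥ i` make up the phase of the inverse Fourier transform; those with `i > j` would be trivial. -/
theorem prod_rotations (x z : Fin q → Bool) :
    (∏ i, hadEntry (z i) (x i)) * ∏ p : Fin q × Fin q, (if p.1 < p.2 then
      (if z p.1 = true ∧ x p.2 = true then (phase (p.2 - p.1 + 1))⁻¹ else 1) else 1) =
    (1 / (Real.sqrt 2 : ℂ)) ^ q * cis (-((revVal x : ℝ) * Nat.ofBits z / 2 ^ q)) := by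
  let h : Fin q → Fin q → ℂ := fun i j =>
    if z i = true ∧ x j = true then (phase (j + 1 - i))⁻¹ else 1
  have h1 : ∏ i, hadEntry (z i) (x i) = (1 / (Real.sqrt 2 : ℂ)) ^ q * ∏ i, h i i := by
    simp only [hadEntry_eq, Finset.prod_mul_distrib, Finset.prod_const, Finset.card_univ,
      Fintype.card_fin, h]
    congr 1
    refine Finset.prod_congr rfl fun i _ => ?_
    rw [show (i : ℕ) + 1 - i = 1 by omega]
  have h2 : ∏ i, h i i = ∏ p : Fin q × Fin q, if p.1 = p.2 then h p.1 p.2 else 1 := by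
    rw [Fintype.prod_prod_type]
    refine Finset.prod_congr rfl fun i _ => ?_
    simp
  have h3 : ∀ i j, h i j = cis (-(((x j).toNat * 2 ^ (q - 1 - j) : ℕ) *
      ((z i).toNat * 2 ^ (i : ℕ) : ℕ) / 2 ^ q)) := by
    intro i j
    have : (j : ℕ) + 1 - i = q - (q - 1 - j + i) := by omega
    simp only [h]
    rw [this, phase_sub]
    by_cases hz : z i = true <;> by_cases hx : x j = true <;> simp [hz, hx, cis_zero, cis_neg, pow_add]
  rw [h1, mul_assoc, h2, ← Finset.prod_mul_distrib]
  congr 1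
  rw [revVal, ofBits_eq_sum]
  push_cast
  rw [Finset.sum_mul_sum, Finset.sum_comm, ← Fintype.sum_prod_type', Finset.sum_div,
    ← Finset.sum_neg_distrib,
    cis_sum]
  refine Finset.prod_congr rfl fun p _ => ?_
  have h4 := h3 p.1 p.2
  push_cast at h4
  rw [← h4]
  rcases lt_trichotomy p.1 p.2 with hp | hp | hp
  · have : (p.2 : ℕ) - p.1 + 1 = p.2 + 1 - p.1 := by
      have := Fin.lt_def.1 hp; omega
    simp [hp, hp.ne, h, this]
  · simp [hp]
  · have : (p.2 : ℕ) + 1 - p.1 = 0 := by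
      have := Fin.lt_def.1 hp; omega
    simp [hp.ne', hp.not_gt, h, this, phase_zero]

theorem Circuit.run_eq_sum {W : Type} [Fintype W] [DecidableEq W] (C : Circuit W) (ψ : State W)
    (z : W → Bool) : C.run ψ z = ∑ x, ψ x * C.run (ket x) z := by
  conv_lhs => rw [state_eq_sum ψ, ← Circuit.lin_apply, map_sum]
  simp

/-- The amplitude of a measurement outcome of phase estimation with `q` qubits, if the outcome, as a
fraction, is `y` away from the phase. -/
def blockAmp (q : ℕ) (y : ℝ) : ℂ := (1 / 2 ^ q : ℂ) * ∑ x : Fin q → Bool, cis (revVal x * y)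

/-- The inverse Fourier transform on each block, after a fixed shift of the phases by
`2 ^ (-b)`. -/
theorem exists_blockQFT (b : ℕ) : ∃ C : Circuit (ι × Fin q),
    C.size ≤ (2 * q + 2) * q * Fintype.card ι ∧ C.depth ≤ 3 * q + 1 ∧ ∀ (θ : ι → ℝ) z,
      C.run (WithLp.toLp 2 fun x => (1 / (Real.sqrt 2 : ℂ)) ^ Fintype.card (ι × Fin q) *
        cis (∑ β, revVal (fun i => x (β, i)) * θ β)) z =
      ∏ β, blockAmp q (θ β + 1 / 2 ^ b - Nat.ofBits (fun i => z (β, i)) / 2 ^ q) := by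
  obtain ⟨C, h1, h2, h3⟩ := exists_partialKernel_circuit (ι := ι) (q := q) q
  obtain ⟨D, k1, k2, k3⟩ := exists_diag_circuit (k := 1)
    (fun p : ι × Fin q => Gate.rot (b - (q - 1 - p.2)) p) (fun _ => trivial) (fun _ => 0) (by
      intro i j hij _; simpa [Gate.support] using hij)
  refine ⟨D.append C, ?_, ?_, ?_⟩
  · have : C.size ≤ q * ((2 * q + 1) * Fintype.card ι) := h1
    rw [Circuit.size_append, k1, Fintype.card_prod, Fintype.card_fin]
    nlinarith
  · rw [Circuit.depth_append]; omega
  · intro θ z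
    rw [Circuit.run_append, Circuit.run_eq_sum]
    have hD : ∀ x : ι × Fin q → Bool, (∏ p, (Gate.rot (b - (q - 1 - p.2)) p).factor x) =
        cis (∑ β, revVal (fun i => x (β, i)) * (1 / 2 ^ b)) := by
      intro x
      rw [cis_sum, Fintype.prod_prod_type]
      refine Finset.prod_congr rfl fun β _ => ?_
      rw [revVal]
      push_cast
      rw [Finset.sum_mul, cis_sum]
      refine Finset.prod_congr rfl fun i _ => ?_
      simp only [Gate.factor, phase_sub]
      cases x (β, i) <;> simp [cis_zero, div_eq_mul_inv]
    have hC : ∀ x : ι × Fin q → Bool, C.run (ket x) z = ∏ β, ((1 / (Real.sqrt 2 : ℂ)) ^ q *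
        cis (-((revVal (fun i => x (β, i)) : ℝ) * Nat.ofBits (fun i => z (β, i)) / 2 ^ q))) := by
      intro x
      rw [h3, partialKernel, Fintype.prod_prod_type, Fintype.prod_prod_type,
        ← Finset.prod_mul_distrib]
      refine Finset.prod_congr rfl fun β _ => ?_
      rw [← prod_rotations]
      congr 1
      · refine Finset.prod_congr rfl fun i _ => ?_
        rw [if_pos i.isLt]
      · refine Finset.prod_congr rfl fun p _ => ?_
        have : ((p.1 : ℕ) + p.2 - 1) / 2 < q := by omega
        simp [this]
    have hs : (1 / (Real.sqrt 2 : ℂ)) ^ q * (1 / (Real.sqrt 2 : ℂ)) ^ q = 1 / 2 ^ q := by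
      rw [← mul_pow, one_div_sqrt_two_mul_self, div_pow, one_pow]
    have e1 : ∏ β, blockAmp q (θ β + 1 / 2 ^ b - Nat.ofBits (fun i => z (β, i)) / 2 ^ q) =
        ∑ x : ι → Fin q → Bool, ∏ β, (1 / 2 ^ q : ℂ) * cis (revVal (x β) *
          (θ β + 1 / 2 ^ b - Nat.ofBits (fun i => z (β, i)) / 2 ^ q)) := by
      simp only [blockAmp, Finset.mul_sum]
      rw [Finset.prod_univ_sum, Fintype.piFinset_univ]
    rw [e1, ← (Equiv.curry ι (Fin q) Bool).sum_comp]
    refine Finset.sum_congr rfl fun x _ => ?_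
    rw [k3, hC, hD]
    have hx : (Equiv.curry ι (Fin q) Bool) x = fun β i => x (β, i) := rfl
    simp only [hx]
    rw [cis_sum, cis_sum, Fintype.card_prod, Fintype.card_fin, mul_comm (Fintype.card ι), pow_mul,
      ← Finset.card_univ, ← Finset.prod_const, ← Finset.prod_mul_distrib,
      ← Finset.prod_mul_distrib, ← Finset.prod_mul_distrib]
    refine Finset.prod_congr rfl fun β _ => ?_
    rw [← hs, show ∀ a c t e : ℝ, a * (t + c - e / 2 ^ q) = a * c + (a * t + -(a * e / 2 ^ q)) by
      intros; ring, cis_add, cis_add]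
    ring

end BlockQFT

/-! ### Phase estimation -/

section Estimate

theorem blockAmp_succ (q : ℕ) (y : ℝ) :
    blockAmp (q + 1) y = (1 + cis (2 ^ q * y)) / 2 * blockAmp q y := by
  rw [blockAmp, blockAmp, ← (Fin.consEquiv fun _ => Bool).sum_comp, Fintype.sum_prod_type]
  have h : ∀ (c : Bool) (x : Fin q → Bool), revVal (Fin.consEquiv (fun _ => Bool) (c, x)) =
      c.toNat * 2 ^ q + revVal x := by
    intro c x
    rw [revVal, Fin.sum_univ_succ]
    simp only [Fin.consEquiv_apply, Fin.cons_zero, Fin.cons_succ, Fin.val_zero, Fin.val_succ, revVal]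
    congr 1
    refine Finset.sum_congr rfl fun j _ => ?_
    rw [show q + 1 - 1 - (j + 1) = q - 1 - j by omega]
  simp only [h]
  simp only [Fintype.sum_bool, Bool.toNat_true, Bool.toNat_false, one_mul, zero_mul, zero_add]
  push_cast
  simp only [add_mul, cis_add]
  rw [← Finset.mul_sum, pow_succ]
  ring

/-- The amplitude is a geometric sum. -/
theorem blockAmp_mul (q : ℕ) (y : ℝ) : blockAmp q y * (1 - cis y) = (1 - cis (2 ^ q * y)) / 2 ^ q := by
  induction q with
  | zero => simp [blockAmp, revVal, cis_zero]
  | succ q ih =>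
    rw [blockAmp_succ, mul_assoc, ih, show (2 : ℝ) ^ (q + 1) * y = 2 ^ q * y + 2 ^ q * y by ring,
      cis_add]
    field_simp
    ring

/-- A chord is at least `2 / π` times as long as its arc. -/
theorem le_norm_one_sub_cis {y ρ : ℝ} (h : ∀ A : ℤ, ρ ≤ |y - A|) : 4 * ρ ≤ ‖1 - cis y‖ := by
  have h0 := h (round y)
  set t := y - round y with ht
  have hy : cis y = cis t := by
    rw [ht, sub_eq_add_neg, ← Int.cast_neg, cis_add_intCast]
  have ht2 : |t| ≤ 1 / 2 := abs_sub_round y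
  have h1 : ‖1 - cis t‖ = 2 * |Real.sin (Real.pi * t)| := by
    have h2 : ‖1 - cis t‖ ^ 2 = (2 * |Real.sin (Real.pi * t)|) ^ 2 := by
      rw [cis, show 2 * (Real.pi : ℂ) * Complex.I * t = ((2 * (Real.pi * t) : ℝ) : ℂ) * Complex.I by
        push_cast; ring, Complex.sq_norm, Complex.normSq_apply, mul_pow, sq_abs]
      simp only [Complex.sub_re, Complex.one_re, Complex.exp_ofReal_mul_I_re, Complex.sub_im,
        Complex.one_im, Complex.exp_ofReal_mul_I_im, Real.cos_two_mul', Real.sin_two_mul]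
      nlinarith [Real.sin_sq_add_cos_sq (Real.pi * t)]
    exact (sq_eq_sq₀ (norm_nonneg _) (by positivity)).1 h2
  have h3 : 2 * |t| ≤ |Real.sin (Real.pi * t)| := by
    have hpi := Real.pi_pos
    have := Real.mul_le_sin (x := Real.pi * |t|) (by positivity) (by nlinarith)
    rw [show 2 / Real.pi * (Real.pi * |t|) = 2 * |t| by field_simp] at this
    refine this.trans ?_
    rcases abs_cases t with ⟨h, _⟩ | ⟨h, _⟩
    · rw [h]; exact le_abs_self _
    · rw [h, mul_neg, Real.sin_neg]; exact neg_le_abs _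
  rw [hy, h1]
  linarith

theorem norm_blockAmp_le {q : ℕ} {y ρ : ℝ} (hρ : 0 < ρ) (h : ∀ A : ℤ, ρ ≤ |y - A|) :
    ‖blockAmp q y‖ ≤ 1 / (2 * ρ * 2 ^ q) := by
  have h1 := congrArg norm (blockAmp_mul q y)
  rw [norm_mul, norm_div, norm_pow, Complex.norm_ofNat] at h1
  have h2 := le_norm_one_sub_cis h
  have h3 : ‖1 - cis (2 ^ q * y)‖ ≤ 2 := by
    refine (norm_sub_le _ _).trans ?_
    rw [norm_cis, norm_one]; norm_num
  have h4 : ‖blockAmp q y‖ * (4 * ρ) ≤ 2 / 2 ^ q := by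
    calc _ ≤ ‖blockAmp q y‖ * ‖1 - cis y‖ := by gcongr
      _ ≤ _ := by rw [h1]; gcongr
  rw [le_div_iff₀ (by positivity)]
  rw [le_div_iff₀ (by positivity)] at h4
  linarith

theorem sum_norm_blockAmp_sq (q : ℕ) (θ : ℝ) :
    ∑ z : Fin q → Bool, ‖blockAmp q (θ - Nat.ofBits z / 2 ^ q)‖ ^ 2 = 1 := by
  obtain ⟨C, -, -, h⟩ := exists_blockQFT (ι := Unit) (q := q) 0
  have h0 := fun z : Fin q → Bool => h (fun _ => θ - 1) fun p => z p.2
  have h1 := C.norm_run (WithLp.toLp 2 fun x => (1 / (Real.sqrt 2 : ℂ)) ^ Fintype.card (Unit × Fin q) *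
        cis (∑ β, revVal (fun i => x (β, i)) * (θ - 1)))
  have h2 := congrArg (· ^ 2) h1
  simp only [EuclideanSpace.norm_sq_eq] at h2
  let e : (Fin q → Bool) ≃ (Unit × Fin q → Bool) :=
    (Equiv.arrowCongr (Equiv.punitProd (Fin q)) (Equiv.refl Bool)).symm
  rw [← e.sum_comp] at h2
  have h3 : ∀ z, e z = fun p => z p.2 := fun z => rfl
  simp only [h3, h0] at h2
  simp only [Finset.univ_unique, Finset.prod_singleton, pow_zero, div_one, sub_add_cancel] at h2
  rw [h2]
  have hs : ‖(1 / (Real.sqrt 2 : ℂ))‖ ^ 2 = 1 / 2 := by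
    rw [sq, ← norm_mul, one_div_sqrt_two_mul_self]; simp
  simp only [norm_mul, norm_cis, mul_one, norm_pow]
  rw [Finset.sum_const, ← pow_mul, mul_comm _ 2, pow_mul, hs]
  simp

/-- The total weight of the estimates with an error of at least `ρ` (modulo `1`). -/
theorem sum_norm_blockAmp_sq_le {q : ℕ} {θ ρ : ℝ} (hρ : 0 < ρ) (T : Finset (Fin q → Bool))
    (hT : ∀ z ∈ T, ∀ A : ℤ, ρ ≤ |θ - Nat.ofBits z / 2 ^ q - A|) :
    ∑ z ∈ T, ‖blockAmp q (θ - Nat.ofBits z / 2 ^ q)‖ ^ 2 ≤ 1 / (4 * ρ ^ 2 * 2 ^ q) := by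
  calc ∑ z ∈ T, ‖blockAmp q (θ - Nat.ofBits z / 2 ^ q)‖ ^ 2
      ≤ ∑ z ∈ T, (1 / (2 * ρ * 2 ^ q)) ^ 2 := by
        refine Finset.sum_le_sum fun z hz => ?_
        have := norm_blockAmp_le (q := q) hρ (hT z hz)
        gcongr
    _ ≤ 2 ^ q * (1 / (2 * ρ * 2 ^ q)) ^ 2 := by
        rw [Finset.sum_const, nsmul_eq_mul]
        gcongr
        have := Finset.card_le_univ T
        simp only [Fintype.card_fun, Fintype.card_bool, Fintype.card_fin] at this
        exact_mod_cast this
    _ = _ := by field_simp; ring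

/-- The total weight of the estimates with an error of at least `ρ` in some block. -/
theorem sum_norm_prod_blockAmp_sq_le {ι : Type} [Fintype ι] [DecidableEq ι] {q : ℕ} (θ : ι → ℝ)
    {ρ : ℝ} (hρ : 0 < ρ) (T : Finset (ι × Fin q → Bool))
    (hT : ∀ z ∈ T, ∃ β, ∀ A : ℤ, ρ ≤ |θ β - Nat.ofBits (fun i => z (β, i)) / 2 ^ q - A|) :
    ∑ z ∈ T, ‖∏ β, blockAmp q (θ β - Nat.ofBits (fun i => z (β, i)) / 2 ^ q)‖ ^ 2 ≤
      Fintype.card ι / (4 * ρ ^ 2 * 2 ^ q) := by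
  classical
  let bad : ι → Finset (Fin q → Bool) := fun β => Finset.univ.filter fun z =>
    ∀ A : ℤ, ρ ≤ |θ β - Nat.ofBits z / 2 ^ q - A|
  let f : ι → (Fin q → Bool) → ℝ := fun β z => ‖blockAmp q (θ β - Nat.ofBits z / 2 ^ q)‖ ^ 2
  have hf : ∀ β z, 0 ≤ f β z := fun β z => by positivity
  calc ∑ z ∈ T, ‖∏ β, blockAmp q (θ β - Nat.ofBits (fun i => z (β, i)) / 2 ^ q)‖ ^ 2
      = ∑ z ∈ T, ∏ β, f β (fun i => z (β, i)) := by
        refine Finset.sum_congr rfl fun z _ => ?_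
        rw [norm_prod, ← Finset.prod_pow]
    _ ≤ ∑ z ∈ T, ∑ β, if (fun i => z (β, i)) ∈ bad β then ∏ β, f β (fun i => z (β, i)) else 0 := by
        refine Finset.sum_le_sum fun z hz => ?_
        obtain ⟨β, hβ⟩ := hT z hz
        refine le_trans ?_ (Finset.single_le_sum (f := fun β => if (fun i => z (β, i)) ∈ bad β
          then ∏ β, f β (fun i => z (β, i)) else 0) (fun β _ => ?_) (Finset.mem_univ β))
        · have : (fun i => z (β, i)) ∈ bad β := by simpa [bad] using hβ
          simp only [if_pos this]; exact le_rfl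
        · split_ifs
          · exact Finset.prod_nonneg fun _ _ => hf _ _
          · exact le_rfl
    _ ≤ ∑ z : ι × Fin q → Bool, ∑ β, if (fun i => z (β, i)) ∈ bad β then
          ∏ β, f β (fun i => z (β, i)) else 0 := by
        refine Finset.sum_le_univ_sum_of_nonneg fun z => Finset.sum_nonneg fun β _ => ?_
        split_ifs
        · exact Finset.prod_nonneg fun _ _ => hf _ _
        · exact le_rfl
    _ = ∑ β, ∑ z : ι → Fin q → Bool, ∏ β', if β' = β then (if z β' ∈ bad β' then f β' (z β') else 0)
          else f β' (z β') := by
        rw [Finset.sum_comm]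
        refine Finset.sum_congr rfl fun β _ => ?_
        rw [← (Equiv.curry ι (Fin q) Bool).sum_comp]
        refine Finset.sum_congr rfl fun z _ => ?_
        have : (Equiv.curry ι (Fin q) Bool) z = fun β i => z (β, i) := rfl
        rw [this]
        split_ifs with h
        · refine Finset.prod_congr rfl fun β' _ => ?_
          split_ifs with h1 h2
          · rfl
          · subst h1; exact (h2 h).elim
          · rfl
        · symm
          refine Finset.prod_eq_zero (Finset.mem_univ β) ?_
          simp [h]
    _ = ∑ β, ∏ β', ∑ z : Fin q → Bool, if β' = β then (if z ∈ bad β' then f β' z else 0)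
          else f β' z := by
        refine Finset.sum_congr rfl fun β _ => ?_
        rw [Finset.prod_univ_sum, Fintype.piFinset_univ]
    _ = ∑ β, ∑ z ∈ bad β, f β z := by
        refine Finset.sum_congr rfl fun β _ => ?_
        rw [Finset.prod_eq_single β]
        · simp
        · intro β' _ h
          simp only [if_neg h]
          exact sum_norm_blockAmp_sq q (θ β')
        · simp
    _ ≤ ∑ β : ι, 1 / (4 * ρ ^ 2 * 2 ^ q) := by
        refine Finset.sum_le_sum fun β _ => ?_
        refine sum_norm_blockAmp_sq_le hρ _ fun z hz => ?_
        simpa [bad] using hz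
    _ = _ := by rw [Finset.sum_const, Finset.card_univ]; simp [div_eq_mul_inv]

end Estimate

/-! ### Operators implemented with clean qubits -/

section Impl

variable {W : Type} [Fintype W] [DecidableEq W]

/-- The operator `T` is implemented by a circuit with at most `s` gates and at most `d` stages that
uses further qubits, which are `0` at the start and at the end. -/
def Impl (T : State W → State W) (s d : ℕ) : Prop :=
  ∃ (A : Type) (_ : Fintype A) (_ : DecidableEq A) (C : Circuit (W ⊕ A)),
    C.size ≤ s ∧ C.depth ≤ d ∧ ∀ ψ,
      C.run (tensor ψ (ket fun _ => false)) = tensor (T ψ) (ket fun _ => false)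

theorem Impl.mono {T : State W → State W} {s d s' d' : ℕ} (h : Impl T s d) (hs : s ≤ s')
    (hd : d ≤ d') : Impl T s' d' := by
  obtain ⟨A, i1, i2, C, h1, h2, h3⟩ := h
  exact ⟨A, i1, i2, C, h1.trans hs, h2.trans hd, h3⟩

theorem tensor_ket_apply {A : Type} [Fintype A] [DecidableEq A] (ψ : State W) (a : A → Bool)
    (z : W ⊕ A → Bool) : tensor ψ (ket a) z =
      if (fun i => z (Sum.inr i)) = a then ψ (fun w => z (Sum.inl w)) else 0 := by
  simp [tensor, ket_apply]

theorem tensor_ket_eq_sum {A : Type} [Fintype A] [DecidableEq A] (ψ : State W) (a : A → Bool) :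
    tensor ψ (ket a) = ∑ x, ψ x • ket (Sum.elim x a) := by
  ext z
  rw [tensor_ket_apply]
  have : ∀ x, z = Sum.elim x a ↔ (fun i => z (Sum.inr i)) = a ∧ (fun w => z (Sum.inl w)) = x := by
    intro x
    constructor
    · rintro rfl; exact ⟨rfl, rfl⟩
    · rintro ⟨h1, h2⟩; funext w; rcases w with w | w
      · exact congrFun h2 w
      · exact congrFun h1 w
  simp only [WithLp.ofLp_sum, WithLp.ofLp_smul, Finset.sum_apply, Pi.smul_apply, ket_apply, this,
    smul_eq_mul, mul_ite, mul_one, mul_zero]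
  split_ifs with h <;> simp [h]

theorem Circuit.run_tensor_ket {A : Type} [Fintype A] [DecidableEq A] (C : Circuit (W ⊕ A))
    (ψ : State W) (a : A → Bool) :
    C.run (tensor ψ (ket a)) = ∑ x, ψ x • C.run (ket (Sum.elim x a)) := by
  rw [tensor_ket_eq_sum, ← Circuit.lin_apply, map_sum]
  simp

theorem norm_tensor_ket {A : Type} [Fintype A] [DecidableEq A] (ψ : State W) (a : A → Bool) :
    ‖tensor ψ (ket a)‖ = ‖ψ‖ := by
  rw [← sq_eq_sq₀ (norm_nonneg _) (norm_nonneg _), EuclideanSpace.norm_sq_eq,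
    EuclideanSpace.norm_sq_eq, ← (Equiv.sumArrowEquivProdArrow W A Bool).symm.sum_comp,
    Fintype.sum_prod_type]
  refine Finset.sum_congr rfl fun x _ => ?_
  rw [Finset.sum_eq_single a]
  · simp [tensor_ket_apply, Equiv.sumArrowEquivProdArrow]
  · intro b _ hb
    simp [tensor_ket_apply, Equiv.sumArrowEquivProdArrow, hb]
  · simp

theorem tensor_ket_sub {A : Type} [Fintype A] [DecidableEq A] (ψ φ : State W) (a : A → Bool) :
    tensor ψ (ket a) - tensor φ (ket a) = tensor (ψ - φ) (ket a) := by
  ext z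
  simp only [PiLp.sub_apply, tensor_ket_apply]
  split_ifs <;> simp

theorem Impl.norm_sub {T : State W → State W} {s d : ℕ} (h : Impl T s d) (ψ φ : State W) :
    ‖T ψ - T φ‖ = ‖ψ - φ‖ := by
  obtain ⟨A, i1, i2, C, h1, h2, h3⟩ := h
  rw [← norm_tensor_ket (T ψ - T φ) (fun _ : A => false), ← tensor_ket_sub, ← h3, ← h3,
    ← Circuit.run_sub, Circuit.norm_run, tensor_ket_sub, norm_tensor_ket]

theorem Circuit.run_map_tensor {A B : Type} [Fintype A] [DecidableEq A] [Fintype B] [DecidableEq B]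
    (f : A ↪ B) (e : W ⊕ A ↪ W ⊕ B) (he : ∀ w, e w = Sum.map id f w) (C : Circuit (W ⊕ A))
    {ψ φ : State W}
    (h : C.run (tensor ψ (ket fun _ => false)) = tensor φ (ket fun _ => false)) :
    (C.map e).run (tensor ψ (ket fun _ => false)) = tensor φ (ket fun _ => false) := by
  ext z
  rw [Circuit.run_map_apply]
  have hs : slice e z (tensor ψ (ket fun _ => false)) =
      if ∀ b, b ∉ Set.range f → z (Sum.inr b) = false then tensor ψ (ket fun _ => false) else 0 := by
    ext x
    have hl : ∀ w, Function.extend e x z (Sum.inl w) = x (Sum.inl w) := by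
      intro w
      rw [← e.injective.extend_apply x z (Sum.inl w), he]; rfl
    have hr : ∀ a, Function.extend e x z (Sum.inr (f a)) = x (Sum.inr a) := by
      intro w
      rw [← e.injective.extend_apply x z (Sum.inr w), he]; rfl
    have hn : ∀ b, b ∉ Set.range f → Function.extend e x z (Sum.inr b) = z (Sum.inr b) := by
      intro b hb
      rw [Function.extend_apply']
      rintro ⟨w | a, hw⟩
      · rw [he] at hw; simp at hw
      · rw [he] at hw; exact hb ⟨a, Sum.inr_injective hw⟩
    simp only [slice, tensor_ket_apply, hl]
    by_cases h1 : ∀ b, b ∉ Set.range f → z (Sum.inr b) = false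
    · rw [if_pos h1, tensor_ket_apply]
      congr 1
      apply propext
      constructor
      · intro hx; funext a; rw [← hr, congrFun hx (f a)]
      · intro hx; funext b
        by_cases hb : b ∈ Set.range f
        · obtain ⟨a, rfl⟩ := hb; rw [hr]; exact congrFun hx a
        · rw [hn b hb, h1 b hb]
    · rw [if_neg h1, if_neg, PiLp.zero_apply]
      intro hx; apply h1; intro b hb
      rw [← hn b hb]; exact congrFun hx b
  rw [hs]
  split_ifs with h1
  · rw [h, tensor_ket_apply, tensor_ket_apply]
    simp only [he]
    congr 1
    apply propext
    constructor
    · intro hx; funext b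
      by_cases hb : b ∈ Set.range f
      · obtain ⟨a, rfl⟩ := hb; exact congrFun hx a
      · exact h1 b hb
    · intro hx; funext a; exact congrFun hx (f a)
  · rw [← Circuit.lin_apply, map_zero, PiLp.zero_apply, tensor_ket_apply, if_neg]
    intro hx; apply h1; intro b _; exact congrFun hx b

theorem Impl.comp {T T' : State W → State W} {s d s' d' : ℕ} (h' : Impl T' s' d')
    (h : Impl T s d) : Impl (fun ψ => T' (T ψ)) (s + s') (d + d') := by
  obtain ⟨A, i1, i2, C, h1, h2, h3⟩ := h
  obtain ⟨B, j1, j2, D, k1, k2, k3⟩ := h'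
  let e : W ⊕ A ↪ W ⊕ (A ⊕ B) := ⟨Sum.map id Sum.inl, by
      rintro (v | u) (v' | u') h <;> simp_all⟩
  let e' : W ⊕ B ↪ W ⊕ (A ⊕ B) := ⟨Sum.map id Sum.inr, by
      rintro (v | u) (v' | u') h <;> simp_all⟩
  refine ⟨A ⊕ B, inferInstance, inferInstance, (C.map e).append (D.map e'), ?_, ?_, fun ψ => ?_⟩
  · simp; omega
  · simp; omega
  · rw [Circuit.run_append,
      Circuit.run_map_tensor ⟨Sum.inl, Sum.inl_injective⟩ e (fun _ => rfl) C (h3 ψ),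
      Circuit.run_map_tensor ⟨Sum.inr, Sum.inr_injective⟩ e' (fun _ => rfl) D (k3 _)]

theorem Circuit.impl (C : Circuit W) : Impl C.run C.size C.depth := by
  let e : W ↪ W ⊕ Empty := ⟨Sum.inl, Sum.inl_injective⟩
  refine ⟨Empty, inferInstance, inferInstance, C.map e, by simp, by simp, fun ψ => ?_⟩
  ext z
  rw [Circuit.run_map_apply, tensor_ket_apply, if_pos (Subsingleton.elim _ _)]
  have : slice e z (tensor ψ (ket fun _ => false)) = ψ := by
    ext x
    have hx : (fun w => Function.extend e x z (Sum.inl w)) = x :=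
      funext fun w => e.injective.extend_apply x z w
    simp only [slice]
    rw [tensor_ket_apply, if_pos (Subsingleton.elim _ _), hx]
  rw [this]
  rfl

/-- The bits with indices `e (inr u)` are changed by the bits of `f`, evaluated at the bits with
indices `e (inl v)`. -/
def xorBy {V U : Type} (e : V ⊕ U ↪ W) (f : (V → Bool) → U → Bool) (z : W → Bool) : W → Bool :=
  Function.extend (fun u => e (Sum.inr u))
    (fun u => xor (z (e (Sum.inr u))) (f (fun v => z (e (Sum.inl v))) u)) z

theorem xorBy_inr {V U : Type} (e : V ⊕ U ↪ W) (f : (V → Bool) → U → Bool) (z : W → Bool) (u : U) :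
    xorBy e f z (e (Sum.inr u)) = xor (z (e (Sum.inr u))) (f (fun v => z (e (Sum.inl v))) u) :=
  (e.injective.comp Sum.inr_injective).extend_apply _ _ u

theorem xorBy_of_ne {V U : Type} (e : V ⊕ U ↪ W) (f : (V → Bool) → U → Bool) (z : W → Bool) (w : W)
    (hw : ∀ u, e (Sum.inr u) ≠ w) : xorBy e f z w = z w :=
  Function.extend_apply' _ _ _ (by rintro ⟨u, hu⟩; exact hw u hu)

theorem xorBy_xorBy {V U : Type} (e : V ⊕ U ↪ W) (f : (V → Bool) → U → Bool) (z : W → Bool) :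
    xorBy e f (xorBy e f z) = z := by
  funext w
  have hl : ∀ v, xorBy e f z (e (Sum.inl v)) = z (e (Sum.inl v)) := fun v =>
    xorBy_of_ne _ _ _ _ (by simp)
  by_cases hw : ∃ u, e (Sum.inr u) = w
  · obtain ⟨u, rfl⟩ := hw
    simp only [xorBy_inr, hl]; simp
  · rw [xorBy_of_ne _ _ _ _ (fun u hu => hw ⟨u, hu⟩), xorBy_of_ne _ _ _ _ (fun u hu => hw ⟨u, hu⟩)]

/-- A computation is the permutation `xorBy` of the basis states. -/
theorem Comp.impl {V U : Type} [Fintype V] [DecidableEq V] [Fintype U] [DecidableEq U]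
    {f : (V → Bool) → U → Bool} {s d : ℕ} (h : Comp f s d) (e : V ⊕ U ↪ W) :
    Impl (fun ψ => WithLp.toLp 2 fun z => ψ (xorBy e f z)) s d := by
  obtain ⟨A, i1, i2, C, h1, h2, h3⟩ := h
  let e' : V ⊕ (U ⊕ A) ↪ W ⊕ A := ⟨Sum.elim (fun v => Sum.inl (e (Sum.inl v)))
    (Sum.elim (fun u => Sum.inl (e (Sum.inr u))) Sum.inr), by
      rintro (v | u | a) (v' | u' | a') h <;> simp_all⟩
  refine ⟨A, inferInstance, inferInstance, C.map e', by simpa, by simpa, fun ψ => ?_⟩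
  have key : ∀ x : W → Bool, (C.map e').run (ket (Sum.elim x fun _ => false)) =
      ket (Sum.elim (xorBy e f x) fun _ => false) := by
    intro x
    refine Circuit.run_map_ket e' (h3 (fun v => x (e (Sum.inl v))) (fun u => x (e (Sum.inr u)))
      trivial) ?_ ?_ ?_
    · rintro (v | u | a) <;> rfl
    · rintro (v | u | a)
      · exact xorBy_of_ne _ _ _ _ (by simp)
      · exact xorBy_inr e f x u
      · rfl
    · rintro (w | a) hw
      · exact xorBy_of_ne _ _ _ _ (fun u hu => hw (Sum.inr (Sum.inl u)) (congrArg Sum.inl hu))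
      · rfl
  rw [Circuit.run_tensor_ket]
  simp only [key]
  rw [tensor_ket_eq_sum, ← Equiv.sum_comp (Function.Involutive.toPerm _ (xorBy_xorBy e f))
    (fun x => (WithLp.toLp 2 fun z => ψ (xorBy e f z) : State W) x •
      ket (Sum.elim x fun _ : A => false))]
  refine Finset.sum_congr rfl fun x _ => ?_
  show ψ x • _ = ψ (xorBy e f (xorBy e f x)) • ket (Sum.elim (xorBy e f x) _)
  rw [xorBy_xorBy]

/-- Phases between qubits of `W` and bits that are computed from qubits of `W`. -/
theorem impl_diag {V Ω Φ ι : Type} [Fintype V] [DecidableEq V] [Fintype Ω] [DecidableEq Ω]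
    [Fintype ι] {f : (V → Bool) → Ω → Bool} {s d : ℕ} (h : Comp f s d)
    (e : V ↪ W) (eΦ : Φ ↪ W) (φ : ι → Φ) (ω : ι → Ω) (k : ι → ℕ) {m : ℕ} (slot : ι → Fin m)
    (hslot : ∀ i j, slot i = slot j → φ i = φ j ∨ ω i = ω j → i = j) :
    Impl (fun ψ => WithLp.toLp 2 fun z => (∏ i, if z (eΦ (φ i)) = true ∧
      f (fun v => z (e v)) (ω i) = true then phase (k i) else 1) * ψ z)
      (2 * s + Fintype.card ι) (2 * d + m) := by
  obtain ⟨A, i1, i2, C, h1, h2, h3⟩ := h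
  let e' : V ⊕ (Ω ⊕ A) ↪ W ⊕ (Ω ⊕ A) := ⟨Sum.map e id,
    Sum.map_injective.2 ⟨e.injective, Function.injective_id⟩⟩
  obtain ⟨D, k1, k2, k3⟩ := exists_diag_circuit (W := W ⊕ (Ω ⊕ A))
      (fun i => Gate.crot (k i) (Sum.inl (eΦ (φ i)))
    (Sum.inr (Sum.inl (ω i))) (by simp)) (fun i => trivial) slot (by
      intro i j hij hs
      have : φ i ≠ φ j ∧ ω i ≠ ω j :=
        ⟨fun h => hij (hslot i j hs (Or.inl h)), fun h => hij (hslot i j hs (Or.inr h))⟩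
      simp [Gate.support, this.1.symm, this.2.symm])
  refine ⟨Ω ⊕ A, inferInstance, inferInstance, ((C.map e').append D).append (C.map e'), ?_, ?_,
    fun ψ => ?_⟩
  · simp; omega
  · simp; omega
  rw [Circuit.run_tensor_ket, tensor_ket_eq_sum]
  refine Finset.sum_congr rfl fun x _ => ?_
  rw [Circuit.run_append, Circuit.run_append]
  have hC : ∀ y : Ω → Bool, (C.map e').run (ket (Sum.elim x (Sum.elim y fun _ => false))) =
      ket (Sum.elim x (Sum.elim (fun u => xor (y u) (f (fun v => x (e v)) u)) fun _ => false)) := by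
    intro y
    refine Circuit.run_map_ket e' (h3 (fun v => x (e v)) y trivial) ?_ ?_ ?_
    · rintro (v | u | a) <;> rfl
    · rintro (v | u | a) <;> rfl
    · rintro (w | u | a) hw
      · rfl
      · exact (hw (Sum.inr (Sum.inl u)) rfl).elim
      · rfl
  have h0 : (Sum.elim x fun _ => false : W ⊕ (Ω ⊕ A) → Bool) =
      Sum.elim x (Sum.elim (fun _ => false) fun _ => false) := by
    funext w; rcases w with w | u | a <;> rfl
  have hD : ∀ z, D.run (ket z) = (∏ i, (Gate.crot (k i) (Sum.inl (eΦ (φ i)))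
      (Sum.inr (Sum.inl (ω i))) (by simp) : Gate (W ⊕ (Ω ⊕ A))).factor z) • ket z := by
    intro z
    ext z'
    rw [k3, PiLp.smul_apply, smul_eq_mul, ket_apply]
    split_ifs with hz
    · rw [hz]
    · simp
  rw [h0, hC, hD, ← Circuit.lin_apply, map_smul, Circuit.lin_apply, hC]
  simp only [Gate.factor, Sum.elim_inl, Sum.elim_inr, Bool.false_xor, Bool.xor_self]
  rw [smul_smul, mul_comm]

end Impl

/-! ### Phases proportional to a product -/

theorem norm_cis_sub_cis_le (x y : ℝ) : ‖cis x - cis y‖ ≤ 2 * Real.pi * |x - y| := by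
  have h : cis x - cis y =
      cis y * (Complex.exp (Complex.I * ((2 * Real.pi * (x - y) : ℝ) : ℂ)) - 1) := by
    have : cis x = cis y * Complex.exp (Complex.I * ((2 * Real.pi * (x - y) : ℝ) : ℂ)) := by
      rw [cis, cis, ← Complex.exp_add]; congr 1; push_cast; ring
    rw [this]; ring
  rw [h, norm_mul, norm_cis, one_mul]
  refine (Real.norm_exp_I_mul_ofReal_sub_one_le).trans ?_
  rw [Real.norm_eq_abs, abs_mul, abs_of_pos Real.two_pi_pos]

theorem sum_one_half_pow_le (T : Finset ℕ) {m : ℕ} (hT : ∀ t ∈ T, m < t) :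
    ∑ t ∈ T, (1 / 2 : ℝ) ^ t ≤ (1 / 2) ^ m := by
  obtain ⟨M, hM⟩ := T.exists_nat_subset_range
  have h1 : ∀ k, ∑ i ∈ Finset.range k, (1 / 2 : ℝ) ^ (m + 1 + i) ≤ (1 / 2) ^ m := by
    intro k
    have : ∑ i ∈ Finset.range k, (1 / 2 : ℝ) ^ (m + 1 + i) = (1 / 2) ^ m - (1 / 2) ^ (m + k) := by
      induction k with
      | zero => simp
      | succ k ih => rw [Finset.sum_range_succ, ih]; ring
    rw [this]
    have : (0 : ℝ) ≤ (1 / 2) ^ (m + k) := by positivity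
    linarith
  have h2 : T ⊆ (Finset.range M).map (addLeftEmbedding (m + 1)) := by
    intro t ht
    have h3 := hT t ht
    have h4 := Finset.mem_range.1 (hM ht)
    exact Finset.mem_map.2 ⟨t - (m + 1), Finset.mem_range.2 (by omega), by
      simp only [addLeftEmbedding_apply]; omega⟩
  refine (Finset.sum_le_sum_of_subset_of_nonneg h2 fun _ _ _ => by positivity).trans ?_
  rw [Finset.sum_map]
  exact h1 M

variable {W : Type} [Fintype W] [DecidableEq W]

/-- The phase proportional to the product of the number with the digits `z (eΦ φ)`, of weights
`2 ^ a φ`, and the number with the digits `f z ω`, of weights `2 ^ (-c ω)`. Of the controlled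
rotations only those are carried out whose angle is at least `2 π / 2 ^ b`. The digits come in `k₁`
and `k₂` classes without repeated weights, so that rotations with the same angle that belong to the
same classes act on disjoint pairs of qubits. -/
theorem impl_mul_phase {V Ω Φ : Type} [Fintype V] [DecidableEq V] [Fintype Ω] [DecidableEq Ω]
    [Fintype Φ] {f : (V → Bool) → Ω → Bool} {s d : ℕ} (h : Comp f s d)
    (e : V ↪ W) (eΦ : Φ ↪ W) (a : Φ → ℕ) (c : Ω → ℕ) {k₁ k₂ : ℕ} (p₁ : Φ → Fin k₁) (p₂ : Ω → Fin k₂)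
    (h₁ : ∀ φ φ', a φ = a φ' → p₁ φ = p₁ φ' → φ = φ')
    (h₂ : ∀ ω ω', c ω = c ω' → p₂ ω = p₂ ω' → ω = ω') (b : ℕ) :
    ∃ D : (W → Bool) → ℂ, Impl (fun ψ => WithLp.toLp 2 fun z => D z * ψ z)
      (2 * s + Fintype.card Φ * (b * k₂)) (2 * d + b * (k₁ * k₂)) ∧
      ∀ z, ‖D z - cis ((∑ φ, ((z (eΦ φ)).toNat : ℝ) * 2 ^ a φ) *
        ∑ ω, ((f (fun v => z (e v)) ω).toNat : ℝ) / 2 ^ c ω)‖ ≤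
          2 * Real.pi * (Fintype.card Φ * (k₂ / 2 ^ b)) := by
  classical
  let ι := {p : Φ × Ω // a p.1 < c p.2 ∧ c p.2 ≤ a p.1 + b}
  let sl : ι → Fin b × Fin k₁ × Fin k₂ := fun p =>
    (⟨c p.1.2 - a p.1.1 - 1, by have := p.2; omega⟩, p₁ p.1.1, p₂ p.1.2)
  have hsl : ∀ i j : ι, sl i = sl j → i.1.1 = j.1.1 ∨ i.1.2 = j.1.2 → i = j := by
    intro i j hij h
    simp only [sl, Prod.mk.injEq, Fin.mk.injEq] at hij
    obtain ⟨h3, h4, h5⟩ := hij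
    have hi := i.2
    have hj := j.2
    have h6 : i.1.1 = j.1.1 ∧ i.1.2 = j.1.2 := by
      rcases h with h | h
      · refine ⟨h, h₂ _ _ ?_ h5⟩
        rw [h] at hi h3; omega
      · refine ⟨h₁ _ _ ?_ h4, h⟩
        rw [h] at hi h3; omega
    exact Subtype.ext (Prod.ext h6.1 h6.2)
  have hcard : Fintype.card ι ≤ Fintype.card Φ * (b * k₂) := by
    have : Function.Injective fun p : ι => (p.1.1, (sl p).1, (sl p).2.2) := by
      intro i j hij
      simp only [sl, Prod.mk.injEq, Fin.mk.injEq] at hij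
      obtain ⟨h3, h4, h5⟩ := hij
      refine hsl i j ?_ (Or.inl h3)
      simp only [sl, Prod.mk.injEq, Fin.mk.injEq, h3, h5, and_true]
      rw [h3] at h4; exact h4
    simpa using Fintype.card_le_of_injective _ this
  let ε : Fin b × Fin k₁ × Fin k₂ ≃ Fin (b * (k₁ * k₂)) :=
    (Fintype.equivFinOfCardEq (by simp))
  have hI := impl_diag h e eΦ (fun i : ι => i.1.1) (fun i => i.1.2) (fun i => c i.1.2 - a i.1.1)
    (fun i => ε (sl i)) (fun i j hij => hsl i j (ε.injective hij))
  refine ⟨_, hI.mono (by omega) le_rfl, fun z => ?_⟩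
  set X : Φ → ℝ := fun φ => (z (eΦ φ)).toNat with hX
  set Y : Ω → ℝ := fun ω => (f (fun v => z (e v)) ω).toNat with hY
  have hX1 : ∀ φ, 0 ≤ X φ ∧ X φ ≤ 1 := fun φ => by simp only [hX]; cases z (eΦ φ) <;> simp
  have hY1 : ∀ ω, 0 ≤ Y ω ∧ Y ω ≤ 1 := fun ω => by
    simp only [hY]; cases f (fun v => z (e v)) ω <;> simp
  let term : Φ × Ω → ℝ := fun p => X p.1 * Y p.2 * (2 ^ a p.1 / 2 ^ c p.2)
  have hprod : (∏ i : ι, if z (eΦ i.1.1) = true ∧ f (fun v => z (e v)) i.1.2 = true then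
      phase (c i.1.2 - a i.1.1) else 1) =
      cis (∑ p with a p.1 < c p.2 ∧ c p.2 ≤ a p.1 + b, term p) := by
    rw [cis_sum, ← Finset.prod_subtype
      (Finset.univ.filter fun p : Φ × Ω => a p.1 < c p.2 ∧ c p.2 ≤ a p.1 + b)
      (by simp) (fun p => if z (eΦ p.1) = true ∧ f (fun v => z (e v)) p.2 = true then
      phase (c p.2 - a p.1) else 1)]
    refine Finset.prod_congr rfl fun p _ => ?_
    simp only [term, hX, hY]
    rw [phase_sub]
    cases z (eΦ p.1) <;> cases f (fun v => z (e v)) p.2 <;> simp [cis_zero]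
  have hint : cis (∑ p with ¬ a p.1 < c p.2, term p) = 1 := by
    rw [cis_sum]
    refine Finset.prod_eq_one fun p hp => ?_
    simp only [Finset.mem_filter, not_lt] at hp
    obtain ⟨m, hm⟩ := Nat.exists_eq_add_of_le hp.2
    have : term p = (((z (eΦ p.1)).toNat * (f (fun v => z (e v)) p.2).toNat * 2 ^ m : ℕ) : ℝ) := by
      simp only [term, hX, hY]
      rw [hm, pow_add]
      push_cast
      field_simp
    rw [this, cis_natCast]
  have hfull : (∑ φ, X φ * 2 ^ a φ) * ∑ ω, Y ω / 2 ^ c ω =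
      (∑ p with a p.1 < c p.2 ∧ c p.2 ≤ a p.1 + b, term p) +
      (∑ p with a p.1 < c p.2 ∧ ¬ c p.2 ≤ a p.1 + b, term p) +
      ∑ p with ¬ a p.1 < c p.2, term p := by
    rw [← Finset.filter_filter, ← Finset.filter_filter, Finset.sum_filter_add_sum_filter_not,
      Finset.sum_filter_add_sum_filter_not, Fintype.sum_mul_sum, ← Fintype.sum_prod_type']
    refine Finset.sum_congr rfl fun p _ => ?_
    simp only [term]; ring
  rw [hprod, hfull, cis_add _ (∑ p with ¬ a p.1 < c p.2, term p), hint, mul_one]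
  refine (norm_cis_sub_cis_le _ _).trans ?_
  refine mul_le_mul_of_nonneg_left ?_ Real.two_pi_pos.le
  rw [abs_sub_comm, add_sub_cancel_left, abs_of_nonneg (Finset.sum_nonneg fun p _ =>
    mul_nonneg (mul_nonneg (hX1 _).1 (hY1 _).1) (by positivity))]
  calc ∑ p with a p.1 < c p.2 ∧ ¬ c p.2 ≤ a p.1 + b, term p
      ≤ ∑ p : Φ × Ω with a p.1 + b < c p.2, (2 ^ a p.1 / 2 ^ c p.2 : ℝ) := by
        refine (Finset.sum_le_sum fun p _ => ?_).trans (Finset.sum_le_sum_of_subset_of_nonneg ?_ ?_)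
        · exact mul_le_of_le_one_left (by positivity) (mul_le_one₀ (hX1 _).2 (hY1 _).1 (hY1 _).2)
        · intro p hp
          simp only [Finset.mem_filter, Finset.mem_univ, true_and] at hp ⊢; omega
        · intro p _ _; positivity
    _ = ∑ φ, 2 ^ a φ * ∑ ω with a φ + b < c ω, (1 / 2 : ℝ) ^ c ω := by
        rw [Finset.sum_filter, Fintype.sum_prod_type]
        refine Finset.sum_congr rfl fun φ _ => ?_
        rw [Finset.mul_sum, Finset.sum_filter]
        refine Finset.sum_congr rfl fun ω _ => ?_
        simp [div_eq_mul_inv]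
    _ ≤ ∑ φ : Φ, (k₂ / 2 ^ b : ℝ) := by
        refine Finset.sum_le_sum fun φ _ => ?_
        have h5 : ∑ ω with a φ + b < c ω, (1 / 2 : ℝ) ^ c ω ≤ k₂ * (1 / 2) ^ (a φ + b) := by
          rw [← Finset.sum_fiberwise (Finset.univ.filter fun ω => a φ + b < c ω) p₂]
          refine (Finset.sum_le_card_nsmul _ _ ((1 / 2) ^ (a φ + b)) fun κ _ => ?_).trans (by simp)
          rw [← Finset.sum_image (f := fun t => (1 / 2 : ℝ) ^ t) (g := c)]
          · refine sum_one_half_pow_le _ fun t ht => ?_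
            simp only [Finset.mem_image, Finset.mem_filter, Finset.mem_univ, true_and] at ht
            obtain ⟨ω, ⟨h, -⟩, rfl⟩ := ht
            exact h
          · intro ω hω ω' hω' hh
            simp only [Finset.coe_filter, Finset.mem_filter, Finset.mem_univ, true_and,
              Set.mem_ofPred_eq] at hω hω'
            exact h₂ _ _ hh (hω.2.trans hω'.2.symm)
        refine (mul_le_mul_of_nonneg_left h5 (by positivity)).trans (le_of_eq ?_)
        rw [pow_add, one_div, inv_pow, inv_pow]
        field_simp
    _ = Fintype.card Φ * (k₂ / 2 ^ b) := by simp

/-! ### Parseval's inequality -/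

theorem cis_mul_natCast (x : ℝ) (k : ℕ) : cis (x * k) = cis x ^ k := by
  rw [cis, cis, ← Complex.exp_nat_mul]; congr 1; push_cast; ring

theorem cis_eq_one_iff (x : ℝ) : cis x = 1 ↔ ∃ k : ℤ, x = k := by
  constructor
  · intro h
    rw [cis, Complex.exp_eq_one_iff] at h
    obtain ⟨k, hk⟩ := h
    refine ⟨k, ?_⟩
    have h2 : (2 * Real.pi * Complex.I : ℂ) ≠ 0 := Complex.two_pi_I_ne_zero
    have : (x : ℂ) = k := mul_left_cancel₀ h2 (by rw [hk]; ring)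
    exact_mod_cast this
  · rintro ⟨k, rfl⟩; exact cis_intCast k

theorem sum_cis_mul_div {N : ℕ} (j k : Fin N) :
    ∑ r ∈ Finset.range N, cis (((j : ℕ) - (k : ℕ) : ℝ) * r / N) = if j = k then (N : ℂ) else 0 := by
  have hN : (N : ℝ) ≠ 0 := by have := j.pos; positivity
  split_ifs with h
  · subst h; simp [cis_zero]
  · have h1 : ∀ r : ℕ, cis (((j : ℕ) - (k : ℕ) : ℝ) * r / N) = cis (((j : ℕ) - (k : ℕ) : ℝ) / N) ^ r := by
      intro r; rw [← cis_mul_natCast]; congr 1; ring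
    simp only [h1]
    have h2 : cis (((j : ℕ) - (k : ℕ) : ℝ) / N) ≠ 1 := by
      rw [Ne, cis_eq_one_iff]
      rintro ⟨m, hm⟩
      rw [div_eq_iff hN] at hm
      have hm' : ((j : ℕ) : ℤ) - (k : ℕ) = m * N := by exact_mod_cast hm
      have hj := j.isLt
      have hk := k.isLt
      apply h
      have h3 : |m * (N : ℤ)| < N := by rw [← hm', abs_lt]; omega
      have h4 : m = 0 := by
        rw [abs_mul, Nat.abs_cast] at h3
        have : |m| < 1 := by
          by_contra hc
          push Not at hc
          nlinarith
        exact Int.abs_lt_one_iff.1 this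
      rw [h4] at hm'
      ext; omega
    rw [geom_sum_eq h2, ← cis_mul_natCast, div_mul_cancel₀ _ hN]
    have : cis (((j : ℕ) - (k : ℕ) : ℝ)) = 1 := by
      rw [cis_eq_one_iff]; exact ⟨(j : ℕ) - (k : ℕ), by push_cast; ring⟩
    rw [this]; simp

/-- Parseval's identity over a full period. -/
theorem sum_norm_sq_cis {N : ℕ} (β : Fin N → ℂ) :
    ∑ r ∈ Finset.range N, ‖∑ j : Fin N, β j * cis ((j : ℕ) * r / N)‖ ^ 2 = N * ∑ j, ‖β j‖ ^ 2 := by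
  have h1 : ∀ z : ℂ, ((‖z‖ ^ 2 : ℝ) : ℂ) = z * starRingEnd ℂ z := by
    intro z; rw [Complex.mul_conj, Complex.normSq_eq_norm_sq]
  have hconj : ∀ x : ℝ, starRingEnd ℂ (cis x) = cis (-x) := by
    intro x
    rw [cis, cis, ← Complex.exp_conj]; congr 1; simp [map_ofNat]
  have : ((∑ r ∈ Finset.range N, ‖∑ j : Fin N, β j * cis ((j : ℕ) * r / N)‖ ^ 2 : ℝ) : ℂ) =
      ((N * ∑ j, ‖β j‖ ^ 2 : ℝ) : ℂ) := by
    push_cast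
    simp only [← Complex.ofReal_pow, h1, map_sum, map_mul, hconj, Finset.sum_mul_sum]
    rw [Finset.sum_comm]
    rw [Finset.mul_sum]
    refine Finset.sum_congr rfl fun j _ => ?_
    rw [Finset.sum_comm]
    have h2 : ∀ k : Fin N, ∑ r ∈ Finset.range N, β j * cis ((j : ℕ) * r / N) *
        (starRingEnd ℂ (β k) * cis (-((k : ℕ) * r / N))) =
        β j * starRingEnd ℂ (β k) * if j = k then (N : ℂ) else 0 := by
      intro k
      rw [← sum_cis_mul_div, Finset.mul_sum]
      refine Finset.sum_congr rfl fun r _ => ?_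
      rw [show ((j : ℕ) - (k : ℕ) : ℝ) * r / N = (j : ℕ) * r / N + -((k : ℕ) * r / N) by ring, cis_add]
      ring
    simp only [h2, mul_ite, mul_zero]
    simp
    ring
  exact_mod_cast this

/-- A random modulation makes the components of a sum almost orthogonal. -/
theorem sum_norm_sq_cis_le {N : ℕ} (hN : 1 ≤ N) (β : Fin N → ℂ) (m : ℕ) :
    ∑ r ∈ Finset.range m, ‖∑ j : Fin N, β j * cis ((j : ℕ) * r / N)‖ ^ 2 ≤
      (m + N) * ∑ j, ‖β j‖ ^ 2 := by
  have hN' : (N : ℝ) ≠ 0 := by positivity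
  have h1 : ∀ k, ∑ r ∈ Finset.range (k * N), ‖∑ j : Fin N, β j * cis ((j : ℕ) * r / N)‖ ^ 2 =
      k * (N * ∑ j, ‖β j‖ ^ 2) := by
    intro k
    induction k with
    | zero => simp
    | succ k ih =>
      rw [Nat.succ_mul, Finset.sum_range_add, ih, ← sum_norm_sq_cis]
      push_cast
      rw [add_mul, one_mul]
      congr 1
      refine Finset.sum_congr rfl fun r _ => ?_
      congr 2
      refine Finset.sum_congr rfl fun j _ => ?_
      rw [show (j : ℕ) * (k * N + r : ℝ) / N = (j : ℕ) * r / N + ((j * k : ℕ) : ℤ) by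
        push_cast; field_simp; ring, cis_add_intCast]
  have h2 : m ≤ (m / N + 1) * N := by
    rw [mul_comm]; exact (Nat.lt_mul_div_succ m hN).le
  calc _ ≤ ∑ r ∈ Finset.range ((m / N + 1) * N), ‖∑ j : Fin N, β j * cis ((j : ℕ) * r / N)‖ ^ 2 :=
        Finset.sum_le_sum_of_subset_of_nonneg (Finset.range_mono h2) fun _ _ _ => by positivity
    _ = ((m / N * N : ℕ) + N) * ∑ j, ‖β j‖ ^ 2 := by rw [h1]; push_cast; ring
    _ ≤ _ := by
        have : ((m / N * N : ℕ) : ℝ) ≤ m := by exact_mod_cast Nat.div_mul_le_self m N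
        have h3 : 0 ≤ ∑ j, ‖β j‖ ^ 2 := by positivity
        gcongr

/-! ### Reconstruction of a fraction from measurements of its blocks of digits -/

/-- The integer part of the reconstruction, without corrections: the last block is used in full,
of the other ones only the leading `s` digits. -/
def leadingDigits (s M : ℕ) (e : ℕ → ℕ) : ℕ :=
  e M + 2 ^ (3 * s) * ∑ i ∈ Finset.range M, e i / 2 ^ (2 * s) * 2 ^ (s * (M - 1 - i))

/-- The leading digits of a block have to be decreased if its remaining digits are small while the
next block, which overlaps with them, is large. -/
def needsBorrow (s : ℕ) (e : ℕ → ℕ) (i : ℕ) : Bool :=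
  decide (2 ^ (3 * s) ≤ 2 * e (i + 1) ∧ 2 * (e i % 2 ^ (2 * s)) < 2 ^ (2 * s))

def borrows (s M : ℕ) (e : ℕ → ℕ) : ℕ :=
  2 ^ (3 * s) * ∑ i ∈ Finset.range M, (needsBorrow s e i).toNat * 2 ^ (s * (M - 1 - i))

/-- An approximation to `2 ^ (s M + 3 s) θ`, given approximations `e i` to the fractional parts
of `2 ^ (s i) θ`, multiplied by `2 ^ (3 s)`. -/
def reconstruct (s M : ℕ) (e : ℕ → ℕ) : ℕ :=
  (2 ^ (s * M + 3 * s) + leadingDigits s M e - borrows s M e) % 2 ^ (s * M + 3 * s)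

theorem borrows_le (s M : ℕ) (hs : 1 ≤ s) (e : ℕ → ℕ) : borrows s M e ≤ 2 ^ (s * M + 3 * s) := by
  have h : ∑ i ∈ Finset.range M, (needsBorrow s e i).toNat * 2 ^ (s * (M - 1 - i)) ≤ 2 ^ (s * M) := by
    calc _ ≤ ∑ i ∈ Finset.range M, (2 ^ s) ^ (M - 1 - i) := by
          refine Finset.sum_le_sum fun i _ => ?_
          rw [pow_mul]
          exact mul_le_of_le_one_left (by positivity) (Bool.toNat_le _)
      _ = ∑ i ∈ Finset.range M, (2 ^ s) ^ i := Finset.sum_range_reflect _ _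
      _ ≤ 2 ^ (s * M) := by
          rw [pow_mul]
          have := Nat.geomSum_lt (m := 2 ^ s) (n := M) (s := Finset.range M)
            (by calc 2 = 2 ^ 1 := rfl
                  _ ≤ 2 ^ s := Nat.pow_le_pow_right (by norm_num) hs) (by simp)
          exact this.le
  rw [borrows, pow_add, mul_comm]
  exact Nat.mul_le_mul_right _ h

/-- The comparison of two consecutive blocks. Here `u` stands for the remaining digits of one block,
brought to the scale of the next block `e`; both exceed the true value, by `b₁` and by `b₂`, and `D` is
the carry between the blocks. It is `0` or `-1`, and the leading bits of `e` and `u` decide which. -/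
theorem borrow_dichotomy {Q u b₁ b₂ e : ℝ} {D : ℤ} (hQ : 0 < Q) (hu : 0 ≤ u) (hu' : u < Q)
    (h₁ : Q / 16 < b₁) (h₁' : b₁ < 3 * Q / 16) (h₂ : 0 < b₂) (h₂' : b₂ < 3 * Q / 64)
    (he : 0 ≤ e) (he' : e < Q) (h : e + Q * D = u - b₁ + b₂) :
    (D = 0 ∧ ¬ (Q ≤ 2 * e ∧ 2 * u < Q)) ∨ (D = -1 ∧ Q ≤ 2 * e ∧ 2 * u < Q) := by
  have hD1 : D < 1 := by
    by_contra hc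
    push Not at hc
    have : (1 : ℝ) ≤ D := by exact_mod_cast hc
    nlinarith
  have hD2 : -2 < D := by
    by_contra hc
    push Not at hc
    have : (D : ℝ) ≤ -2 := by exact_mod_cast hc
    nlinarith
  have hcase : D = 0 ∨ D = -1 := by omega
  rcases hcase with rfl | rfl
  · refine Or.inl ⟨rfl, ?_⟩
    rintro ⟨h4, h5⟩
    push_cast at h
    linarith
  · refine Or.inr ⟨rfl, ?_, ?_⟩ <;> push_cast at h <;> linarith

/-- If each block approximates its phase to within `2 ^ (-s - 4)`, after the shift by `2 ^ (-s - 3)`, then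
the blocks overestimate by a controlled amount. Hence the reconstruction exceeds
`2 ^ (s M + 3 s) j / N` by less than `2 ^ (s M + 3 s) / N`, so that multiplication by `N` and truncation
yield `j`. -/
theorem reconstruct_spec {s M N j : ℕ} (hs : 2 ≤ s) (hj : j < N) (hN : N ≤ 2 ^ (s * (M + 1)))
    (e : ℕ → ℕ) (he : ∀ i ≤ M, e i < 2 ^ (3 * s))
    (hA : ∀ i ≤ M, ∃ A : ℤ,
      |2 ^ (s * i) * (j / N : ℝ) + 1 / 2 ^ (s + 3) - e i / 2 ^ (3 * s) - A| < 1 / 2 ^ (s + 4)) :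
    N * reconstruct s M e / 2 ^ (s * M + 3 * s) = j := by
  have hA' : ∀ i, ∃ A : ℤ, i ≤ M →
      |2 ^ (s * i) * (j / N : ℝ) + 1 / 2 ^ (s + 3) - e i / 2 ^ (3 * s) - A| < 1 / 2 ^ (s + 4) := by
    intro i
    by_cases hi : i ≤ M
    · obtain ⟨A, hA⟩ := hA i hi; exact ⟨A, fun _ => hA⟩
    · exact ⟨0, fun h => (hi h).elim⟩
  choose A hA using hA'
  have hNpos : (0 : ℝ) < N := by exact_mod_cast (Nat.zero_le j).trans_lt hj
  set θ : ℝ := j / N with hθ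
  set S : ℝ := 2 ^ s with hS
  have hS4 : (4 : ℝ) ≤ S := by
    calc (4 : ℝ) = 2 ^ 2 := by norm_num
      _ ≤ 2 ^ s := pow_le_pow_right₀ (by norm_num) hs
  have e2 : (2 : ℝ) ^ (2 * s) = S ^ 2 := by rw [hS, mul_comm, pow_mul]
  have e3 : (2 : ℝ) ^ (3 * s) = S ^ 3 := by rw [hS, mul_comm, pow_mul]
  have hS0 : 0 < S := by linarith
  -- `e i + S³ A i` exceeds `S³ Sⁱ θ` by an amount between `S² / 16` and `3 S² / 16`.
  have hβ : ∀ i ≤ M, S ^ 2 / 16 < e i + S ^ 3 * A i - S ^ 3 * S ^ i * θ ∧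
      e i + S ^ 3 * A i - S ^ 3 * S ^ i * θ < 3 * S ^ 2 / 16 := by
    intro i hi
    have h := hA i hi
    rw [pow_mul, pow_add, pow_add, e3, ← hS, abs_lt] at h
    have h1 : S ^ 3 * (1 / (S * 2 ^ 3)) = S ^ 2 / 8 := by field_simp; norm_num
    have h2 : S ^ 3 * (1 / (S * 2 ^ 4)) = S ^ 2 / 16 := by field_simp; norm_num
    have h3 : S ^ 3 * (e i / S ^ 3) = e i := by field_simp
    have h4 : (0 : ℝ) < S ^ 3 := by positivity
    have h5 := mul_lt_mul_of_pos_left h.1 h4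
    have h6 := mul_lt_mul_of_pos_left h.2 h4
    constructor <;> nlinarith
  have hrec : ∀ i < M, A (i + 1) = 2 ^ s * A i + (e i / 2 ^ (2 * s) : ℕ) -
      (needsBorrow s e i).toNat := by
    intro i hi
    have h1 := hβ i hi.le
    have h2 := hβ (i + 1) hi
    have h3 : (e (i + 1) : ℝ) < S ^ 3 := by rw [← e3]; exact_mod_cast he (i + 1) hi
    have hdiv : (e i : ℝ) = S ^ 2 * (e i / 2 ^ (2 * s) : ℕ) + (e i % 2 ^ (2 * s) : ℕ) := by
      rw [← e2]; exact_mod_cast (Nat.div_add_mod (e i) (2 ^ (2 * s))).symm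
    have hlo : ((e i % 2 ^ (2 * s) : ℕ) : ℝ) < S ^ 2 := by
      rw [← e2]; exact_mod_cast Nat.mod_lt _ (by positivity)
    have hborrow : needsBorrow s e i = true ↔ S ^ 3 ≤ 2 * (e (i + 1) : ℝ) ∧
        2 * ((e i % 2 ^ (2 * s) : ℕ) : ℝ) < S ^ 2 := by
      rw [needsBorrow, decide_eq_true_iff, ← e2, ← e3]
      norm_cast
    set hi' : ℕ := e i / 2 ^ (2 * s)
    set lo : ℕ := e i % 2 ^ (2 * s)
    set D : ℤ := A (i + 1) - 2 ^ s * A i - hi' with hD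
    have hDr : (D : ℝ) = A (i + 1) - S * A i - hi' := by rw [hD, hS]; push_cast; ring
    have hS2 : 0 < S ^ 2 := by positivity
    set x : ℝ := S ^ 3 * S ^ i * θ
    rw [show S ^ 3 * S ^ (i + 1) * θ = S * x by simp only [x]; ring] at h2
    have hkey : (e (i + 1) : ℝ) + S ^ 3 * D = S * lo - S * (e i + S ^ 3 * A i - x) +
        (e (i + 1) + S ^ 3 * A (i + 1) - S * x) := by
      rw [hDr, hdiv]; ring
    have hm4 := mul_le_mul_of_nonneg_right hS4 hS2.le
    have hlo2 : 2 * (lo : ℝ) < S ^ 2 ↔ 2 * (S * lo) < S ^ 3 := by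
      rw [show 2 * (S * lo) = S * (2 * lo) by ring, show S ^ 3 = S * S ^ 2 by ring,
        mul_lt_mul_iff_right₀ hS0]
    have hm1 := mul_lt_mul_of_pos_left h1.1 hS0
    have hm2 := mul_lt_mul_of_pos_left h1.2 hS0
    have hm3 := mul_lt_mul_of_pos_left hlo hS0
    rcases borrow_dichotomy (by positivity) (by positivity) (by linarith) (by linarith) (by linarith)
      (by linarith) (by linarith) (by positivity) h3 hkey with ⟨h0, h4⟩ | ⟨h0, h4⟩
    · have : needsBorrow s e i = false := by
        rw [← Bool.not_eq_true, hborrow, hlo2]; exact h4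
      rw [this, Bool.toNat_false]; push_cast; omega
    · have : needsBorrow s e i = true := by
        rw [hborrow, hlo2]; exact h4
      rw [this, Bool.toNat_true]; push_cast; omega
  have hclosed : ∀ m ≤ M, A m = (2 ^ s) ^ m * A 0 + ∑ i ∈ Finset.range m,
      ((e i / 2 ^ (2 * s) : ℕ) - ((needsBorrow s e i).toNat : ℤ)) * (2 ^ s) ^ (m - 1 - i) := by
    intro m hm
    induction m with
    | zero => simp
    | succ m ih =>
      rw [hrec m hm, ih (by omega), Finset.sum_range_succ, mul_add, Finset.mul_sum]
      have : ∀ i ∈ Finset.range m,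
          (2 ^ s : ℤ) * (((e i / 2 ^ (2 * s) : ℕ) - ((needsBorrow s e i).toNat : ℤ)) *
          (2 ^ s) ^ (m - 1 - i)) = ((e i / 2 ^ (2 * s) : ℕ) - ((needsBorrow s e i).toNat : ℤ)) *
          (2 ^ s) ^ (m + 1 - 1 - i) := by
        intro i hi
        rw [show m + 1 - 1 - i = (m - 1 - i) + 1 by have := Finset.mem_range.1 hi; omega]
        ring
      rw [Finset.sum_congr rfl this, show m + 1 - 1 - m = 0 by omega]
      ring
  set Z : ℤ := e M + 2 ^ (3 * s) * A M with hZ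
  have hZr : (Z : ℝ) = e M + S ^ 3 * A M := by rw [hZ, ← e3]; push_cast; ring
  have hβM := hβ M le_rfl
  have hΛ : (2 : ℝ) ^ (s * M + 3 * s) = S ^ 3 * S ^ M := by
    rw [pow_add, e3, pow_mul, hS]; ring
  have hNS : (N : ℝ) ≤ S ^ M * S := by
    have : (N : ℝ) ≤ 2 ^ (s * (M + 1)) := by exact_mod_cast hN
    rwa [pow_mul, ← hS, pow_succ] at this
  have hθN : N * θ = j := by rw [hθ]; field_simp
  have hSM : 0 < S ^ M := by positivity
  have hNZ1 : (j : ℝ) * 2 ^ (s * M + 3 * s) ≤ N * Z := by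
    rw [hΛ, hZr, ← hθN]
    have := mul_lt_mul_of_pos_left hβM.1 hNpos
    have h0 : 0 ≤ (N : ℝ) * (S ^ 2 / 16) := by positivity
    nlinarith
  have hNZ2 : (N : ℝ) * Z < (j + 1) * 2 ^ (s * M + 3 * s) := by
    rw [hΛ, hZr, ← hθN]
    have h5 := mul_lt_mul_of_pos_left hβM.2 hNpos
    have h6 : (N : ℝ) * (3 * S ^ 2 / 16) ≤ (S ^ M * S) * (3 * S ^ 2 / 16) :=
      mul_le_mul_of_nonneg_right hNS (by positivity)
    have h7 : 0 < S ^ M * S ^ 3 := by positivity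
    nlinarith
  have hZ0 : 0 ≤ Z := by
    by_contra hc
    push Not at hc
    have : (Z : ℝ) < 0 := by exact_mod_cast hc
    have h0 : (0 : ℝ) ≤ j * 2 ^ (s * M + 3 * s) := by positivity
    nlinarith
  have hZ1 : Z < 2 ^ (s * M + 3 * s) := by
    have h8 : ((j : ℝ) + 1) ≤ N := by exact_mod_cast hj
    have h9 : (N : ℝ) * Z < N * 2 ^ (s * M + 3 * s) :=
      hNZ2.trans_le (mul_le_mul_of_nonneg_right h8 (by positivity))
    have := lt_of_mul_lt_mul_left h9 hNpos.le
    exact_mod_cast this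
  have hYZ : (reconstruct s M e : ℤ) = Z := by
    have hle := borrows_le s M (by omega) e
    rw [reconstruct]
    rw [Int.natCast_mod, Nat.cast_sub (by omega)]
    push_cast
    have : (2 ^ (s * M + 3 * s) + (leadingDigits s M e : ℤ) - borrows s M e) =
        Z + 2 ^ (s * M + 3 * s) * (1 - A 0) := by
      rw [hZ, hclosed M le_rfl, leadingDigits, borrows]
      push_cast
      simp only [sub_mul, Finset.sum_sub_distrib, pow_add, pow_mul]
      ring
    rw [this, Int.add_mul_emod_self_left, Int.emod_eq_of_lt hZ0 hZ1]
  have h10 : ((reconstruct s M e : ℕ) : ℝ) = Z := by exact_mod_cast hYZ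
  rw [← h10] at hNZ1 hNZ2
  refine Nat.div_eq_of_lt_le ?_ ?_
  · exact_mod_cast hNZ1
  · exact_mod_cast hNZ2

/-! ### States of four registers -/

section Registers

variable {J K R T : Type} [Fintype J] [DecidableEq J] [Fintype K] [DecidableEq K]
  [Fintype R] [DecidableEq R] [Fintype T] [DecidableEq T]

/-- The qubits of four registers. -/
abbrev Quad (J K R T : Type) : Type := J ⊕ (K ⊕ (R ⊕ T))

/-- The state of four registers with given amplitudes. -/
def quadState (f : (J → Bool) → (K → Bool) → (R → Bool) → (T → Bool) → ℂ) : State (Quad J K R T) :=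
  WithLp.toLp 2 fun z => f (fun w => z (Sum.inl w)) (fun w => z (Sum.inr (Sum.inl w)))
    (fun w => z (Sum.inr (Sum.inr (Sum.inl w)))) fun w => z (Sum.inr (Sum.inr (Sum.inr w)))

theorem sum_sumArrow {A B E : Type} [Fintype A] [DecidableEq A] [Fintype B] [DecidableEq B]
    [AddCommMonoid E] (g : (A ⊕ B → Bool) → E) :
    ∑ z, g z = ∑ x : A → Bool, ∑ y : B → Bool, g (Sum.elim x y) := by
  rw [← (Equiv.sumArrowEquivProdArrow A B Bool).symm.sum_comp, Fintype.sum_prod_type]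
  rfl

theorem norm_quadState_sq (f : (J → Bool) → (K → Bool) → (R → Bool) → (T → Bool) → ℂ) :
    ‖quadState f‖ ^ 2 = ∑ x, ∑ κ, ∑ r, ∑ t, ‖f x κ r t‖ ^ 2 := by
  rw [EuclideanSpace.norm_sq_eq, sum_sumArrow]
  simp only [sum_sumArrow (A := K), sum_sumArrow (A := R)]
  rfl

theorem quadState_sub (f g : (J → Bool) → (K → Bool) → (R → Bool) → (T → Bool) → ℂ) :
    quadState f - quadState g = quadState fun x κ r t => f x κ r t - g x κ r t := rfl

/-- The wires of the second register. -/
def secondReg : K ↪ Quad J K R T := ⟨fun k => Sum.inr (Sum.inl k),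
  Sum.inr_injective.comp Sum.inl_injective⟩

theorem run_map_secondReg (C : Circuit K)
    (f g : (J → Bool) → (K → Bool) → (R → Bool) → (T → Bool) → ℂ)
    (h : ∀ x r t κ, C.run (WithLp.toLp 2 fun κ => f x κ r t) κ = g x κ r t) :
    (C.map secondReg).run (quadState f) = quadState (J := J) (T := T) g := by
  ext z
  rw [Circuit.run_map_apply]
  refine Eq.trans ?_ (h (fun w => z (Sum.inl w)) (fun w => z (Sum.inr (Sum.inr (Sum.inl w))))
    (fun w => z (Sum.inr (Sum.inr (Sum.inr w)))) (fun w => z (Sum.inr (Sum.inl w))))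
  refine congrArg (fun ψ : State K => C.run ψ fun w => z (Sum.inr (Sum.inl w))) ?_
  ext κ
  have h1 : ∀ k, Function.extend (secondReg (J := J) (R := R) (T := T)) κ z (Sum.inr (Sum.inl k)) =
    κ k := fun k => secondReg.injective.extend_apply κ z k
  simp only [slice, quadState, h1]
  simp [secondReg]

/-- Hadamard gates on the second and third register create uniform superpositions. -/
theorem exists_hadLayer_quad :
    ∃ C : Circuit (Quad J K R T), C.size = Fintype.card K + Fintype.card R ∧ C.depth = 1 ∧
      ∀ a : State J, C.run (tensor a (ket fun _ => false)) = quadState fun x _ _ t =>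
        (1 / (Real.sqrt 2 : ℂ)) ^ (Fintype.card K + Fintype.card R) * a x *
          if t = fun _ => false then 1 else 0 := by
  let e : K ⊕ R ↪ Quad J K R T := ⟨Sum.elim (fun k => Sum.inr (Sum.inl k))
    fun r => Sum.inr (Sum.inr (Sum.inl r)), by rintro (v | u) (v' | u') h <;> simp_all⟩
  refine ⟨hadLayer (Finset.univ.map e), by simp, rfl, fun a => ?_⟩
  let f : (Quad J K R T → Bool) → ℂ := fun z => a (fun w => z (Sum.inl w)) *
    if (fun w => z (Sum.inr (Sum.inr (Sum.inr w)))) = fun _ => false then 1 else 0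
  have h0 : tensor a (ket fun _ : K ⊕ (R ⊕ T) => false) = WithLp.toLp 2 fun z => f z *
      ∏ w ∈ Finset.univ.map e, if z w = (fun _ => false) w then (1 : ℂ) else 0 := by
    ext z
    have hp : (∏ w ∈ Finset.univ.map e, if z w = (fun _ => false) w then (1 : ℂ) else 0) =
        (∏ k, if z (Sum.inr (Sum.inl k)) = false then (1 : ℂ) else 0) *
        ∏ r, if z (Sum.inr (Sum.inr (Sum.inl r))) = false then (1 : ℂ) else 0 := by
      rw [Finset.prod_map, Fintype.prod_sum_type]; rfl
    rw [tensor_ket_apply]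
    refine Eq.trans ?_ (congrArg (fun c => f z * c) hp).symm
    simp only [Finset.prod_ite_zero, Finset.prod_const_one, f,
      Finset.mem_univ, true_imp_iff, funext_iff, Sum.forall]
    split_ifs <;> simp_all
  rw [h0, run_hadLayer]
  · ext z
    simp only [quadState, f, Finset.prod_map]
    have : ∀ b, hadEntry b false = 1 / (Real.sqrt 2 : ℂ) := by intro b; simp [hadEntry]
    simp only [this, Finset.prod_const, Finset.card_univ, Fintype.card_sum]
    ring
  · intro z w hw b
    obtain ⟨v, -, rfl⟩ := Finset.mem_map.1 hw
    have h1 : ∀ w : J, (Sum.inl w : Quad J K R T) ≠ e v := by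
      intro w hw; rcases v with v | v <;> nomatch hw
    have h2 : ∀ w : T, (Sum.inr (Sum.inr (Sum.inr w)) : Quad J K R T) ≠ e v := by
      intro w hw; rcases v with v | v <;> nomatch hw
    simp only [f, Function.update_of_ne (h1 _), Function.update_of_ne (h2 _)]

/-- Bitwise addition modulo two. -/
def bxor {U : Type} (x y : U → Bool) : U → Bool := fun u => xor (x u) (y u)

theorem bxor_bxor {U : Type} (x y : U → Bool) : bxor (bxor x y) y = x := by
  funext u; simp [bxor]

theorem bxor_eq_false {U : Type} {x y : U → Bool} : (bxor x y = fun _ => false) ↔ x = y := by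
  constructor
  · intro h; funext u; simpa [bxor] using congrFun h u
  · rintro rfl; funext u; simp [bxor]

theorem quadState_xorBy_first {g : (K → Bool) → J → Bool} {s d : ℕ} (h : Comp g s d) :
    ∃ T' : State (Quad J K R T) → State (Quad J K R T), Impl T' s d ∧ ∀ f, T' (quadState f) =
      quadState fun x κ r t => f (bxor x (g κ)) κ r t := by
  let e : K ⊕ J ↪ Quad J K R T := ⟨Sum.elim (fun k => Sum.inr (Sum.inl k)) Sum.inl, by
    rintro (v | u) (v' | u') h <;> simp_all⟩
  refine ⟨_, h.impl e, fun f => ?_⟩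
  ext z
  have h1 : ∀ j, xorBy e g z (Sum.inl j) = _ := fun j => xorBy_inr e g z j
  have h2 : ∀ w : K ⊕ (R ⊕ T), xorBy e g z (Sum.inr w) = z (Sum.inr w) := fun w =>
    xorBy_of_ne e g z _ (fun u hu => nomatch hu)
  simp only [quadState, h1, h2]
  rfl

theorem quadState_xorBy_first_fourth {g : (K ⊕ R → Bool) → J ⊕ T → Bool} {s d : ℕ}
    (h : Comp g s d) :
    ∃ T' : State (Quad J K R T) → State (Quad J K R T), Impl T' s d ∧ ∀ f, T' (quadState f) =
      quadState fun x κ r t => f (bxor x fun j => g (Sum.elim κ r) (Sum.inl j)) κ r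
        (bxor t fun j => g (Sum.elim κ r) (Sum.inr j)) := by
  let e : (K ⊕ R) ⊕ (J ⊕ T) ↪ Quad J K R T := ⟨Sum.elim (Sum.elim (fun k => Sum.inr (Sum.inl k))
    fun r => Sum.inr (Sum.inr (Sum.inl r))) (Sum.elim Sum.inl
      fun t => Sum.inr (Sum.inr (Sum.inr t))), by
    rintro ((v | v) | (v | v)) ((v' | v') | (v' | v')) h <;> simp_all⟩
  refine ⟨_, h.impl e, fun f => ?_⟩
  ext z
  have h1 : ∀ j, xorBy e g z (Sum.inl j) = _ := fun j => xorBy_inr e g z (Sum.inl j)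
  have h2 : ∀ j, xorBy e g z (Sum.inr (Sum.inr (Sum.inr j))) = _ := fun j =>
    xorBy_inr e g z (Sum.inr j)
  have h3 : ∀ w, xorBy e g z (Sum.inr (Sum.inl w)) = z (Sum.inr (Sum.inl w)) := fun w =>
    xorBy_of_ne e g z _ (by rintro (u | u) hu <;> nomatch hu)
  have h4 : ∀ w, xorBy e g z (Sum.inr (Sum.inr (Sum.inl w))) = z (Sum.inr (Sum.inr (Sum.inl w))) :=
    fun w => xorBy_of_ne e g z _ (by rintro (u | u) hu <;> nomatch hu)
  have h5 : (fun v => z (e (Sum.inl v))) = Sum.elim (fun w => z (Sum.inr (Sum.inl w)))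
      fun w => z (Sum.inr (Sum.inr (Sum.inl w))) := by
    funext v; rcases v with v | v <;> rfl
  simp only [quadState, h1, h2, h3, h4, h5]
  rfl

theorem quadState_xorBy_third {g : (J ⊕ (K ⊕ T) → Bool) → R → Bool} {s d : ℕ} (h : Comp g s d) :
    ∃ T' : State (Quad J K R T) → State (Quad J K R T), Impl T' s d ∧ ∀ f, T' (quadState f) =
      quadState fun x κ r t => f x κ (bxor r (g (Sum.elim x (Sum.elim κ t)))) t := by
  let e : (J ⊕ (K ⊕ T)) ⊕ R ↪ Quad J K R T := ⟨Sum.elim (Sum.elim Sum.inl (Sum.elim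
    (fun k => Sum.inr (Sum.inl k)) fun t => Sum.inr (Sum.inr (Sum.inr t))))
    (fun r => Sum.inr (Sum.inr (Sum.inl r))), by
    rintro ((v | v | v) | v) ((v' | v' | v') | v') h <;> simp_all⟩
  refine ⟨_, h.impl e, fun f => ?_⟩
  ext z
  have h1 : ∀ j, xorBy e g z (Sum.inr (Sum.inr (Sum.inl j))) = _ := fun j => xorBy_inr e g z j
  have h2 : ∀ w, xorBy e g z (Sum.inl w) = z (Sum.inl w) := fun w =>
    xorBy_of_ne e g z _ (fun u hu => nomatch hu)
  have h3 : ∀ w, xorBy e g z (Sum.inr (Sum.inl w)) = z (Sum.inr (Sum.inl w)) := fun w =>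
    xorBy_of_ne e g z _ (fun u hu => nomatch hu)
  have h4 : ∀ w, xorBy e g z (Sum.inr (Sum.inr (Sum.inr w))) = z (Sum.inr (Sum.inr (Sum.inr w))) :=
    fun w => xorBy_of_ne e g z _ (fun u hu => nomatch hu)
  have h5 : (fun v => z (e (Sum.inl v))) = Sum.elim (fun w => z (Sum.inl w))
      (Sum.elim (fun w => z (Sum.inr (Sum.inl w))) fun w => z (Sum.inr (Sum.inr (Sum.inr w)))) := by
    funext v; rcases v with v | v | v <;> rfl
  simp only [quadState, h1, h2, h3, h4, h5]
  rfl

theorem norm_tensor {A B : Type} [Fintype A] [DecidableEq A] [Fintype B] [DecidableEq B]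
    (ψ : State A) (φ : State B) : ‖tensor ψ φ‖ = ‖ψ‖ * ‖φ‖ := by
  rw [← sq_eq_sq₀ (norm_nonneg _) (by positivity), mul_pow, EuclideanSpace.norm_sq_eq,
    EuclideanSpace.norm_sq_eq, EuclideanSpace.norm_sq_eq, sum_sumArrow, Fintype.sum_mul_sum]
  simp [tensor, mul_pow]

end Registers

/-! ### Superpositions of numbers -/

section Numbers

variable {n N : ℕ}

/-- Summation over bit strings, that is over numbers. -/
theorem sum_bitstrings {E : Type} [AddCommMonoid E] (n : ℕ) (f : (Fin n → Bool) → E) :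
    ∑ x, f x = ∑ k ∈ Finset.range (2 ^ n), f (bits n k) := by
  refine Finset.sum_bij (fun x _ => Nat.ofBits x) ?_ ?_ ?_ ?_
  · intro x _; exact Finset.mem_range.2 (Nat.ofBits_lt_two_pow x)
  · intro x _ y _ h; rw [← bits_ofBits x, h, bits_ofBits]
  · intro k hk
    exact ⟨bits n k, Finset.mem_univ _, by
      rw [ofBits_bits, Nat.mod_eq_of_lt (Finset.mem_range.1 hk)]⟩
  · intro x _; rw [bits_ofBits]

theorem ofBits_bits_of_lt {k : ℕ} (hk : k < 2 ^ n) : Nat.ofBits (bits n k) = k := by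
  rw [ofBits_bits, Nat.mod_eq_of_lt hk]

theorem eq_bits_iff {x : Fin n → Bool} {k : ℕ} (hk : k < 2 ^ n) : x = bits n k ↔ Nat.ofBits x = k := by
  constructor
  · rintro rfl; exact ofBits_bits_of_lt hk
  · rintro rfl; exact (bits_ofBits x).symm

theorem sum_bitstrings_of_zero {E : Type} [AddCommMonoid E] (hN : N ≤ 2 ^ n)
    (f : (Fin n → Bool) → E) (hf : ∀ x, N ≤ Nat.ofBits x → f x = 0) :
    ∑ x, f x = ∑ j : Fin N, f (bits n j) := by
  rw [sum_bitstrings, Fin.sum_univ_eq_sum_range (fun j => f (bits n j)) N]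
  symm
  refine Finset.sum_subset (Finset.range_mono hN) fun k hk hk' => hf _ ?_
  rw [ofBits_bits_of_lt (Finset.mem_range.1 hk)]
  simpa using hk'

theorem superposition_apply (hN : N ≤ 2 ^ n) (α : EuclideanSpace ℂ (Fin N)) (x : Fin n → Bool) :
    superposition n α x = if h : Nat.ofBits x < N then α ⟨Nat.ofBits x, h⟩ else 0 := by
  have h1 : ∀ j : Fin N, x = bits n j ↔ Nat.ofBits x = j := fun j => eq_bits_iff (j.isLt.trans_le hN)
  simp only [superposition, WithLp.ofLp_sum, Finset.sum_apply, WithLp.ofLp_smul, Pi.smul_apply,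
    ket_apply, h1, smul_eq_mul, mul_ite, mul_one, mul_zero]
  split_ifs with h
  · rw [Finset.sum_eq_single ⟨Nat.ofBits x, h⟩]
    · simp
    · intro j _ hj
      rw [if_neg]
      intro hh; exact hj (Fin.ext hh.symm)
    · simp
  · refine Finset.sum_eq_zero fun j _ => if_neg ?_
    intro hh; rw [hh] at h; exact h j.isLt

theorem superposition_bits (hN : N ≤ 2 ^ n) (α : EuclideanSpace ℂ (Fin N)) (j : Fin N) :
    superposition n α (bits n j) = α j := by
  have : Nat.ofBits (bits n j) = j := ofBits_bits_of_lt (j.isLt.trans_le hN)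
  simp [superposition_apply hN, this]

theorem superposition_of_le (hN : N ≤ 2 ^ n) (α : EuclideanSpace ℂ (Fin N)) (x : Fin n → Bool)
    (hx : N ≤ Nat.ofBits x) : superposition n α x = 0 := by
  rw [superposition_apply hN, dif_neg (by omega)]

theorem norm_superposition (hN : N ≤ 2 ^ n) (α : EuclideanSpace ℂ (Fin N)) :
    ‖superposition n α‖ = ‖α‖ := by
  rw [← sq_eq_sq₀ (norm_nonneg _) (norm_nonneg _), EuclideanSpace.norm_sq_eq,
    EuclideanSpace.norm_sq_eq, sum_bitstrings_of_zero hN]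
  · simp only [superposition_bits hN]
  · intro x hx; rw [superposition_of_le hN α x hx]; simp

/-- The sum that defines the Fourier transform, for arbitrary natural indices. -/
def qftSum (n N : ℕ) (α : EuclideanSpace ℂ (Fin N)) (k : ℕ) : ℂ :=
  ∑ y : Fin n → Bool, superposition n α y * cis (Nat.ofBits y * k / N)

theorem qftSum_mod (hN : N ≤ 2 ^ n) (α : EuclideanSpace ℂ (Fin N)) (k : ℕ) :
    qftSum n N α (k % N) = qftSum n N α k := by
  rcases Nat.eq_zero_or_pos N with rfl | hpos
  · simp
  have hN' : (N : ℝ) ≠ 0 := by positivity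
  refine Finset.sum_congr rfl fun y _ => ?_
  congr 1
  have : (k : ℝ) = (k % N : ℕ) + N * (k / N : ℕ) := by exact_mod_cast (Nat.mod_add_div k N).symm
  rw [show (Nat.ofBits y * k / N : ℝ) = Nat.ofBits y * (k % N : ℕ) / N +
    ((Nat.ofBits y * (k / N) : ℕ) : ℤ) by rw [this, Int.cast_natCast, Nat.cast_mul]; field_simp,
      cis_add_intCast]

theorem superposition_qft (hN : N ≤ 2 ^ n) (α : EuclideanSpace ℂ (Fin N)) (x : Fin n → Bool) :
    superposition n (qft α) x = if Nat.ofBits x < N then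
      (1 / (Real.sqrt N : ℂ)) * qftSum n N α (Nat.ofBits x) else 0 := by
  rw [superposition_apply hN]
  split_ifs with h
  · simp only [qft, qftSum]
    congr 1
    rw [sum_bitstrings_of_zero hN]
    · refine Finset.sum_congr rfl fun j _ => ?_
      rw [superposition_bits hN, ofBits_bits_of_lt (j.isLt.trans_le hN), cis]
      congr 2; push_cast; ring
    · intro y hy; rw [superposition_of_le hN α y hy, zero_mul]
  · rfl

/-- The transform is unitary. -/
theorem norm_qft (α : EuclideanSpace ℂ (Fin N)) : ‖qft α‖ = ‖α‖ := by
  rcases Nat.eq_zero_or_pos N with rfl | hpos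
  · simp [EuclideanSpace.norm_eq]
  rw [← sq_eq_sq₀ (norm_nonneg _) (norm_nonneg _), EuclideanSpace.norm_sq_eq,
    EuclideanSpace.norm_sq_eq]
  have h := sum_norm_sq_cis α
  rw [← Fin.sum_univ_eq_sum_range (fun r => ‖∑ j : Fin N, α j * cis ((j : ℕ) * r / N)‖ ^ 2) N] at h
  have h1 : ∀ k : Fin N, ‖qft α k‖ ^ 2 = 1 / N * ‖∑ j : Fin N, α j * cis ((j : ℕ) * k / N)‖ ^ 2 := by
    intro k
    simp only [qft, norm_mul, mul_pow]
    congr 1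
    · rw [norm_div, norm_one, Complex.norm_real, Real.norm_eq_abs, abs_of_nonneg (Real.sqrt_nonneg _),
        div_pow, Real.sq_sqrt (by positivity), one_pow]
    · congr 2
      refine Finset.sum_congr rfl fun j _ => ?_
      rw [cis]
      congr 2; push_cast; ring
  simp only [h1, ← Finset.mul_sum, h]
  field_simp

end Numbers

/-! ### Erasing the input from the Fourier basis states -/

theorem norm_one_div_sqrt_two_pow_sq (m : ℕ) : ‖(1 / (Real.sqrt 2 : ℂ)) ^ m‖ ^ 2 = 1 / 2 ^ m := by
  rw [← norm_pow, ← pow_mul, mul_comm, pow_mul, sq, one_div_sqrt_two_mul_self]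
  simp

/-- Averaged over the numbers in the third register, the inputs do not interfere. -/
theorem sum_modulation_le {n N P : ℕ} (hN1 : 1 ≤ N) (hN : N ≤ 2 ^ n) (hP : N ≤ 2 ^ P)
    (β : (Fin n → Bool) → ℂ) (hβ : ∀ x, N ≤ Nat.ofBits x → β x = 0) :
    ∑ r : Fin P → Bool, ‖∑ y, β y * cis (Nat.ofBits y * Nat.ofBits r / N)‖ ^ 2 ≤
      2 * 2 ^ P * ∑ y, ‖β y‖ ^ 2 := by
  have h1 : ∀ r : ℕ, ∑ y, β y * cis (Nat.ofBits y * r / N) =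
      ∑ j : Fin N, β (bits n j) * cis ((j : ℕ) * r / N) := by
    intro r
    rw [sum_bitstrings_of_zero hN _ fun x hx => by rw [hβ x hx, zero_mul]]
    refine Finset.sum_congr rfl fun j _ => ?_
    rw [ofBits_bits_of_lt (j.isLt.trans_le hN)]
  have h2 : ∑ y, ‖β y‖ ^ 2 = ∑ j : Fin N, ‖β (bits n j)‖ ^ 2 :=
    sum_bitstrings_of_zero hN _ fun x hx => by rw [hβ x hx]; simp
  rw [sum_bitstrings, h2]
  simp only [h1]
  have h3 : ∀ r ∈ Finset.range (2 ^ P),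
      ‖∑ j : Fin N, β (bits n j) * cis ((j : ℕ) * (Nat.ofBits (bits P r) : ℕ) / N)‖ ^ 2 =
      ‖∑ j : Fin N, β (bits n j) * cis ((j : ℕ) * r / N)‖ ^ 2 := by
    intro r hr
    rw [ofBits_bits_of_lt (Finset.mem_range.1 hr)]
  rw [Finset.sum_congr rfl h3]
  refine (sum_norm_sq_cis_le hN1 _ _).trans ?_
  have h4 : (N : ℝ) ≤ 2 ^ P := by exact_mod_cast hP
  have h5 : 0 ≤ ∑ j : Fin N, ‖β (bits n j)‖ ^ 2 := by positivity
  push_cast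
  nlinarith

/-- If the function `D` of the second register recovers the first register with failure
probability at most `δ`, then adding `D` to the first register almost erases it. The third register,
which modulates the phases, prevents different inputs from interfering. -/
theorem norm_erase_sq_le {n N P : ℕ} {K T : Type} [Fintype K] [DecidableEq K] [Fintype T]
    [DecidableEq T] (hN1 : 1 ≤ N) (hN : N ≤ 2 ^ n) (hP : N ≤ 2 ^ P) (a : State (Fin n))
    (ha : ∀ x, N ≤ Nat.ofBits x → a x = 0) (ha1 : ‖a‖ = 1)
    (G : (Fin n → Bool) → (K → Bool) → ℂ) (D : (K → Bool) → Fin n → Bool) {δ : ℝ}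
    (hδ : ∀ y, Nat.ofBits y < N → ∑ e with D e ≠ y, ‖G y e‖ ^ 2 ≤ δ) :
    ‖quadState (J := Fin n) (K := K) (R := Fin P) (T := T) (fun x e r t =>
        (1 / (Real.sqrt 2 : ℂ)) ^ P * (a (bxor x (D e)) * G (bxor x (D e)) e *
          cis (Nat.ofBits (bxor x (D e)) * Nat.ofBits r / N)) *
          if t = fun _ => false then 1 else 0) -
      quadState (fun x e r t => (1 / (Real.sqrt 2 : ℂ)) ^ P * (if x = fun _ => false then
        ∑ y, a y * G y e * cis (Nat.ofBits y * Nat.ofBits r / N) else 0) *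
          if t = fun _ => false then 1 else 0)‖ ^ 2 ≤ 3 * δ := by
  classical
  rw [quadState_sub, norm_quadState_sq]
  let β : (K → Bool) → (Fin n → Bool) → ℂ := fun e y => if y = D e then 0 else a y * G y e
  -- `β e` is the part of the state for which the decoder fails.
  have key : ∀ e, ∑ r : Fin P → Bool, ∑ x : Fin n → Bool,
      ‖a (bxor x (D e)) * G (bxor x (D e)) e * cis (Nat.ofBits (bxor x (D e)) * Nat.ofBits r / N) -
        (if x = fun _ => false then ∑ y, a y * G y e * cis (Nat.ofBits y * Nat.ofBits r / N) else 0)‖ ^ 2 ≤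
      2 ^ P * (3 * ∑ y, ‖β e y‖ ^ 2) := by
    intro e
    have h1 : ∀ r : Fin P → Bool, ∑ x : Fin n → Bool,
      ‖a (bxor x (D e)) * G (bxor x (D e)) e * cis (Nat.ofBits (bxor x (D e)) * Nat.ofBits r / N) -
        (if x = fun _ => false then ∑ y, a y * G y e * cis (Nat.ofBits y * Nat.ofBits r / N) else 0)‖ ^ 2 =
      (∑ y, ‖β e y‖ ^ 2) + ‖∑ y, β e y * cis (Nat.ofBits y * Nat.ofBits r / N)‖ ^ 2 := by
      intro r
      let u : (Fin n → Bool) → ℂ := fun y => a y * G y e * cis (Nat.ofBits y * Nat.ofBits r / N)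
      have h2 : ∀ x : Fin n → Bool, (x = fun _ => false) ↔ bxor x (D e) = D e := by
        intro x
        rw [← bxor_eq_false (x := bxor x (D e)), bxor_bxor]
      have h3 : ∀ y, β e y * cis (Nat.ofBits y * Nat.ofBits r / N) = if y = D e then 0 else u y := by
        intro y; simp only [β, u]; split_ifs <;> simp
      have h4 : ∀ y, ‖β e y‖ = ‖if y = D e then 0 else u y‖ := by
        intro y; rw [← h3, norm_mul, norm_cis, mul_one]
      simp only [h2, h3, h4]
      change ∑ x, ‖u (bxor x (D e)) - if bxor x (D e) = D e then ∑ y, u y else 0‖ ^ 2 = _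
      have h5 : ∑ x, ‖u (bxor x (D e)) - if bxor x (D e) = D e then ∑ y, u y else 0‖ ^ 2 =
          ∑ y, ‖u y - if y = D e then ∑ y, u y else 0‖ ^ 2 :=
        Equiv.sum_comp (Function.Involutive.toPerm (fun x : Fin n → Bool => bxor x (D e))
          (fun x => bxor_bxor x (D e))) (fun y => ‖u y - if y = D e then ∑ y, u y else 0‖ ^ 2)
      rw [h5, ← Finset.add_sum_erase _ _ (Finset.mem_univ (D e)),
        ← Finset.add_sum_erase Finset.univ (fun y => ‖if y = D e then 0 else u y‖ ^ 2)
          (Finset.mem_univ (D e))]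
      rw [if_pos rfl, if_pos rfl, norm_zero, zero_pow two_ne_zero, zero_add, add_comm]
      congr 1
      · refine Finset.sum_congr rfl fun y hy => ?_
        rw [if_neg (Finset.ne_of_mem_erase hy), if_neg (Finset.ne_of_mem_erase hy), sub_zero]
      · rw [← Finset.add_sum_erase Finset.univ u (Finset.mem_univ (D e)),
          ← Finset.add_sum_erase Finset.univ (fun y => if y = D e then 0 else u y)
            (Finset.mem_univ (D e)),
          sub_add_cancel_left, norm_neg, if_pos rfl, zero_add]
        congr 2
        refine Finset.sum_congr rfl fun y hy => ?_
        rw [if_neg (Finset.ne_of_mem_erase hy)]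
    simp only [h1, Finset.sum_add_distrib]
    have h5 := sum_modulation_le hN1 hN hP (β e) (fun x hx => by
      simp only [β, ha x hx, zero_mul, ite_self])
    simp only [Finset.sum_const, Finset.card_univ, Fintype.card_fun, Fintype.card_bool,
      Fintype.card_fin, nsmul_eq_mul]
    push_cast
    linarith
  have h6 : ∑ e, ∑ y, ‖β e y‖ ^ 2 ≤ δ := by
    rw [Finset.sum_comm]
    calc ∑ y, ∑ e, ‖β e y‖ ^ 2 ≤ ∑ y, ‖a y‖ ^ 2 * δ := by
          refine Finset.sum_le_sum fun y _ => ?_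
          by_cases hy : Nat.ofBits y < N
          · refine le_trans (le_of_eq ?_) (mul_le_mul_of_nonneg_left (hδ y hy) (by positivity))
            rw [Finset.mul_sum, Finset.sum_filter]
            refine Finset.sum_congr rfl fun e _ => ?_
            simp only [β]
            by_cases h : y = D e
            · simp [h]
            · rw [if_neg h, if_pos (Ne.symm h), norm_mul, mul_pow]
          · simp [β, ha y (not_lt.1 hy)]
      _ = δ := by
          rw [← Finset.sum_mul, ← EuclideanSpace.norm_sq_eq, ha1]; ring
  calc _ = ∑ x : Fin n → Bool, ∑ e, ∑ r : Fin P → Bool, 1 / 2 ^ P *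
      ‖a (bxor x (D e)) * G (bxor x (D e)) e * cis (Nat.ofBits (bxor x (D e)) * Nat.ofBits r / N) -
        (if x = fun _ => false then ∑ y, a y * G y e * cis (Nat.ofBits y * Nat.ofBits r / N) else 0)‖ ^ 2 := by
        refine Finset.sum_congr rfl fun x _ => Finset.sum_congr rfl fun e _ =>
          Finset.sum_congr rfl fun r _ => ?_
        rw [Finset.sum_eq_single (fun _ => false)]
        · rw [if_pos rfl, mul_one, mul_one, ← mul_sub, norm_mul, mul_pow,
            norm_one_div_sqrt_two_pow_sq]
        · intro t _ ht; simp [ht]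
        · simp
    _ = 1 / 2 ^ P * ∑ e, ∑ r : Fin P → Bool, ∑ x : Fin n → Bool,
      ‖a (bxor x (D e)) * G (bxor x (D e)) e * cis (Nat.ofBits (bxor x (D e)) * Nat.ofBits r / N) -
        (if x = fun _ => false then ∑ y, a y * G y e * cis (Nat.ofBits y * Nat.ofBits r / N) else 0)‖ ^ 2 := by
        rw [Finset.sum_comm, Finset.mul_sum]
        refine Finset.sum_congr rfl fun e _ => ?_
        rw [Finset.sum_comm, Finset.mul_sum]
        refine Finset.sum_congr rfl fun r _ => ?_
        rw [Finset.mul_sum]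
    _ ≤ 1 / 2 ^ P * ∑ e, 2 ^ P * (3 * ∑ y, ‖β e y‖ ^ 2) := by
        refine mul_le_mul_of_nonneg_left (Finset.sum_le_sum fun e _ => key e) (by positivity)
    _ = 3 * ∑ e, ∑ y, ‖β e y‖ ^ 2 := by
        rw [← Finset.mul_sum, ← Finset.mul_sum]; field_simp
    _ ≤ 3 * δ := by linarith

/-! ### The remaining garbage hardly depends on the result -/

/-- The number of multiples of `N` in an interval of length `m` is about `m / N`. -/
theorem card_multiples {N T a m : ℕ} (hN : 1 ≤ N) (h : a + m ≤ N * T) :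
    N * ((Finset.range T).filter fun t => a ≤ N * t ∧ N * t < a + m).card ≤ m + N ∧
    m ≤ N * ((Finset.range T).filter fun t => a ≤ N * t ∧ N * t < a + m).card + N := by
  have h1 : ((Finset.range T).filter fun t => a ≤ N * t ∧ N * t < a + m) =
      Finset.Ico (a ⌈/⌉ N) ((a + m) ⌈/⌉ N) := by
    ext t
    rw [Finset.mem_filter, Finset.mem_Ico, Finset.mem_range, ceilDiv_le_iff_le_mul hN,
      ← not_le (a := (a + m) ⌈/⌉ N),
      ceilDiv_le_iff_le_mul hN, not_le]
    constructor
    · exact fun h => h.2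
    · refine fun h' => ⟨?_, h'⟩
      exact lt_of_mul_lt_mul_left (h'.2.trans_le h) (Nat.zero_le N)
  have h2 : ∀ x, x ≤ N * (x ⌈/⌉ N) ∧ N * (x ⌈/⌉ N) < x + N := by
    intro x
    refine ⟨(ceilDiv_le_iff_le_mul hN).1 le_rfl, ?_⟩
    rw [Nat.ceilDiv_eq_add_pred_div]
    have := Nat.mul_div_le (x + N - 1) N
    omega
  have h3 : a ⌈/⌉ N ≤ (a + m) ⌈/⌉ N := by
    rw [ceilDiv_le_iff_le_mul hN]
    exact (Nat.le_add_right a m).trans (h2 _).1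
  rw [h1, Nat.card_Ico, Nat.mul_sub]
  have h4 := Nat.mul_le_mul_left N h3
  have h5 := h2 a
  have h6 := h2 (a + m)
  omega

/-- Up to a small error the state is a product state, since for most values of the second and
fourth registers the condition on `Nat.ofBits x + N * t` does not depend on `x`. -/
theorem exists_product_state {n N P τ : ℕ} {K : Type} [Fintype K] [DecidableEq K] (hN1 : 1 ≤ N)
    (hP : N < 2 ^ P) (o : (K → Bool) → ℕ) (hτ : ∀ κ, o κ + 2 ^ P ≤ N * 2 ^ τ) :
    ∃ η : State (K ⊕ (Fin P ⊕ Fin τ)), ‖η‖ = 1 ∧ ∀ b : State (Fin n), ‖b‖ = 1 →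
      (∀ x, N ≤ Nat.ofBits x → b x = 0) →
    ‖quadState (fun x κ r t => (1 / (Real.sqrt 2 : ℂ)) ^ (Fintype.card K + P) * (Real.sqrt N) * b x *
        if (r = fun _ => false) ∧ o κ ≤ Nat.ofBits x + N * Nat.ofBits t ∧
          Nat.ofBits x + N * Nat.ofBits t < o κ + 2 ^ P then 1 else 0) - tensor b η‖ ≤
      Real.sqrt (2 * (N / 2 ^ P)) + (N / 2 ^ P : ℝ) := by
  classical
  set c : ℂ := (1 / (Real.sqrt 2 : ℂ)) ^ (Fintype.card K + P) * (Real.sqrt N) with hc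
  have hc2 : ‖c‖ ^ 2 = N / 2 ^ P * (1 / 2 ^ Fintype.card K) := by
    rw [hc, norm_mul, mul_pow, norm_one_div_sqrt_two_pow_sq, Complex.norm_real, Real.norm_eq_abs,
      abs_of_nonneg (Real.sqrt_nonneg _), Real.sq_sqrt (by positivity), pow_add]
    field_simp
  let η' : State (K ⊕ (Fin P ⊕ Fin τ)) := WithLp.toLp 2 fun z =>
    c * if (fun r => z (Sum.inr (Sum.inl r))) = (fun _ => false) ∧ o (fun k => z (Sum.inl k)) ≤
      N * Nat.ofBits (fun t => z (Sum.inr (Sum.inr t))) ∧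
      N * Nat.ofBits (fun t => z (Sum.inr (Sum.inr t))) < o (fun k => z (Sum.inl k)) + 2 ^ P
      then 1 else 0
  have hη'2 : |‖η'‖ ^ 2 - 1| ≤ (N / 2 ^ P : ℝ) := by
    -- For each `κ` about `2 ^ P / N` values of `t` are admissible.
    let cnt : (K → Bool) → ℕ := fun κ => ((Finset.range (2 ^ τ)).filter fun t =>
      o κ ≤ N * t ∧ N * t < o κ + 2 ^ P).card
    have h1 : ‖η'‖ ^ 2 = ∑ κ : K → Bool, 1 / 2 ^ Fintype.card K * (N * cnt κ / 2 ^ P : ℝ) := by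
      rw [EuclideanSpace.norm_sq_eq, sum_sumArrow]
      refine Finset.sum_congr rfl fun κ _ => ?_
      rw [sum_sumArrow, Finset.sum_eq_single (fun _ => false)]
      · rw [sum_bitstrings]
        simp only [cnt, Finset.card_eq_sum_ones, Finset.sum_filter, Nat.cast_sum, Finset.mul_sum,
          Finset.sum_div]
        refine Finset.sum_congr rfl fun t ht => ?_
        simp only [η', Sum.elim_inl, Sum.elim_inr, norm_mul, mul_pow, hc2, true_and]
        rw [show (fun i => bits τ t i) = bits τ t from rfl, ofBits_bits_of_lt (Finset.mem_range.1 ht)]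
        split_ifs
        · simp; ring
        · simp
      · intro r _ hr
        refine Finset.sum_eq_zero fun t _ => ?_
        simp [η', hr]
      · simp
    have h2 : ∀ κ, |(N * cnt κ / 2 ^ P : ℝ) - 1| ≤ N / 2 ^ P := by
      intro κ
      obtain ⟨h3, h4⟩ := card_multiples hN1 (hτ κ)
      have h3' : (N : ℝ) * cnt κ ≤ 2 ^ P + N := by exact_mod_cast h3
      have h4' : (2 : ℝ) ^ P ≤ N * cnt κ + N := by exact_mod_cast h4
      have h5 : (0 : ℝ) < 2 ^ P := by positivity
      rw [div_sub_one h5.ne', abs_div, abs_of_pos h5]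
      gcongr
      rw [abs_le]; constructor <;> linarith
    have h6 : ‖η'‖ ^ 2 - 1 = ∑ κ : K → Bool, 1 / 2 ^ Fintype.card K * (N * cnt κ / 2 ^ P - 1 : ℝ) := by
      simp only [mul_sub, Finset.sum_sub_distrib, h1]
      simp
    rw [h6]
    refine (Finset.abs_sum_le_sum_abs _ _).trans ?_
    calc _ ≤ ∑ κ : K → Bool, 1 / 2 ^ Fintype.card K * (N / 2 ^ P : ℝ) := by
          refine Finset.sum_le_sum fun κ _ => ?_
          rw [abs_mul, abs_of_nonneg (by positivity)]
          exact mul_le_mul_of_nonneg_left (h2 κ) (by positivity)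
      _ = N / 2 ^ P := by simp
  have hlt : (N / 2 ^ P : ℝ) < 1 := by
    rw [div_lt_one (by positivity)]; exact_mod_cast hP
  have hpos : 0 < ‖η'‖ := by
    by_contra hcon
    have : ‖η'‖ = 0 := le_antisymm (not_lt.1 hcon) (norm_nonneg _)
    rw [this] at hη'2
    norm_num at hη'2
    linarith
  refine ⟨((‖η'‖⁻¹ : ℝ) : ℂ) • η', ?_, fun b hb hbN => ?_⟩
  · rw [norm_smul, Complex.norm_real, norm_inv, norm_norm, inv_mul_cancel₀ hpos.ne']
  have h7 : ‖tensor b η' - tensor b (((‖η'‖⁻¹ : ℝ) : ℂ) • η')‖ ≤ (N / 2 ^ P : ℝ) := by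
    have h8 : tensor b η' - tensor b (((‖η'‖⁻¹ : ℝ) : ℂ) • η') =
        tensor b (((1 - ‖η'‖⁻¹ : ℝ) : ℂ) • η') := by
      ext z
      simp only [tensor, PiLp.sub_apply, PiLp.smul_apply, smul_eq_mul]
      push_cast
      ring
    rw [h8, norm_tensor, hb, one_mul, norm_smul, Complex.norm_real, Real.norm_eq_abs]
    have h9 : |1 - ‖η'‖⁻¹| * ‖η'‖ = |‖η'‖ - 1| := by
      conv_lhs => rw [← abs_of_pos hpos, ← abs_mul, abs_of_pos hpos]
      rw [sub_mul, one_mul, inv_mul_cancel₀ hpos.ne']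
    rw [h9]
    refine le_trans ?_ hη'2
    rw [show ‖η'‖ ^ 2 - 1 = (‖η'‖ - 1) * (‖η'‖ + 1) by ring, abs_mul]
    refine le_mul_of_one_le_right (abs_nonneg _) ?_
    rw [abs_of_pos (by linarith)]; linarith
  have h10 : ‖quadState (fun x κ r t => c * b x *
        if (r = fun _ => false) ∧ o κ ≤ Nat.ofBits x + N * Nat.ofBits t ∧
          Nat.ofBits x + N * Nat.ofBits t < o κ + 2 ^ P then 1 else 0) - tensor b η'‖ ≤
      Real.sqrt (2 * (N / 2 ^ P)) := by
    refine Real.le_sqrt_of_sq_le ?_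
    have h11 : tensor b η' = quadState (fun x κ r t => c * b x *
        if (r = fun _ => false) ∧ o κ ≤ N * Nat.ofBits t ∧ N * Nat.ofBits t < o κ + 2 ^ P
          then 1 else 0) := by
      ext z
      simp only [tensor, quadState, η']
      ring
    rw [h11, quadState_sub, norm_quadState_sq]
    calc _ ≤ ∑ x, ∑ κ : K → Bool, ‖b x‖ ^ 2 * (N / 2 ^ P * (1 / 2 ^ Fintype.card K)) * 2 := by
          refine Finset.sum_le_sum fun x _ => Finset.sum_le_sum fun κ _ => ?_
          by_cases hx : N ≤ Nat.ofBits x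
          · simp [hbN x hx]
          push Not at hx
          rw [Finset.sum_eq_single (fun _ => false)]
          · rw [sum_bitstrings]
            -- The two conditions differ only for values of `t` at the ends of the interval.
            have h12 : ∀ t ∈ Finset.range (2 ^ τ), ‖c * b x *
                (if ((fun _ => false : Fin P → Bool) = fun _ => false) ∧
                  o κ ≤ Nat.ofBits x + N * Nat.ofBits (bits τ t) ∧
                  Nat.ofBits x + N * Nat.ofBits (bits τ t) < o κ + 2 ^ P then 1 else 0) -
                c * b x * (if ((fun _ => false : Fin P → Bool) = fun _ => false) ∧
                  o κ ≤ N * Nat.ofBits (bits τ t) ∧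
                  N * Nat.ofBits (bits τ t) < o κ + 2 ^ P then 1 else 0)‖ ^ 2 ≤
                ‖b x‖ ^ 2 * (N / 2 ^ P * (1 / 2 ^ Fintype.card K)) *
                  (if t ∈ ({o κ / N, (o κ + 2 ^ P) / N} : Finset ℕ) then 1 else 0) := by
              intro t ht
              rw [ofBits_bits_of_lt (Finset.mem_range.1 ht), ← mul_sub, norm_mul, mul_pow, norm_mul,
                mul_pow, hc2, mul_comm (‖b x‖ ^ 2)]
              refine mul_le_mul_of_nonneg_left ?_ (by positivity)
              simp only [true_and]
              have hdiv : ∀ y, N * t < y → y < N * t + N → y / N = t := by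
                intro y h13 h14
                refine Nat.div_eq_of_lt_le ?_ ?_
                · rw [mul_comm]; exact h13.le
                · rw [add_mul, one_mul, mul_comm]; exact h14
              by_cases h15 : t ∈ ({o κ / N, (o κ + 2 ^ P) / N} : Finset ℕ)
              · rw [if_pos h15]
                split_ifs <;> simp
              · rw [if_neg h15]
                simp only [Finset.mem_insert, Finset.mem_singleton, not_or] at h15
                have h16 : ¬ (N * t < o κ ∧ o κ < N * t + N) := fun h => h15.1 (hdiv _ h.1 h.2).symm
                have h17 : ¬ (N * t < o κ + 2 ^ P ∧ o κ + 2 ^ P < N * t + N) :=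
                  fun h => h15.2 (hdiv _ h.1 h.2).symm
                have h18 : (o κ ≤ Nat.ofBits x + N * t ∧ Nat.ofBits x + N * t < o κ + 2 ^ P) ↔
                    (o κ ≤ N * t ∧ N * t < o κ + 2 ^ P) := by
                  by_contra h19
                  omega
                simp only [h18]
                simp
            refine (Finset.sum_le_sum h12).trans ?_
            rw [← Finset.mul_sum]
            refine mul_le_mul_of_nonneg_left ?_ (by positivity)
            rw [Finset.sum_ite_mem, Finset.sum_const, nsmul_eq_mul, mul_one]
            exact_mod_cast (Finset.card_le_card Finset.inter_subset_right).trans Finset.card_le_two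
          · intro r _ hr
            simp [hr]
          · simp
      _ = 2 * (N / 2 ^ P : ℝ) := by
          have h20 : ∑ x, ‖b x‖ ^ 2 = 1 := by rw [← EuclideanSpace.norm_sq_eq, hb, one_pow]
          simp only [Finset.sum_const, Finset.card_univ, Fintype.card_fun, Fintype.card_bool,
            nsmul_eq_mul]
          calc _ = ∑ x, ‖b x‖ ^ 2 * (2 * (N / 2 ^ P : ℝ)) := by
                refine Finset.sum_congr rfl fun x _ => ?_
                push_cast
                field_simp
            _ = _ := by rw [← Finset.sum_mul, h20, one_mul]
  exact (norm_sub_le_norm_sub_add_norm_sub _ (tensor b η') _).trans (add_le_add h10 h7)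

/-! ### The algorithm -/

/-- All qubits but those of the first register are regarded as further qubits, and numbered. -/
theorem Circuit.exists_relabel {J K A : Type} [Fintype J] [DecidableEq J] [Fintype K]
    [DecidableEq K] [Fintype A] [DecidableEq A] (C : Circuit ((J ⊕ K) ⊕ A)) :
    ∃ (c : ℕ) (C' : Circuit (J ⊕ Fin c)), C'.size = C.size ∧ C'.depth = C.depth ∧
      ∀ η : State K, ∃ η' : State (Fin c), ‖η'‖ = ‖η‖ ∧ ∀ a b : State J,
        ‖C'.run (tensor a (ket fun _ => false)) - tensor b η'‖ =
        ‖C.run (tensor (tensor a (ket fun _ => false)) (ket fun _ => false)) -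
          tensor (tensor b η) (ket fun _ => false)‖ := by
  let ε : K ⊕ A ≃ Fin (Fintype.card (K ⊕ A)) := Fintype.equivFin _
  let e : (J ⊕ K) ⊕ A ≃ J ⊕ Fin (Fintype.card (K ⊕ A)) :=
    (Equiv.sumAssoc J K A).trans (Equiv.sumCongr (Equiv.refl J) ε)
  refine ⟨_, C.map e.toEmbedding, by simp, by simp, fun η =>
    ⟨WithLp.toLp 2 fun z => tensor η (ket fun _ : A => false) fun w => z (ε w), ?_, fun a b => ?_⟩⟩
  · rw [← norm_tensor_ket η (fun _ : A => false), ← sq_eq_sq₀ (norm_nonneg _) (norm_nonneg _),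
      EuclideanSpace.norm_sq_eq, EuclideanSpace.norm_sq_eq]
    exact (Equiv.arrowCongr ε.symm (Equiv.refl Bool)).sum_comp
      (fun z => ‖tensor η (ket fun _ : A => false) z‖ ^ 2)
  · rw [← sq_eq_sq₀ (norm_nonneg _) (norm_nonneg _), EuclideanSpace.norm_sq_eq,
      EuclideanSpace.norm_sq_eq, ← (Equiv.arrowCongr e.symm (Equiv.refl Bool)).sum_comp]
    refine Finset.sum_congr rfl fun z _ => ?_
    have h1 : slice e.toEmbedding z (tensor a (ket fun _ => false)) =
        tensor (tensor a (ket fun _ => false)) (ket fun _ => false) := by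
      ext x
      have h2 : ∀ w, Function.extend e.toEmbedding x z (e w) = x w := fun w =>
        e.toEmbedding.injective.extend_apply x z w
      have h3 : ∀ j, Function.extend e.toEmbedding x z (Sum.inl j) = x (Sum.inl (Sum.inl j)) :=
        fun j => h2 (Sum.inl (Sum.inl j))
      have h4 : (fun i => Function.extend e.toEmbedding x z (Sum.inr i)) = (fun _ => false) ↔
          (∀ k, x (Sum.inl (Sum.inr k)) = false) ∧ ∀ k, x (Sum.inr k) = false := by
        constructor
        · intro h
          refine ⟨fun k => ?_, fun k => ?_⟩
          · rw [← h2]; exact congrFun h (ε (Sum.inl k))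
          · rw [← h2]; exact congrFun h (ε (Sum.inr k))
        · rintro ⟨h, h'⟩
          funext i
          obtain ⟨k | k, rfl⟩ := ε.surjective i
          · exact (h2 (Sum.inl (Sum.inr k))).trans (h k)
          · exact (h2 (Sum.inr k)).trans (h' k)
      simp only [slice, tensor_ket_apply, h3, h4]
      simp only [funext_iff]
      by_cases h5 : ∀ k, x (Sum.inl (Sum.inr k)) = false <;>
        by_cases h6 : ∀ k, x (Sum.inr k) = false <;> simp [h5, h6]
    have h7 : tensor b (WithLp.toLp 2 fun z => tensor η (ket fun _ : A => false) fun w => z (ε w)) z =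
        tensor (tensor b η) (ket fun _ : A => false) (fun w => z (e w)) := by
      simp only [tensor]
      rw [← mul_assoc]
      rfl
    rw [PiLp.sub_apply, PiLp.sub_apply, Circuit.run_map_apply, h1, h7]
    rfl

section Algorithm

variable {M s : ℕ}

/-- The number whose digits, in an arrangement suitable for the Fourier transforms of the blocks,
are the qubits of the block register. -/
def blockSum (κ : Fin (M + 1) × Fin (3 * s) → Bool) : ℕ :=
  ∑ i : Fin (M + 1), 2 ^ (s * i) * revVal fun a => κ (i, a)

/-- The number in the `i`-th block. -/
def blockVal (κ : Fin (M + 1) × Fin (3 * s) → Bool) (i : ℕ) : ℕ :=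
  if h : i < M + 1 then Nat.ofBits fun a => κ (⟨i, h⟩, a) else 0

theorem blockVal_lt (κ : Fin (M + 1) × Fin (3 * s) → Bool) (i : ℕ) : blockVal κ i < 2 ^ (3 * s) := by
  rw [blockVal]
  split_ifs
  · exact Nat.ofBits_lt_two_pow _
  · positivity

/-- The residue that is recovered from the contents of the blocks. -/
def decode (N : ℕ) (κ : Fin (M + 1) × Fin (3 * s) → Bool) : ℕ :=
  N * reconstruct s M (blockVal κ) / 2 ^ (s * M + 3 * s)

/-- The phases of the blocks that encode the fraction `j / N`, and the shift that makes up for the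
two-sided errors of the Fourier transform. -/
def blockPhase (s N j : ℕ) (i : Fin (M + 1)) : ℝ := 2 ^ (s * (i : ℕ)) * (j / N) + 1 / 2 ^ (s + 3)

/-- The amplitudes of the state of the blocks that encodes the fraction `j / N`. -/
def blockState (N j : ℕ) (e : Fin (M + 1) × Fin (3 * s) → Bool) : ℂ :=
  ∏ i, blockAmp (3 * s) (blockPhase s N j i - Nat.ofBits (fun a => e (i, a)) / 2 ^ (3 * s))

/-- The probability that the decoder fails. -/
theorem sum_blockState_le {n N : ℕ} (hs : 2 ≤ s) (hNM : N ≤ 2 ^ (s * (M + 1)))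
    (y : Fin n → Bool) (hy : Nat.ofBits y < N) :
    ∑ e with bits n (decode N e) ≠ y, ‖blockState (M := M) (s := s) N (Nat.ofBits y) e‖ ^ 2 ≤
      64 * (M + 1) / 2 ^ s := by
  refine (sum_norm_prod_blockAmp_sq_le (blockPhase s N (Nat.ofBits y)) (ρ := 1 / 2 ^ (s + 4))
    (by positivity) _ ?_).trans (le_of_eq ?_)
  · intro e he
    by_contra hcon
    push Not at hcon
    simp only [Finset.mem_filter, Finset.mem_univ, true_and] at he
    apply he
    have : decode N e = Nat.ofBits y := by
      refine reconstruct_spec hs hy hNM _ (fun i _ => blockVal_lt e i) fun i hi => ?_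
      obtain ⟨A, hA⟩ := hcon ⟨i, by omega⟩
      refine ⟨A, ?_⟩
      rw [blockVal, dif_pos (by omega)]
      exact hA
    rw [this, bits_ofBits]
  · rw [Fintype.card_fin, show (2 : ℝ) ^ (s + 4) = 2 ^ s * 16 by rw [pow_add]; norm_num,
      show (2 : ℝ) ^ (3 * s) = (2 ^ s) ^ 3 by rw [mul_comm, pow_mul]]
    push_cast
    field_simp
    norm_num

theorem sum_blockPhase (N j : ℕ) (κ : Fin (M + 1) × Fin (3 * s) → Bool) :
    ∑ i, (revVal (fun a => κ (i, a)) : ℝ) * (2 ^ (s * (i : ℕ)) * (j / N)) =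
      (j * blockSum κ / N : ℝ) := by
  rw [blockSum]
  push_cast
  rw [Finset.mul_sum, Finset.sum_div]
  refine Finset.sum_congr rfl fun i _ => ?_
  ring

/-- The algorithm, for given circuits for the phases and for the arithmetic. The registers hold the
input, the blocks, a random number `r` and a quotient. The phases encode the input in the Fourier basis;
the first arithmetic circuit is used in the basis of the transformed blocks, to erase the input; the
second one turns `blockSum κ + r` into its residue modulo `N` and a quotient, and the third one
computes `r` from the rest, to reset it. -/
theorem approximatesQFT_of_impl {n N P τ S₁ D₁ S₂ D₂ S₃ D₃ S₄ D₄ : ℕ} (hs : 2 ≤ s) (hN1 : 1 ≤ N)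
    (hN : N ≤ 2 ^ n) (hNM : N ≤ 2 ^ (s * (M + 1))) (hP : N < 2 ^ P)
    (hτ : ∀ κ : Fin (M + 1) × Fin (3 * s) → Bool, blockSum κ + 2 ^ P ≤ N * 2 ^ τ)
    (d : (Quad (Fin n) (Fin (M + 1) × Fin (3 * s)) (Fin P) (Fin τ) → Bool) → ℂ) {ε : ℝ}
    (hd : Impl (fun ψ => WithLp.toLp 2 fun z => d z * ψ z) S₁ D₁) (hε : 0 ≤ ε)
    (hdε : ∀ z, Nat.ofBits (fun i => z (Sum.inl i)) < N → ‖d z - cis (Nat.ofBits (fun i => z (Sum.inl i)) *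
      ((blockSum (fun k => z (Sum.inr (Sum.inl k))) +
        Nat.ofBits fun r => z (Sum.inr (Sum.inr (Sum.inl r))) : ℕ) : ℝ) / N)‖ ≤ ε)
    (hdec : Comp (fun κ : Fin (M + 1) × Fin (3 * s) → Bool => bits n (decode N κ)) S₂ D₂)
    (hdiv : Comp (fun z : (Fin (M + 1) × Fin (3 * s)) ⊕ Fin P → Bool => Sum.elim
      (bits n ((blockSum (fun k => z (Sum.inl k)) + Nat.ofBits fun r => z (Sum.inr r)) % N))
      (bits τ ((blockSum (fun k => z (Sum.inl k)) + Nat.ofBits fun r => z (Sum.inr r)) / N))) S₃ D₃)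
    (g : (Fin n ⊕ ((Fin (M + 1) × Fin (3 * s)) ⊕ Fin τ) → Bool) → Fin P → Bool)
    (hg : Comp g S₄ D₄)
    (hgspec : ∀ x κ t, blockSum κ ≤ Nat.ofBits x + N * Nat.ofBits t →
      g (Sum.elim x (Sum.elim κ t)) = bits P (Nat.ofBits x + N * Nat.ofBits t - blockSum κ)) :
    ∃ (c : ℕ) (C : Circuit (Fin n ⊕ Fin c)),
      C.size ≤ ((M + 1) * (3 * s) + P) + S₁ + 2 * ((2 * (3 * s) + 2) * (3 * s) * (M + 1)) + S₂ + S₃ + S₄ ∧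
      C.depth ≤ 1 + D₁ + 2 * (3 * (3 * s) + 1) + D₂ + D₃ + D₄ ∧
      ∃ η : State (Fin c), ‖η‖ = 1 ∧ ∀ α : EuclideanSpace ℂ (Fin N), ‖α‖ = 1 →
        ‖C.run (tensor (superposition n α) (ket fun _ => false)) -
          tensor (superposition n (qft α)) η‖ ≤
        ε + Real.sqrt (3 * (64 * (M + 1) / 2 ^ s)) + (Real.sqrt (2 * (N / 2 ^ P)) + N / 2 ^ P) := by
  obtain ⟨V, hV1, hV2, hV3⟩ := exists_blockQFT (ι := Fin (M + 1)) (q := 3 * s) (s + 3)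
  obtain ⟨H, hH1, hH2, hH3⟩ := exists_hadLayer_quad (J := Fin n) (K := Fin (M + 1) × Fin (3 * s))
    (R := Fin P) (T := Fin τ)
  obtain ⟨T₂, hT₂, hT₂'⟩ := quadState_xorBy_first (R := Fin P) (T := Fin τ) hdec
  obtain ⟨T₃, hT₃, hT₃'⟩ := quadState_xorBy_first_fourth hdiv
  obtain ⟨T₄, hT₄, hT₄'⟩ := quadState_xorBy_third hg
  obtain ⟨η, hη1, hη⟩ := exists_product_state (n := n) hN1 hP (blockSum (M := M) (s := s)) hτ
  have hV : Impl _ _ _ := (V.map (secondReg (J := Fin n) (R := Fin P) (T := Fin τ))).impl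
  have hVi : Impl _ _ _ := (V.inv.map (secondReg (J := Fin n) (R := Fin P) (T := Fin τ))).impl
  have hX := hT₄.comp (hT₃.comp hVi)
  obtain ⟨A, i1, i2, C, hC1, hC2, hC3⟩ := hX.comp (hT₂.comp (hV.comp (hd.comp H.impl)))
  obtain ⟨c, C', hC'1, hC'2, hC'3⟩ := C.exists_relabel
  obtain ⟨η', hη'1, hη'⟩ := hC'3 η
  refine ⟨c, C', ?_, ?_, η', hη'1.trans hη1, fun α hα => ?_⟩
  · simp only [Circuit.size_map, Circuit.size_inv, hH1, Fintype.card_prod, Fintype.card_fin] at hC1 hV1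
    omega
  · simp only [Circuit.depth_map, Circuit.depth_inv, hH2] at hC2
    omega
  rw [hη', hC3, tensor_ket_sub, norm_tensor_ket]
  set a := superposition n α with ha
  have ha1 : ‖a‖ = 1 := by rw [ha, norm_superposition hN, hα]
  set h : ℂ := 1 / (Real.sqrt 2 : ℂ) with hh
  set k := Fintype.card (Fin (M + 1) × Fin (3 * s)) with hk
  have hVrun : ∀ j : ℕ, V.run (WithLp.toLp 2 fun κ => h ^ k * cis (j * blockSum κ / N)) =
      WithLp.toLp 2 (blockState N j) := by
    intro j
    ext z
    have := hV3 (fun i => 2 ^ (s * (i : ℕ)) * (j / N)) z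
    simp only [sum_blockPhase] at this
    exact this
  -- The phases turn the uniform superposition of the blocks and of `r` into a product of Fourier basis
  -- states; these are transformed block by block, and the decoded input is subtracted.
  have hE1 : ‖T₂ ((V.map secondReg).run (WithLp.toLp 2 fun z => d z *
      H.run (tensor a (ket fun _ => false)) z)) -
      quadState (fun x e r t =>
        h ^ P * (a (bxor x (bits n (decode N e))) *
          blockState N (Nat.ofBits (bxor x (bits n (decode N e)))) e *
          cis (Nat.ofBits (bxor x (bits n (decode N e))) * Nat.ofBits r / N)) *
          if t = fun _ => false then 1 else 0)‖ ≤ ε := by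
    rw [← hT₂' (fun x e r t => h ^ P * (a x * blockState N (Nat.ofBits x) e *
          cis (Nat.ofBits x * Nat.ofBits r / N)) * if t = fun _ => false then 1 else 0),
      hT₂.norm_sub]
    rw [← run_map_secondReg V (fun x κ r t => h ^ (k + Fintype.card (Fin P)) * a x *
      (if t = fun _ => false then 1 else 0) *
      cis (Nat.ofBits x * ((blockSum κ + Nat.ofBits r : ℕ) : ℝ) / N)), hV.norm_sub]
    · refine (sq_le_sq₀ (norm_nonneg _) hε).1 ?_
      have hn : ‖H.run (tensor a (ket fun _ => false))‖ = 1 := by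
        rw [Circuit.norm_run, norm_tensor_ket, ha1]
      rw [show ε ^ 2 = ε ^ 2 * ‖H.run (tensor a (ket fun _ => false))‖ ^ 2 by
        rw [hn, one_pow, mul_one], EuclideanSpace.norm_sq_eq, EuclideanSpace.norm_sq_eq,
        Finset.mul_sum]
      refine Finset.sum_le_sum fun z _ => ?_
      rw [← mul_pow]
      refine pow_le_pow_left₀ (norm_nonneg _) ?_ 2
      rw [hH3]
      simp only [quadState, PiLp.sub_apply]
      by_cases hz : Nat.ofBits (fun i => z (Sum.inl i)) < N
      · rw [mul_comm (d z), ← mul_sub, norm_mul, mul_comm]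
        exact mul_le_mul_of_nonneg_right (hdε z hz) (norm_nonneg _)
      · rw [superposition_of_le hN α _ (not_lt.1 hz)]
        simp
    · intro x r t κ
      have h1 : (WithLp.toLp 2 fun κ => h ^ (k + Fintype.card (Fin P)) * a x *
          (if t = fun _ => false then 1 else 0) *
          cis (Nat.ofBits x * ((blockSum κ + Nat.ofBits r : ℕ) : ℝ) / N) :
          State (Fin (M + 1) × Fin (3 * s))) =
          (h ^ P * a x * (if t = fun _ => false then 1 else 0) * cis (Nat.ofBits x * Nat.ofBits r / N)) •
          WithLp.toLp 2 fun κ => h ^ k * cis (Nat.ofBits x * blockSum κ / N) := by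
        ext κ
        simp only [PiLp.smul_apply, smul_eq_mul, Fintype.card_fin, pow_add]
        rw [show (Nat.ofBits x * ((blockSum κ + Nat.ofBits r : ℕ) : ℝ) / N) =
          Nat.ofBits x * blockSum κ / N + Nat.ofBits x * Nat.ofBits r / N by push_cast; ring, cis_add]
        ring
      rw [h1, ← Circuit.lin_apply, map_smul, Circuit.lin_apply, hVrun, PiLp.smul_apply, smul_eq_mul]
      ring
  -- The decoder is almost always right, so that the first register is `0` up to a small error.
  have hE2 := norm_erase_sq_le (T := Fin τ) hN1 hN hP.le a (superposition_of_le hN α) ha1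
    (fun y e => blockState (M := M) (s := s) N (Nat.ofBits y) e) (fun e => bits n (decode N e))
    (fun y hy => sum_blockState_le hs hNM y hy)
  have hE2 := Real.le_sqrt_of_sq_le hE2
  -- If the first register is exactly `0`, the remaining steps produce, at `F = blockSum κ + r`, the
  -- amplitude of the transform at `F % N`, times a state that involves `F` only through a condition.
  have hE3 : T₄ (T₃ ((V.inv.map secondReg).run (quadState (fun x e r t =>
      h ^ P * (if x = fun _ => false then
        ∑ y, a y * blockState (M := M) (s := s) N (Nat.ofBits y) e *
          cis (Nat.ofBits y * Nat.ofBits r / N) else 0) *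
          if t = fun _ => false then 1 else 0)))) =
      quadState (fun x κ r t => h ^ (k + P) * (Real.sqrt N) * superposition n (qft α) x *
        if (r = fun _ => false) ∧ blockSum κ ≤ Nat.ofBits x + N * Nat.ofBits t ∧
          Nat.ofBits x + N * Nat.ofBits t < blockSum κ + 2 ^ P then 1 else 0) := by
    rw [run_map_secondReg V.inv _ (fun x κ r t => h ^ (k + P) * (if x = fun _ => false then
      qftSum n N α (blockSum κ + Nat.ofBits r) else 0) * if t = fun _ => false then 1 else 0)]
    · rw [hT₃', hT₄']
      congr 1
      funext x κ r t
      simp only [Sum.elim_inl, Sum.elim_inr]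
      set G := g (Sum.elim x (Sum.elim κ t)) with hG
      set F := blockSum κ + Nat.ofBits (bxor r G) with hF
      have hFlt : F < N * 2 ^ τ := by
        have h1 := Nat.ofBits_lt_two_pow (bxor r G)
        have h2 := hτ κ
        omega
      have h1 : (bxor x fun j => bits n (F % N) j) = (fun _ => false) ↔ Nat.ofBits x = F % N := by
        rw [bxor_eq_false]
        exact eq_bits_iff ((Nat.mod_lt F hN1).trans_le hN)
      have h2 : (bxor t fun j => bits τ (F / N) j) = (fun _ => false) ↔ Nat.ofBits t = F / N := by
        rw [bxor_eq_false]
        exact eq_bits_iff (Nat.div_lt_of_lt_mul hFlt)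
      change h ^ (k + P) * (if (bxor x fun j => bits n (F % N) j) = (fun _ => false) then
        qftSum n N α F else 0) * (if (bxor t fun j => bits τ (F / N) j) = (fun _ => false) then 1
        else 0) = _
      simp only [h1, h2]
      rw [superposition_qft hN]
      by_cases hc : Nat.ofBits x = F % N ∧ Nat.ofBits t = F / N
      · have h3 : Nat.ofBits x + N * Nat.ofBits t = F := by
          rw [hc.1, hc.2]; exact Nat.mod_add_div F N
        have h4 : g (Sum.elim x (Sum.elim κ t)) = bxor r G := by
          rw [hgspec x κ t (by omega), h3, hF, Nat.add_sub_cancel_left, bits_ofBits]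
        have h5 : r = fun _ => false := by
          funext i
          have := congrFun h4 i
          rw [← hG, bxor] at this
          revert this
          cases r i <;> cases G i <;> simp
        have h6 := Nat.ofBits_lt_two_pow (bxor r G)
        rw [if_pos hc.1, if_pos hc.2, if_pos (by rw [hc.1]; exact Nat.mod_lt F hN1),
          if_pos ⟨h5, by omega, by omega⟩, hc.1, qftSum_mod hN]
        have h7 : (Real.sqrt N : ℂ) ≠ 0 := by
          rw [Complex.ofReal_ne_zero]
          exact (Real.sqrt_pos.2 (by exact_mod_cast hN1)).ne'
        field_simp
      · have h8 : ∀ u v : ℂ, u * (if Nat.ofBits x = F % N then v else 0) *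
            (if Nat.ofBits t = F / N then 1 else 0) = 0 := by
          intro u v
          split_ifs with h9 h10
          · exact (hc ⟨h9, h10⟩).elim
          · simp
          · simp
          · simp
        rw [h8]
        symm
        by_cases hx : Nat.ofBits x < N
        · refine (congrArg _ (if_neg ?_)).trans (mul_zero _)
          rintro ⟨rfl, h9, h10⟩
          apply hc
          have h11 : bxor (fun _ => false) G = G := by funext i; simp [bxor]
          have h12 : F = Nat.ofBits x + N * Nat.ofBits t := by
            rw [hF, h11, hG, hgspec x κ t h9, ofBits_bits_of_lt (by omega)]
            omega
          rw [h12, Nat.add_mul_mod_self_left, Nat.mod_eq_of_lt hx, Nat.add_mul_div_left _ _ hN1,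
            Nat.div_eq_of_lt hx, zero_add]
          exact ⟨rfl, rfl⟩
        · rw [if_neg hx, mul_zero, zero_mul]
    · intro x r t κ
      set coef : (Fin n → Bool) → ℂ := fun y => h ^ P * (if x = fun _ => false then
        a y * cis (Nat.ofBits y * Nat.ofBits r / N) else 0) * if t = fun _ => false then 1 else 0
        with hcoef
      have h1 : (WithLp.toLp 2 fun κ => h ^ (k + P) * (if x = fun _ => false then
          qftSum n N α (blockSum κ + Nat.ofBits r) else 0) * if t = fun _ => false then 1 else 0 :
          State (Fin (M + 1) × Fin (3 * s))) =
          ∑ y, coef y • WithLp.toLp 2 fun κ => h ^ k * cis (Nat.ofBits y * blockSum κ / N) := by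
        ext κ
        simp only [WithLp.ofLp_sum, WithLp.ofLp_smul, Finset.sum_apply, Pi.smul_apply, smul_eq_mul,
          hcoef, qftSum]
        split_ifs
        · rw [mul_one, Finset.mul_sum]
          refine Finset.sum_congr rfl fun y _ => ?_
          rw [show (Nat.ofBits y * ((blockSum κ + Nat.ofBits r : ℕ) : ℝ) / N) =
            Nat.ofBits y * blockSum κ / N + Nat.ofBits y * Nat.ofBits r / N by push_cast; ring,
            cis_add, pow_add]
          ring
        all_goals simp
      have h2 : (WithLp.toLp 2 fun e => h ^ P * (if x = fun _ => false then
          ∑ y, a y * blockState (M := M) (s := s) N (Nat.ofBits y) e *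
          cis (Nat.ofBits y * Nat.ofBits r / N) else 0) * if t = fun _ => false then 1 else 0) =
          V.run (WithLp.toLp 2 fun κ => h ^ (k + P) * (if x = fun _ => false then
          qftSum n N α (blockSum κ + Nat.ofBits r) else 0) * if t = fun _ => false then 1 else 0) := by
        rw [h1, ← Circuit.lin_apply, map_sum]
        simp only [map_smul, Circuit.lin_apply, hVrun]
        ext e
        simp only [WithLp.ofLp_sum, WithLp.ofLp_smul, Finset.sum_apply, Pi.smul_apply, smul_eq_mul,
          hcoef]
        split_ifs
        · rw [mul_one, Finset.mul_sum]
          refine Finset.sum_congr rfl fun y _ => ?_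
          ring
        all_goals simp
      rw [h2, Circuit.inv_run_run]
  have hE4 := hη (superposition n (qft α)) (by rw [norm_superposition hN, norm_qft, hα])
    (superposition_of_le hN _)
  rw [← hE3] at hE4
  refine (norm_sub_le_norm_sub_add_norm_sub _ _ _).trans (add_le_add ?_ hE4)
  rw [hX.norm_sub]
  exact (norm_sub_le_norm_sub_add_norm_sub _ _ _).trans (add_le_add hE1 hE2)

end Algorithm

/-! ### The algorithm for given arithmetic circuits -/

section Weights

variable {M s : ℕ}

theorem revVal_eq_ofBits {q : ℕ} (x : Fin q → Bool) : revVal x = Nat.ofBits fun i => x i.rev := by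
  rw [revVal, ofBits_eq_sum, ← Equiv.sum_comp Fin.revPerm]
  refine Finset.sum_congr rfl fun j _ => ?_
  simp only [Fin.revPerm_apply, Fin.val_rev]
  congr 2
  omega

theorem revVal_lt {q : ℕ} (x : Fin q → Bool) : revVal x < 2 ^ q := by
  rw [revVal_eq_ofBits]; exact Nat.ofBits_lt_two_pow _

theorem blockSum_lt (hs : 1 ≤ s) (κ : Fin (M + 1) × Fin (3 * s) → Bool) :
    blockSum κ < 2 ^ (s * M + 3 * s + 1) := by
  have h1 : blockSum κ ≤ 2 ^ (3 * s) * ∑ i ∈ Finset.range (M + 1), (2 ^ s) ^ i := by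
    rw [blockSum, Finset.mul_sum, ← Fin.sum_univ_eq_sum_range (fun i => 2 ^ (3 * s) * (2 ^ s) ^ i)]
    refine Finset.sum_le_sum fun i _ => ?_
    rw [← pow_mul, mul_comm]
    exact Nat.mul_le_mul_right _ (revVal_lt _).le
  have h2 : ∑ i ∈ Finset.range (M + 1), (2 ^ s) ^ i < 2 * (2 ^ s) ^ M := by
    rw [Finset.sum_range_succ]
    have := Nat.geomSum_lt (m := 2 ^ s) (n := M) (s := Finset.range M)
            (by calc 2 = 2 ^ 1 := rfl
                  _ ≤ 2 ^ s := Nat.pow_le_pow_right (by norm_num) hs) (by simp)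
    omega
  refine h1.trans_lt ((Nat.mul_lt_mul_of_pos_left h2 (by positivity)).trans_le (le_of_eq ?_))
  rw [pow_succ, pow_add, pow_mul]
  ring

/-- The exponents of the binary weights of the qubits of the block register and of the third
register. -/
def digitWeight {P : ℕ} : (Fin (M + 1) × Fin (3 * s)) ⊕ Fin P → ℕ :=
  Sum.elim (fun p => s * p.1 + (3 * s - 1 - p.2)) fun r => r

/-- Blocks whose indices differ by a multiple of three do not overlap. -/
def digitClass {P : ℕ} : (Fin (M + 1) × Fin (3 * s)) ⊕ Fin P → Fin 4 :=
  Sum.elim (fun p => ⟨(p.1 : ℕ) % 3, by omega⟩) fun _ => 3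

theorem digitWeight_injective {P : ℕ} (φ φ' : (Fin (M + 1) × Fin (3 * s)) ⊕ Fin P)
    (h : digitWeight φ = digitWeight φ') (h' : digitClass φ = digitClass φ') : φ = φ' := by
  rcases φ with ⟨i, a⟩ | r <;> rcases φ' with ⟨i', a'⟩ | r' <;>
    simp only [digitWeight, digitClass, Sum.elim_inl, Sum.elim_inr, Fin.ext_iff] at h h'
  · have ha := a.isLt
    have ha' := a'.isLt
    have hi : (i : ℕ) = i' := by
      by_contra hne
      rcases Nat.lt_or_gt_of_ne hne with hlt | hlt
      · obtain ⟨k, hk⟩ : ∃ k, (i' : ℕ) = i + 3 * (k + 1) := ⟨(i' - i) / 3 - 1, by omega⟩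
        rw [hk] at h
        have : s * (i + 3 * (k + 1)) = s * i + 3 * (s * k) + 3 * s := by ring
        omega
      · obtain ⟨k, hk⟩ : ∃ k, (i : ℕ) = i' + 3 * (k + 1) := ⟨(i - i') / 3 - 1, by omega⟩
        rw [hk] at h
        have : s * (i' + 3 * (k + 1)) = s * i' + 3 * (s * k) + 3 * s := by ring
        omega
    rw [hi] at h
    have : (a : ℕ) = a' := by omega
    rw [Fin.ext hi, Fin.ext this]
  · have : (3 : Fin 4).val = 3 := rfl
    omega
  · have : (3 : Fin 4).val = 3 := rfl
    omega
  · rw [Fin.ext h]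

theorem sum_digits {P : ℕ} (κ : Fin (M + 1) × Fin (3 * s) → Bool) (r : Fin P → Bool) :
    ∑ φ : (Fin (M + 1) × Fin (3 * s)) ⊕ Fin P, ((Sum.elim κ r φ).toNat : ℝ) * 2 ^ digitWeight φ =
      (blockSum κ + Nat.ofBits r : ℕ) := by
  rw [Fintype.sum_sum_type, Fintype.sum_prod_type, blockSum, ofBits_eq_sum]
  push_cast
  congr 1
  refine Finset.sum_congr rfl fun i _ => ?_
  rw [revVal]
  push_cast
  rw [Finset.mul_sum]
  refine Finset.sum_congr rfl fun a _ => ?_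
  simp only [digitWeight, Sum.elim_inl, pow_add]
  ring

/-- The algorithm for given circuits for the arithmetic. The first circuit yields the digits of an
approximation to `j / N`; the other ones recover the residue from the Fourier basis states, divide
by `N`, and reset the third register. -/
theorem approximatesQFT_of_comp {n N P τ S₁ D₁ S₂ D₂ S₃ D₃ S₄ D₄ : ℕ} (hs : 2 ≤ s) (hN1 : 1 ≤ N)
    (hN : N ≤ 2 ^ n) (hNM : N ≤ 2 ^ (s * (M + 1))) (hP : N < 2 ^ P)
    (hτ : ∀ κ : Fin (M + 1) × Fin (3 * s) → Bool, blockSum κ + 2 ^ P ≤ N * 2 ^ τ)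
    {Ω : Type} [Fintype Ω] [DecidableEq Ω] (f : (Fin n → Bool) → Ω → Bool) (c : Ω → ℕ) (p : Ω → Fin 2)
    (hcp : ∀ ω ω', c ω = c ω' → p ω = p ω' → ω = ω') (hf : Comp f S₁ D₁) {ε : ℝ} (hε0 : 0 ≤ ε)
    (hε : ∀ x, Nat.ofBits x < N → |∑ ω, ((f x ω).toNat : ℝ) / 2 ^ c ω - Nat.ofBits x / N| ≤ ε)
    (hdec : Comp (fun κ : Fin (M + 1) × Fin (3 * s) → Bool => bits n (decode N κ)) S₂ D₂)
    (hdiv : Comp (fun z : (Fin (M + 1) × Fin (3 * s)) ⊕ Fin P → Bool => Sum.elim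
      (bits n ((blockSum (fun k => z (Sum.inl k)) + Nat.ofBits fun r => z (Sum.inr r)) % N))
      (bits τ ((blockSum (fun k => z (Sum.inl k)) + Nat.ofBits fun r => z (Sum.inr r)) / N))) S₃ D₃)
    (g : (Fin n ⊕ ((Fin (M + 1) × Fin (3 * s)) ⊕ Fin τ) → Bool) → Fin P → Bool)
    (hg : Comp g S₄ D₄)
    (hgspec : ∀ x κ t, blockSum κ ≤ Nat.ofBits x + N * Nat.ofBits t →
      g (Sum.elim x (Sum.elim κ t)) = bits P (Nat.ofBits x + N * Nat.ofBits t - blockSum κ)) :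
    ∃ (c : ℕ) (C : Circuit (Fin n ⊕ Fin c)),
      C.size ≤ ((M + 1) * (3 * s) + P) * (1 + s * 2) + 2 * S₁ +
        2 * ((2 * (3 * s) + 2) * (3 * s) * (M + 1)) + S₂ + S₃ + S₄ ∧
      C.depth ≤ 1 + (2 * D₁ + s * (4 * 2)) + 2 * (3 * (3 * s) + 1) + D₂ + D₃ + D₄ ∧
      ∃ η : State (Fin c), ‖η‖ = 1 ∧ ∀ α : EuclideanSpace ℂ (Fin N), ‖α‖ = 1 →
        ‖C.run (tensor (superposition n α) (ket fun _ => false)) -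
          tensor (superposition n (qft α)) η‖ ≤
        2 * Real.pi * (((M + 1) * (3 * s) + P : ℕ) * (2 / 2 ^ s) +
          (2 ^ (s * M + 3 * s + 1) + 2 ^ P) * ε) +
        Real.sqrt (3 * (64 * (M + 1) / 2 ^ s)) + (Real.sqrt (2 * (N / 2 ^ P)) + N / 2 ^ P) := by
  let eJ : Fin n ↪ Quad (Fin n) (Fin (M + 1) × Fin (3 * s)) (Fin P) (Fin τ) :=
    ⟨Sum.inl, Sum.inl_injective⟩
  let eΦ : (Fin (M + 1) × Fin (3 * s)) ⊕ Fin P ↪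
    Quad (Fin n) (Fin (M + 1) × Fin (3 * s)) (Fin P) (Fin τ) :=
    ⟨Sum.elim (fun k => Sum.inr (Sum.inl k))
    fun r => Sum.inr (Sum.inr (Sum.inl r)), by rintro (v | u) (v' | u') h <;> simp_all⟩
  obtain ⟨d, hd, hdε⟩ := impl_mul_phase hf eJ eΦ digitWeight c digitClass p digitWeight_injective
    hcp s
  set B : ℝ := 2 * Real.pi * (((M + 1) * (3 * s) + P : ℕ) * (2 / 2 ^ s) +
    (2 ^ (s * M + 3 * s + 1) + 2 ^ P) * ε) with hB
  have hB0 : 0 ≤ B := by positivity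
  have hd' : ∀ z, Nat.ofBits (fun i => z (Sum.inl i)) < N →
      ‖d z - cis (Nat.ofBits (fun i => z (Sum.inl i)) *
      ((blockSum (fun k => z (Sum.inr (Sum.inl k))) +
        Nat.ofBits fun r => z (Sum.inr (Sum.inr (Sum.inl r))) : ℕ) : ℝ) / N)‖ ≤ B := by
    intro z hz
    refine (norm_sub_le_norm_sub_add_norm_sub _ _ _).trans
      ((add_le_add (hdε z) (norm_cis_sub_cis_le _ _)).trans (le_of_eq_of_le (mul_add _ _ _).symm ?_))
    refine mul_le_mul_of_nonneg_left (add_le_add (le_of_eq ?_) ?_) Real.two_pi_pos.le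
    · simp only [Fintype.card_sum, Fintype.card_prod, Fintype.card_fin]
      push_cast
      ring
    set κ : Fin (M + 1) × Fin (3 * s) → Bool := fun k => z (Sum.inr (Sum.inl k)) with hκ
    set r : Fin P → Bool := fun i => z (Sum.inr (Sum.inr (Sum.inl i))) with hr
    set x : Fin n → Bool := fun i => z (Sum.inl i) with hx
    have h4 : ∑ φ, ((z (eΦ φ)).toNat : ℝ) * 2 ^ digitWeight φ = (blockSum κ + Nat.ofBits r : ℕ) := by
      rw [← sum_digits]
      refine Finset.sum_congr rfl fun φ _ => ?_
      rcases φ with φ | φ <;> rfl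
    rw [h4, mul_comm (Nat.ofBits x : ℝ), mul_div_assoc, ← mul_sub, abs_mul, Nat.abs_cast]
    refine mul_le_mul ?_ (hε x hz) (abs_nonneg _) (by positivity)
    have h5 := (blockSum_lt (by omega) κ).le
    have h6 := (Nat.ofBits_lt_two_pow r).le
    exact_mod_cast add_le_add h5 h6
  obtain ⟨c', C, h1, h2, h3⟩ := approximatesQFT_of_impl hs hN1 hN hNM hP hτ d hd hB0 hd' hdec hdiv
    g hg hgspec
  refine ⟨c', C, h1.trans (le_of_eq ?_), h2, h3⟩
  simp only [Fintype.card_sum, Fintype.card_prod, Fintype.card_fin]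
  ring

end Weights

/-! ### Arithmetic of the block register -/

section BlockArithmetic

theorem sum_range_mul {E : Type} [AddCommMonoid E] (Q k : ℕ) (f : ℕ → E) :
    ∑ p ∈ Finset.range (Q * k), f p =
      ∑ i ∈ Finset.range k, ∑ a ∈ Finset.range Q, f (Q * i + a) := by
  induction k with
  | zero => simp
  | succ k ih => rw [Nat.mul_succ, Finset.sum_range_add, ih, Finset.sum_range_succ]

theorem ofBits_eq_sum_range (w : ℕ) (b : ℕ → Bool) :
    Nat.ofBits (fun p : Fin w => b p) = ∑ p ∈ Finset.range w, (b p).toNat * 2 ^ p := by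
  rw [ofBits_eq_sum, Fin.sum_univ_eq_sum_range (fun p => (b p).toNat * 2 ^ p)]

theorem sum_testBit (x w : ℕ) : ∑ a ∈ Finset.range w, (x.testBit a).toNat * 2 ^ a = x % 2 ^ w := by
  rw [← ofBits_eq_sum_range]; exact ofBits_bits w x

variable {M s : ℕ}

theorem testBit_blockVal (κ : Fin (M + 1) × Fin (3 * s) → Bool) (i : Fin (M + 1))
    (a : Fin (3 * s)) : (blockVal κ i).testBit a = κ (i, a) := by
  rw [blockVal, dif_pos i.isLt]
  exact Nat.testBit_ofBits_lt _ _ a.isLt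

/-- The binary digits of `leadingDigits`. -/
def leadingBit (s M : ℕ) (e : ℕ → ℕ) (p : ℕ) : Bool :=
  if p < 3 * s then (e M).testBit p
  else (e (M - 1 - (p - 3 * s) / s)).testBit (2 * s + (p - 3 * s) % s)

theorem sum_leadingBit (hs : 1 ≤ s) (e : ℕ → ℕ) (he : ∀ i, e i < 2 ^ (3 * s)) :
    ∑ p ∈ Finset.range (3 * s + s * M), (leadingBit s M e p).toNat * 2 ^ p = leadingDigits s M e := by
  rw [Finset.sum_range_add, leadingDigits]
  congr 1
  · rw [← Nat.mod_eq_of_lt (he M), ← sum_testBit]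
    refine Finset.sum_congr rfl fun p hp => ?_
    rw [leadingBit, if_pos (Finset.mem_range.1 hp)]
  · rw [sum_range_mul, Finset.mul_sum, ← Finset.sum_range_reflect]
    refine Finset.sum_congr rfl fun k hk => ?_
    have hk := Finset.mem_range.1 hk
    have h1 : e k / 2 ^ (2 * s) = e k / 2 ^ (2 * s) % 2 ^ s := by
      refine (Nat.mod_eq_of_lt (Nat.div_lt_of_lt_mul ?_)).symm
      rw [← pow_add, show 2 * s + s = 3 * s by ring]
      exact he k
    rw [h1, ← sum_testBit, Finset.sum_mul, Finset.mul_sum]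
    refine Finset.sum_congr rfl fun a ha => ?_
    have ha := Finset.mem_range.1 ha
    rw [leadingBit, if_neg (by omega), Nat.add_sub_cancel_left, Nat.mul_add_div (by omega),
      Nat.div_eq_of_lt ha, Nat.mul_add_mod, Nat.mod_eq_of_lt ha, add_zero,
      show M - 1 - (M - 1 - k) = k by omega, Nat.testBit_div_two_pow,
      add_comm a (2 * s), pow_add, pow_add]
    ring

/-- The binary digits of `borrows`. -/
def borrowBit (s M : ℕ) (e : ℕ → ℕ) (p : ℕ) : Bool :=
  if p < 3 * s then false
  else if (p - 3 * s) % s = 0 then needsBorrow s e (M - 1 - (p - 3 * s) / s) else false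

theorem sum_borrowBit (hs : 1 ≤ s) (e : ℕ → ℕ) :
    ∑ p ∈ Finset.range (3 * s + s * M), (borrowBit s M e p).toNat * 2 ^ p = borrows s M e := by
  rw [Finset.sum_range_add, borrows, Finset.sum_eq_zero, zero_add]
  · rw [sum_range_mul, Finset.mul_sum, ← Finset.sum_range_reflect]
    refine Finset.sum_congr rfl fun k hk => ?_
    have hk := Finset.mem_range.1 hk
    rw [Finset.sum_eq_single 0]
    · rw [borrowBit, if_neg (by omega), Nat.add_sub_cancel_left, add_zero,
        if_pos (Nat.mul_mod_right _ _), Nat.mul_div_cancel_left _ (by omega),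
        show M - 1 - (M - 1 - k) = k by omega, pow_add]
      ring
    · intro a ha ha0
      have ha := Finset.mem_range.1 ha
      rw [borrowBit, if_neg (by omega), Nat.add_sub_cancel_left, Nat.mul_add_mod,
        Nat.mod_eq_of_lt ha, if_neg ha0]
      simp
    · intro h; exact (h (Finset.mem_range.2 (by omega))).elim
  · intro p hp
    rw [borrowBit, if_pos (Finset.mem_range.1 hp)]
    simp

/-- Both comparisons concern the leading bit of a number only. -/
theorem needsBorrow_eq (hs : 1 ≤ s) (e : ℕ → ℕ) (he : ∀ i, e i < 2 ^ (3 * s)) (i : ℕ) :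
    needsBorrow s e i = ((e (i + 1)).testBit (3 * s - 1) && !(e i).testBit (2 * s - 1)) := by
  have h1 : ∀ x w, 1 ≤ w → x < 2 ^ w → (x.testBit (w - 1) = true ↔ 2 ^ w ≤ 2 * x) := by
    intro x w hw hx
    obtain ⟨w, rfl⟩ := Nat.exists_eq_add_of_le' hw
    rw [Nat.add_sub_cancel, Nat.testBit_eq_decide_div_mod_eq, decide_eq_true_iff]
    rw [pow_succ] at hx ⊢
    have h2 : x / 2 ^ w < 2 := Nat.div_lt_of_lt_mul hx
    rw [Nat.mod_eq_of_lt h2]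
    constructor
    · intro h
      have := Nat.div_mul_le_self x (2 ^ w)
      rw [h] at this
      omega
    · intro h
      have : 1 ≤ x / 2 ^ w := (Nat.le_div_iff_mul_le (by positivity)).2 (by omega)
      omega
  have h2 := h1 (e (i + 1)) (3 * s) (by omega) (he _)
  have h3 := h1 (e i % 2 ^ (2 * s)) (2 * s) (by omega) (Nat.mod_lt _ (by positivity))
  rw [Nat.testBit_mod_two_pow, decide_eq_true (by omega : 2 * s - 1 < 2 * s), Bool.true_and] at h3
  rw [Bool.eq_iff_iff, needsBorrow, decide_eq_true_iff, Bool.and_eq_true, h2, Bool.not_eq_true',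
    ← Bool.not_eq_true, h3, not_le]

variable {u t m r : ℕ}

theorem compN_leadingDigits (hu : CostUnit u t m r) (hs : 1 ≤ s) (hw : 3 * s + s * M ≤ m) :
    CompN u t (3 * s + s * M) (fun κ : Fin (M + 1) × Fin (3 * s) → Bool =>
      leadingDigits s M (blockVal κ)) 3 := by
  have hdiv : ∀ p, p < 3 * s + s * M → ¬ p < 3 * s → (p - 3 * s) / s < M := by
    intro p hp hp'
    exact Nat.div_lt_of_lt_mul (by omega)
  have hlt : ∀ p, p < 3 * s + s * M → ¬ p < 3 * s → M - 1 - (p - 3 * s) / s < M := by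
    intro p hp hp'
    have := hdiv p hp hp'
    generalize (p - 3 * s) / s = x at this ⊢
    omega
  have hmod : ∀ p, (p - 3 * s) % s < s := fun p => Nat.mod_lt _ (by omega)
  let src : Fin (3 * s + s * M) → Fin (M + 1) × Fin (3 * s) := fun p =>
    if h : (p : ℕ) < 3 * s then (⟨M, by omega⟩, ⟨p, h⟩) else
      (⟨M - 1 - ((p : ℕ) - 3 * s) / s, (hlt p p.isLt h).trans M.lt_succ_self⟩,
        ⟨2 * s + ((p : ℕ) - 3 * s) % s, by
        have := hmod p; omega⟩)
  have hsrc : Function.Injective src := by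
    intro p p' h
    simp only [src] at h
    ext
    split_ifs at h with h1 h2 h2
    · simpa using h
    · have := hlt p' p'.isLt h2
      have h8 := congrArg (fun x => (x.1 : ℕ)) h
      have h9 := congrArg (fun x => (x.2 : ℕ)) h
      dsimp only at h8 h9
      omega
    · have := hlt p p.isLt h1
      have h8 := congrArg (fun x => (x.1 : ℕ)) h
      have h9 := congrArg (fun x => (x.2 : ℕ)) h
      dsimp only at h8 h9
      omega
    · have h3 := hdiv p p.isLt h1
      have h4 := hdiv p' p'.isLt h2
      have h8 := congrArg (fun x => (x.1 : ℕ)) h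
      have h9 := congrArg (fun x => (x.2 : ℕ)) h
      dsimp only at h8 h9
      have h5 := Nat.div_add_mod ((p : ℕ) - 3 * s) s
      have h6 := Nat.div_add_mod ((p' : ℕ) - 3 * s) s
      have h7 : ((p : ℕ) - 3 * s) / s = ((p' : ℕ) - 3 * s) / s := by omega
      rw [h7] at h5
      omega
  refine (hu.wires hw (fun p => Sum.inr (src p)) (fun i i' v h h' => hsrc
    ((Sum.inr_injective h).trans (Sum.inr_injective h').symm))).congr fun κ => ?_
  congr 1
  rw [← sum_leadingBit hs _ (blockVal_lt κ), ← ofBits_eq_sum_range]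
  congr 1
  funext p
  simp only [lit, Sum.elim_inr, src, leadingBit]
  split_ifs with h
  · exact (testBit_blockVal κ ⟨M, by omega⟩ ⟨p, h⟩).symm
  · exact (testBit_blockVal κ ⟨_, _⟩ ⟨_, _⟩).symm

theorem compN_borrows (hu : CostUnit u t m r) (hs : 1 ≤ s) (hw : 3 * s + s * M ≤ m) :
    CompN u t (3 * s + s * M) (fun κ : Fin (M + 1) × Fin (3 * s) → Bool =>
      borrows s M (blockVal κ)) 105 := by
  have h1 := (comp_lit (V := Fin (M + 1) × Fin (3 * s)) (U := Fin M)
    (fun i => Sum.inr (⟨i + 1, by omega⟩, ⟨3 * s - 1, by omega⟩)) (by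
      intro i i' v h h'
      have := (Sum.inr_injective h).trans (Sum.inr_injective h').symm
      simp only [Prod.mk.injEq, Fin.mk.injEq] at this
      ext; omega)).and (Comp.not (comp_lit (V := Fin (M + 1) × Fin (3 * s)) (U := Fin M)
    (fun i => Sum.inr (⟨i, by omega⟩, ⟨2 * s - 1, by omega⟩)) (by
      intro i i' v h h'
      have := (Sum.inr_injective h).trans (Sum.inr_injective h').symm
      simp only [Prod.mk.injEq, Fin.mk.injEq] at this
      ext; omega)))
  have hdiv : ∀ p, p < 3 * s + s * M → ¬ p < 3 * s → (p - 3 * s) / s < M := by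
    intro p hp hp'
    exact Nat.div_lt_of_lt_mul (by omega)
  have hlt : ∀ p, p < 3 * s + s * M → ¬ p < 3 * s → M - 1 - (p - 3 * s) / s < M := by
    intro p hp hp'
    have := hdiv p hp hp'
    generalize (p - 3 * s) / s = x at this ⊢
    omega
  have h2 := h1.select (fun p : Fin (3 * s + s * M) =>
    if h : (p : ℕ) < 3 * s then Sum.inl false else if ((p : ℕ) - 3 * s) % s = 0 then
      Sum.inr ⟨M - 1 - ((p : ℕ) - 3 * s) / s, hlt p p.isLt h⟩ else Sum.inl false) (by
    intro p p' v h h'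
    ext
    split_ifs at h h' with g1 g2 g3 g4
    have h3 := hdiv p p.isLt g1
    have h4 := hdiv p' p'.isLt g3
    have := (Sum.inr_injective h).trans (Sum.inr_injective h').symm
    simp only [Fin.mk.injEq] at this
    have h5 := Nat.div_add_mod ((p : ℕ) - 3 * s) s
    have h6 := Nat.div_add_mod ((p' : ℕ) - 3 * s) s
    have h7 : ((p : ℕ) - 3 * s) / s = ((p' : ℕ) - 3 * s) / s := by omega
    rw [h7] at h5
    omega)
  refine Comp.congr (h2.mono ?_ ?_) ?_
  · have h3 := hu.le_u hw
    have h4 : M ≤ s * M := Nat.le_mul_of_pos_left M hs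
    simp only [Fintype.card_fin]
    omega
  · have := hu.one_le_t
    omega
  · intro κ p
    have hb : (borrows s M (blockVal κ)).testBit p = borrowBit s M (blockVal κ) p := by
      rw [← sum_borrowBit hs, ← ofBits_eq_sum_range, Nat.testBit_ofBits_lt _ _ p.isLt]
    rw [bits, hb, borrowBit]
    split_ifs with h3 h4
    · rfl
    · simp only [lit, Sum.elim_inr]
      rw [needsBorrow_eq hs _ (blockVal_lt κ)]
      congr 1
      · exact (testBit_blockVal κ ⟨_, _⟩ ⟨_, _⟩).symm
      · congr 1
        exact (testBit_blockVal κ ⟨_, _⟩ ⟨_, _⟩).symm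
    · rfl

/-- The number formed by every third block. These blocks do not overlap, so that the digits of the
number can be read off. -/
def thirdSum (κ : Fin (M + 1) × Fin (3 * s) → Bool) (c : ℕ) : ℕ :=
  ∑ k ∈ Finset.range (M / 3 + 1), 2 ^ (3 * s * k) *
    if h : 3 * k + c < M + 1 then revVal fun a => κ (⟨3 * k + c, h⟩, a) else 0

theorem blockSum_eq (κ : Fin (M + 1) × Fin (3 * s) → Bool) :
    blockSum κ = thirdSum κ 0 + thirdSum κ 1 * 2 ^ s + thirdSum κ 2 * 2 ^ (2 * s) := by
  have h1 : blockSum κ = ∑ i ∈ Finset.range (3 * (M / 3 + 1)), 2 ^ (s * i) *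
      if h : i < M + 1 then revVal fun a => κ (⟨i, h⟩, a) else 0 := by
    have h2 : Finset.range (M + 1) ⊆ Finset.range (3 * (M / 3 + 1)) :=
      Finset.range_mono (by omega)
    rw [← Finset.sum_subset h2]
    · rw [blockSum, ← Fin.sum_univ_eq_sum_range (fun i => 2 ^ (s * i) *
        if h : i < M + 1 then revVal fun a => κ (⟨i, h⟩, a) else 0)]
      refine Finset.sum_congr rfl fun i _ => ?_
      rw [dif_pos i.isLt]
    · intro i _ hi
      rw [dif_neg (by simpa using hi), mul_zero]
  rw [h1, sum_range_mul, thirdSum, thirdSum, thirdSum, Finset.sum_mul, Finset.sum_mul,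
    ← Finset.sum_add_distrib, ← Finset.sum_add_distrib]
  refine Finset.sum_congr rfl fun k _ => ?_
  rw [Finset.sum_range_succ, Finset.sum_range_succ, Finset.sum_range_one]
  simp only [mul_add, pow_add]
  ring_nf

theorem compN_thirdSum (hu : CostUnit u t m r) (hs : 1 ≤ s) {w : ℕ} (hw : w ≤ m)
    (hM : 3 * s * (M / 3 + 1) ≤ m) (c : ℕ) :
    CompN u t w (fun κ : Fin (M + 1) × Fin (3 * s) → Bool => thirdSum κ c) 9 := by
  have hmod : ∀ p, p % (3 * s) < 3 * s := fun p => Nat.mod_lt _ (by omega)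
  have h1 := hu.wires (V := Fin (M + 1) × Fin (3 * s)) hM
    (fun p : Fin (3 * s * (M / 3 + 1)) => if h : 3 * ((p : ℕ) / (3 * s)) + c < M + 1 then
      Sum.inr (⟨3 * ((p : ℕ) / (3 * s)) + c, h⟩, (⟨(p : ℕ) % (3 * s), hmod p⟩ : Fin (3 * s)).rev)
      else Sum.inl false) (by
    intro p p' v h h'
    split_ifs at h h'
    have := (Sum.inr_injective h).trans (Sum.inr_injective h').symm
    simp only [Prod.mk.injEq, Fin.mk.injEq, Fin.rev_inj] at this
    ext
    rw [← Nat.div_add_mod (p : ℕ) (3 * s), ← Nat.div_add_mod (p' : ℕ) (3 * s), this.2]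
    congr 2
    omega)
  have h2 : ∀ κ : Fin (M + 1) × Fin (3 * s) → Bool,
      (Nat.ofBits fun p : Fin (3 * s * (M / 3 + 1)) => lit κ
        (if h : 3 * ((p : ℕ) / (3 * s)) + c < M + 1 then
      Sum.inr (⟨3 * ((p : ℕ) / (3 * s)) + c, h⟩, (⟨(p : ℕ) % (3 * s), hmod p⟩ : Fin (3 * s)).rev)
      else Sum.inl false)) = thirdSum κ c := by
    intro κ
    rw [ofBits_eq_sum_range (3 * s * (M / 3 + 1)) (fun p => lit κ
        (if h : 3 * (p / (3 * s)) + c < M + 1 then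
      Sum.inr (⟨3 * (p / (3 * s)) + c, h⟩, (⟨p % (3 * s), hmod p⟩ : Fin (3 * s)).rev)
      else Sum.inl false)), sum_range_mul, thirdSum]
    refine Finset.sum_congr rfl fun k _ => ?_
    rw [← Fin.sum_univ_eq_sum_range (fun a => (lit κ
        (if h : 3 * ((3 * s * k + a) / (3 * s)) + c < M + 1 then
      Sum.inr (⟨3 * ((3 * s * k + a) / (3 * s)) + c, h⟩,
        (⟨(3 * s * k + a) % (3 * s), hmod _⟩ : Fin (3 * s)).rev)
      else Sum.inl false)).toNat * 2 ^ (3 * s * k + a))]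
    have h3 : ∀ a : Fin (3 * s), (3 * s * k + a) / (3 * s) = k := by
      intro a
      rw [Nat.mul_add_div (by omega), Nat.div_eq_of_lt a.isLt, add_zero]
    have h4 : ∀ a : Fin (3 * s), (3 * s * k + a) % (3 * s) = a := by
      intro a
      rw [Nat.mul_add_mod, Nat.mod_eq_of_lt a.isLt]
    simp only [h3, h4]
    split_ifs with h5
    · rw [revVal_eq_ofBits, ofBits_eq_sum, Finset.mul_sum]
      refine Finset.sum_congr rfl fun a _ => ?_
      simp only [lit, Sum.elim_inr, pow_add]
      ring
    · simp [lit]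
  refine ((h1.congr fun κ => by rw [h2]).resize hu hw fun κ => ?_)
  rw [← h2]
  exact Nat.ofBits_lt_two_pow _

/-- Consecutive blocks overlap, since the stride `s` is smaller than the length `3 s`; three sums of
blocks that do not overlap are added. -/
theorem compN_blockSum (hu : CostUnit u t m r) (hs : 1 ≤ s) {w : ℕ} (hw : w ≤ m)
    (hM : 3 * s * (M / 3 + 1) ≤ m) :
    CompN u t w (fun κ : Fin (M + 1) × Fin (3 * s) → Bool => blockSum κ) 2900 := by
  have h0 := compN_thirdSum hu hs hw hM 0
  have h1 := (compN_thirdSum hu hs hw hM 1).shiftLeft hu hw s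
  have h2 := (compN_thirdSum hu hs hw hM 2).shiftLeft hu hw (2 * s)
  refine (((h0.add hu hw h1).add hu hw h2).mono (by norm_num)).congr fun κ => ?_
  rw [blockSum_eq]

theorem CompN.comap {V V' : Type} [Fintype V] [DecidableEq V] [Fintype V'] [DecidableEq V']
    {w k : ℕ} {F : (V → Bool) → ℕ} (hF : CompN u t w F k) (i : V ↪ V') :
    CompN u t w (fun x => F fun v => x (i v)) k :=
  Comp.comap hF i

end BlockArithmetic

/-! ### Division with the approximate reciprocal -/

/-- `a / 2 ^ e` approximates `1 / N` to within `1 / 2 ^ e`, where `a` and `N` have `n` digits; the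
exponent `e` is then about `2 n`. -/
structure RecipApprox (N a n e : ℕ) : Prop where
  five_le : 5 ≤ n
  le_N : 2 ^ (n - 1) ≤ N
  N_lt : N < 2 ^ n
  a_pos : 1 ≤ a
  a_lt : a < 2 ^ n
  mul_le : N * a ≤ 2 ^ e + N
  le_mul : 2 ^ e ≤ N * a + N
  le_e : 2 * n ≤ e + 2
  e_lt : e < 2 * n

/-- The bounds for `e` follow since both `N` and `a` have `n` digits. -/
theorem RecipApprox.of_isBitApprox {N a n e : ℕ} (hn : 5 ≤ n) (hN : n = N.size)
    (h : IsBitApprox n a e (1 / (N : ℝ))) : RecipApprox N a n e := by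
  obtain ⟨h1, h2⟩ := h
  have hN1 : 2 ^ (n - 1) ≤ N := Nat.lt_size.1 (by omega)
  have hN2 : N < 2 ^ n := Nat.size_le.1 hN.symm.le
  have ha1 : 2 ^ (n - 1) ≤ a := Nat.lt_size.1 (by omega)
  have ha2 : a < 2 ^ n := Nat.size_le.1 h1.le
  have hN0 : 1 ≤ N := Nat.one_le_two_pow.trans hN1
  have hNr : (0 : ℝ) < N := by exact_mod_cast hN0
  have h3 : |(2 : ℝ) ^ e - N * a| ≤ N := by
    have h4 : (2 : ℝ) ^ e - N * a = N * 2 ^ e * (1 / N - a / 2 ^ e) := by field_simp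
    rw [h4, abs_mul, abs_of_pos (by positivity)]
    calc (N : ℝ) * 2 ^ e * |1 / (N : ℝ) - a / 2 ^ e| ≤ N * 2 ^ e * (1 / 2 ^ e) := by gcongr
      _ = N := by field_simp
  rw [abs_le] at h3
  have h5 : N * a ≤ 2 ^ e + N := by
    have : (N : ℝ) * a ≤ 2 ^ e + N := by linarith
    exact_mod_cast this
  have h6 : 2 ^ e ≤ N * a + N := by
    have : (2 : ℝ) ^ e ≤ N * a + N := by linarith
    exact_mod_cast this
  refine ⟨hn, hN1, hN2, Nat.one_le_two_pow.trans ha1, ha2, h5, h6, ?_, ?_⟩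
  · by_contra hc
    have h7 : 2 ^ e ≤ 2 ^ (2 * n - 3) := Nat.pow_le_pow_right (by norm_num) (by omega)
    have h8 : 2 ^ n ≤ 2 ^ (2 * n - 3) := Nat.pow_le_pow_right (by norm_num) (by omega)
    have h9 : 2 ^ (n - 1) * 2 ^ (n - 1) ≤ N * a := Nat.mul_le_mul hN1 ha1
    rw [← pow_add, show n - 1 + (n - 1) = 2 * n - 3 + 1 by omega, pow_succ] at h9
    omega
  · by_contra hc
    have h7 : 2 ^ (2 * n) ≤ 2 ^ e := Nat.pow_le_pow_right (by norm_num) (by omega)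
    have h9 : N * (a + 1) ≤ (2 ^ n - 1) * 2 ^ n := Nat.mul_le_mul (by omega) (by omega)
    rw [Nat.sub_mul, ← pow_add, one_mul, ← two_mul] at h9
    have h10 : 0 < 2 ^ n := by positivity
    have h11 : 2 ^ n ≤ 2 ^ (2 * n) := Nat.pow_le_pow_right (by norm_num) (by omega)
    rw [mul_add, mul_one] at h9
    omega

namespace RecipApprox

variable {N a n e : ℕ} (h : RecipApprox N a n e)
include h

theorem N_pos : 1 ≤ N := Nat.one_le_two_pow.trans h.le_N

/-- Multiplication by `(a - 1) / 2 ^ e`, with truncation, underestimates division by `N`; the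
quotient is scaled by `2 ^ b`. -/
theorem mul_quotient_le {b : ℕ} (hb : b ≤ e) (x : ℕ) :
    N * ((a * x - x) / 2 ^ (e - b)) ≤ x * 2 ^ b := by
  have h1 : 2 ^ e = 2 ^ (e - b) * 2 ^ b := by rw [← pow_add]; congr 1; omega
  have h2 := Nat.div_mul_le_self (a * x - x) (2 ^ (e - b))
  have h3 := h.mul_le
  obtain ⟨a', rfl⟩ := Nat.exists_eq_add_of_le' h.a_pos
  have h4 : N * a' ≤ 2 ^ e := by linarith
  have h5 : (a' + 1) * x - x = a' * x := by rw [add_mul, one_mul, Nat.add_sub_cancel]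
  rw [h5] at h2 ⊢
  refine Nat.le_of_mul_le_mul_right ?_ (show 0 < 2 ^ (e - b) by positivity)
  calc N * (a' * x / 2 ^ (e - b)) * 2 ^ (e - b) = N * (a' * x / 2 ^ (e - b) * 2 ^ (e - b)) := by ring
    _ ≤ N * (a' * x) := Nat.mul_le_mul_left _ h2
    _ = N * a' * x := by ring
    _ ≤ 2 ^ e * x := Nat.mul_le_mul_right _ h4
    _ = x * 2 ^ b * 2 ^ (e - b) := by rw [h1]; ring

/-- The truncated quotient is at most one unit, and what the error of the reciprocal contributes,
below the true one. -/
theorem lt_mul_quotient {b : ℕ} (hb : b ≤ e) (x : ℕ) (hx : x < 2 ^ n) :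
    2 ^ n * (x * 2 ^ b) < 2 ^ n * (N * ((a * x - x) / 2 ^ (e - b))) + N * 2 ^ n + 8 * N * 2 ^ b := by
  have h1 : 2 ^ e = 2 ^ (e - b) * 2 ^ b := by rw [← pow_add]; congr 1; omega
  have h3 := h.le_mul
  obtain ⟨a', rfl⟩ := Nat.exists_eq_add_of_le' h.a_pos
  have h4 : 2 ^ e ≤ N * a' + 2 * N := by linarith
  have h5 : (a' + 1) * x - x = a' * x := by rw [add_mul, one_mul, Nat.add_sub_cancel]
  rw [h5]
  have h6 := Nat.lt_div_mul_add (a := a' * x) (show 0 < 2 ^ (e - b) by positivity)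
  generalize a' * x / 2 ^ (e - b) = q at h6
  have hN := h.N_pos
  have h7 : 2 ^ n * 2 ^ n ≤ 4 * 2 ^ e := by
    rw [← pow_add, show (4 : ℕ) = 2 ^ 2 by norm_num, ← pow_add]
    exact Nat.pow_le_pow_right (by norm_num) (by have := h.le_e; omega)
  refine Nat.lt_of_mul_lt_mul_right (a := 2 ^ (e - b)) ?_
  calc 2 ^ n * (x * 2 ^ b) * 2 ^ (e - b) = 2 ^ n * x * 2 ^ e := by rw [h1]; ring
    _ ≤ 2 ^ n * x * (N * a' + 2 * N) := Nat.mul_le_mul_left _ h4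
    _ = 2 ^ n * N * (a' * x) + 2 * N * 2 ^ n * x := by ring
    _ ≤ 2 ^ n * N * (a' * x) + 2 * N * 2 ^ n * 2 ^ n :=
        Nat.add_le_add_left (Nat.mul_le_mul_left _ hx.le) _
    _ < 2 ^ n * N * (q * 2 ^ (e - b) + 2 ^ (e - b)) + 2 * N * 2 ^ n * 2 ^ n := by
        refine Nat.add_lt_add_right (Nat.mul_lt_mul_of_pos_left h6 ?_) _
        positivity
    _ = 2 ^ n * N * (q * 2 ^ (e - b) + 2 ^ (e - b)) + 2 * N * (2 ^ n * 2 ^ n) := by ring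
    _ ≤ 2 ^ n * N * (q * 2 ^ (e - b) + 2 ^ (e - b)) + 2 * N * (4 * 2 ^ e) :=
        Nat.add_le_add_left (Nat.mul_le_mul_left _ h7) _
    _ = (2 ^ n * (N * q) + N * 2 ^ n + 8 * N * 2 ^ b) * 2 ^ (e - b) := by rw [h1]; ring

end RecipApprox

/-- The quotient estimate for `k` from its leading digits `k / 2 ^ g`. -/
def trialQuotient (a e g k : ℕ) : ℕ := (a * (k / 2 ^ g) - k / 2 ^ g) / 2 ^ (e - g)

/-- The trial quotient is the quotient or one less; this is the difference. -/
def quotientCarry (N a n e g k : ℕ) : ℕ :=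
  (2 ^ (n + 1) + (k - N * trialQuotient a e g k) - N) / 2 ^ (n + 1)

section DivMod

variable {N a n e g k : ℕ}

theorem mul_trialQuotient_le (h : RecipApprox N a n e) (hg : g ≤ e) :
    N * trialQuotient a e g k ≤ k :=
  (h.mul_quotient_le hg _).trans (Nat.div_mul_le_self _ _)

theorem trialQuotient_lt (h : RecipApprox N a n e) (hg : g + 4 ≤ n) (hk : k < 2 ^ (n + g)) :
    trialQuotient a e g k < 2 ^ n := by
  have h1 := mul_trialQuotient_le (k := k) h (show g ≤ e by have := h.le_e; have := h.five_le; omega)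
  have h2 : 2 ^ (n + g) ≤ 2 ^ (n - 1) * 2 ^ n := by
    rw [← pow_add]; exact Nat.pow_le_pow_right (by norm_num) (by omega)
  by_contra hc
  have h3 := Nat.mul_le_mul h.le_N (not_lt.1 hc)
  omega

theorem sub_trialQuotient_lt (h : RecipApprox N a n e) (hg : g + 4 ≤ n) (hk : k < 2 ^ (n + g)) :
    k - N * trialQuotient a e g k < 2 * N := by
  have hge : g ≤ e := by have := h.le_e; have := h.five_le; omega
  have h1 : k / 2 ^ g < 2 ^ n := Nat.div_lt_of_lt_mul (by rw [← pow_add, add_comm]; exact hk)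
  have h2 := h.lt_mul_quotient hge _ h1
  have h3 := Nat.lt_div_mul_add (a := k) (show 0 < 2 ^ g by positivity)
  rw [← trialQuotient] at h2
  have h4 : 16 * 2 ^ g ≤ 2 ^ n := by
    rw [show (16 : ℕ) = 2 ^ 4 by norm_num, ← pow_add]
    exact Nat.pow_le_pow_right (by norm_num) (by omega)
  have h5 : 2 ^ n ≤ 2 * N := by
    have := h.le_N
    rw [show n = n - 1 + 1 by have := h.five_le; omega, pow_succ]; omega
  have h6 : k < N * trialQuotient a e g k + 2 * N := by
    refine Nat.lt_of_mul_lt_mul_left (a := 2 ^ n) ?_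
    have h7 : 2 ^ n * k ≤ 2 ^ n * (k / 2 ^ g * 2 ^ g) + 2 ^ n * 2 ^ g := by
      rw [← mul_add]; exact Nat.mul_le_mul_left _ h3.le
    have h8 : 2 ^ n * 2 ^ g ≤ 2 * N * 2 ^ g := Nat.mul_le_mul_right _ h5
    have h9 : N * (16 * 2 ^ g) ≤ N * 2 ^ n := Nat.mul_le_mul_left _ h4
    nlinarith
  have h7 := h.N_pos
  omega

theorem quotientCarry_add (h : RecipApprox N a n e) (hg : g + 4 ≤ n) (hk : k < 2 ^ (n + g)) :
    trialQuotient a e g k + quotientCarry N a n e g k = k / N := by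
  have h1 := mul_trialQuotient_le (k := k) h (show g ≤ e by have := h.le_e; have := h.five_le; omega)
  have h2 := sub_trialQuotient_lt h hg hk
  have hN := h.N_pos
  have hN2 := h.N_lt
  have h3 : k / N = trialQuotient a e g k + (k - N * trialQuotient a e g k) / N := by
    conv_lhs => rw [← Nat.add_sub_cancel' h1]
    rw [Nat.mul_add_div hN]
  rw [h3, quotientCarry]
  congr 1
  generalize k - N * trialQuotient a e g k = y at h2
  have h4 : 2 ^ (n + 1) = 2 * 2 ^ n := by ring
  by_cases hy : y < N
  · rw [Nat.div_eq_of_lt hy, Nat.div_eq_of_lt (by omega)]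
  · rw [Nat.div_eq_of_lt_le (k := 1) (by omega) (by omega),
      Nat.div_eq_of_lt_le (k := 1) (by omega) (by omega)]

end DivMod

section Circuits

variable {V : Type} [Fintype V] [DecidableEq V] {u t m r : ℕ} {N a n e g s₁ d₁ s₂ d₂ : ℕ}
  {F : (V → Bool) → ℕ} {M : ℕ}

/-- Division with remainder by `N`, with the help of multiplication by `N` and by the mantissa `a`
of the reciprocal. -/
theorem comp_divMod (hu : CostUnit u t m r) (h : RecipApprox N a n e) (hm : 4 * n ≤ m)
    (h₁ : HasMulCircuit n N s₁ d₁) (h₂ : HasMulCircuit n a s₂ d₂) (hs₁ : s₁ ≤ u) (hd₁ : d₁ ≤ t)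
    (hs₂ : s₂ ≤ u) (hd₂ : d₂ ≤ t) (hg : g + 4 ≤ n)
    (hF : ∀ w, w ≤ m → CompN u t w F 10000) (hFlt : ∀ x, F x < 2 ^ (n + g)) {q : ℕ} (hq : q ≤ n) :
    Comp (fun x => Sum.elim (bits n (F x % N)) (bits q (F x / N))) (10 ^ 15 * u) (10 ^ 15 * t) := by
  have hn := h.five_le
  have he1 := h.le_e
  have he2 := h.e_lt
  have hge : g ≤ e := by omega
  have hsN : N.size ≤ n := Nat.size_le.2 h.N_lt
  have hsa : a.size ≤ n := Nat.size_le.2 h.a_lt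
  have h1 : ∀ w, w ≤ m → CompN u t w (fun x => F x / 2 ^ g) _ := fun w hw =>
    ((hF (n + g) (by omega)).shiftRight hu (by omega) g).resize hu hw fun x =>
      Nat.div_lt_of_lt_mul (by rw [← pow_add, add_comm]; exact hFlt x)
  have h1lt : ∀ x, F x / 2 ^ g < 2 ^ n := fun x =>
    Nat.div_lt_of_lt_mul (by rw [← pow_add, add_comm]; exact hFlt x)
  have h2 : CompN u t n (fun x => trialQuotient a e g (F x)) _ :=
    (((h1 n (by omega)).mul hu (by omega : n + (e - g) ≤ m) h₂ (by omega) hs₂ hd₂ h1lt).sub hu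
      (by omega)
      (h1 _ (by omega)) fun x => Nat.le_mul_of_pos_left _ h.a_pos).shiftRight hu (by omega) (e - g)
  have h3 : ∀ w, w ≤ m → CompN u t w (fun x => F x - N * trialQuotient a e g (F x)) _ := fun w hw =>
    (hF w hw).sub hu hw (h2.mul hu hw h₁ (by omega) hs₁ hd₁ fun x => trialQuotient_lt h hg (hFlt x))
      fun x => mul_trialQuotient_le h hge
  have h4 : CompN u t n (fun x => quotientCarry N a n e g (F x)) _ :=
    (((hu.const (by omega : n + (n + 1) ≤ m) (2 ^ (n + 1))).add hu (by omega) (h3 _ (by omega))).sub hu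
      (by omega) (hu.const (by omega) N) fun x => by
        have := h.N_lt
        rw [pow_succ]; omega).shiftRight hu (by omega) (n + 1)
  have h5 : CompN u t n (fun x => F x / N) _ :=
    (h2.add hu (by omega) h4).congr fun x => by rw [quotientCarry_add h hg (hFlt x)]
  have h5lt : ∀ x, F x / N < 2 ^ n := by
    intro x
    refine Nat.div_lt_of_lt_mul ((hFlt x).trans_le ?_)
    refine le_trans ?_ (Nat.mul_le_mul_right _ h.le_N)
    rw [← pow_add]; exact Nat.pow_le_pow_right (by norm_num) (by omega)
  have h6 : CompN u t n (fun x => F x % N) _ :=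
    ((hF n (by omega)).sub hu (by omega) (h5.mul hu (by omega) h₁ (by omega) hs₁ hd₁ h5lt)
      fun x => Nat.mul_div_le _ _).congr fun x => by
        rw [← Nat.mod_eq_sub_mul_div]
  have h7 := h5.resize hu (by omega : q ≤ m) h5lt
  refine (Comp.sumElim h6 h7).mono ?_ ?_
  · rw [← add_mul]; exact Nat.mul_le_mul_right _ (by norm_num)
  · rw [← add_mul]; exact Nat.mul_le_mul_right _ (by norm_num)

/-- The decoder of the algorithm. The argument of the multiplication has more than `n` digits, and is
split in two. -/
theorem compN_decode (hu : CostUnit u t m r) {s : ℕ} (hs : 1 ≤ s) (hN : N < 2 ^ n)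
    (h₁ : HasMulCircuit n N s₁ d₁) (hs₁ : s₁ ≤ u) (hd₁ : d₁ ≤ t)
    (hm : 4 * n ≤ m) (hM : n ≤ s * M + 3 * s) (hM' : s * M + 3 * s ≤ 2 * n) :
    CompN u t n (fun κ : Fin (M + 1) × Fin (3 * s) → Bool => decode N κ) (10 ^ 15) := by
  have hsN : N.size ≤ n := Nat.size_le.2 hN
  have hΛ : 3 * s + s * M = s * M + 3 * s := Nat.add_comm _ _
  have hlead := compN_leadingDigits hu hs (show 3 * s + s * M ≤ m by omega)
  have hborr := compN_borrows hu hs (show 3 * s + s * M ≤ m by omega)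
  rw [hΛ] at hlead hborr
  have h1 : CompN u t (s * M + 3 * s) (fun κ : Fin (M + 1) × Fin (3 * s) → Bool =>
      reconstruct s M (blockVal κ)) _ :=
    ((hlead.congr (G := fun κ => 2 ^ (s * M + 3 * s) + leadingDigits s M (blockVal κ))
      (by simp)).sub hu (by omega) hborr fun κ =>
        (borrows_le s M hs _).trans (Nat.le_add_right _ _)).congr fun κ => by
      rw [reconstruct, Nat.mod_mod]
  obtain ⟨c, hc⟩ := Nat.exists_eq_add_of_le hM
  have hlt : ∀ κ : Fin (M + 1) × Fin (3 * s) → Bool,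
      reconstruct s M (blockVal κ) < 2 ^ (n + c) := fun κ => by
    rw [← hc]; exact Nat.mod_lt _ (by positivity)
  rw [hc] at h1
  have h2 : CompN u t n (fun κ : Fin (M + 1) × Fin (3 * s) → Bool =>
      reconstruct s M (blockVal κ) / 2 ^ c) _ := h1.shiftRight hu (by omega) c
  have h2lt : ∀ κ : Fin (M + 1) × Fin (3 * s) → Bool,
      reconstruct s M (blockVal κ) / 2 ^ c < 2 ^ n := fun κ =>
    Nat.div_lt_of_lt_mul (by rw [← pow_add, add_comm]; exact hlt κ)
  have h3 : CompN u t n (fun κ : Fin (M + 1) × Fin (3 * s) → Bool =>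
      reconstruct s M (blockVal κ) % 2 ^ c) _ :=
    (h1.resize hu (by omega : c ≤ m) hlt).mod hu (by omega)
  have h3lt : ∀ κ : Fin (M + 1) × Fin (3 * s) → Bool,
      reconstruct s M (blockVal κ) % 2 ^ c < 2 ^ n := fun κ =>
    (Nat.mod_lt _ (by positivity)).trans_le (Nat.pow_le_pow_right (by norm_num) (by omega))
  have hw : n + (n + c) ≤ m := by omega
  refine ((((((h2.mul hu hw h₁ (by omega) hs₁ hd₁ h2lt).shiftLeft hu hw c).add hu hw
    (h3.mul hu hw h₁ (by omega) hs₁ hd₁ h3lt)).shiftRight hu (by omega) (n + c))).mono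
      (by norm_num)).congr fun κ => ?_
  rw [decode, hc]
  congr 2
  rw [mul_assoc, ← mul_add, Nat.div_add_mod']

/-- The second arithmetic step: division with remainder of `blockSum κ + r` by `N`. -/
theorem comp_divMod_blockSum (hu : CostUnit u t m r) {s : ℕ} (hs : 1 ≤ s) (h : RecipApprox N a n e)
    (h₁ : HasMulCircuit n N s₁ d₁) (h₂ : HasMulCircuit n a s₂ d₂) (hs₁ : s₁ ≤ u) (hd₁ : d₁ ≤ t)
    (hs₂ : s₂ ≤ u) (hd₂ : d₂ ≤ t) (hm : 4 * n ≤ m) (hsn : 3 * s + 6 ≤ n) (hM : s * M ≤ n) :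
    Comp (fun z : (Fin (M + 1) × Fin (3 * s)) ⊕ Fin (n + s) → Bool => Sum.elim
      (bits n ((blockSum (fun k => z (Sum.inl k)) + Nat.ofBits fun r => z (Sum.inr r)) % N))
      (bits (3 * s + 3) ((blockSum (fun k => z (Sum.inl k)) + Nat.ofBits fun r => z (Sum.inr r)) / N)))
      (10 ^ 15 * u) (10 ^ 15 * t) := by
  have h3 : 3 * s * (M / 3 + 1) ≤ m := by
    have : s * (3 * (M / 3)) ≤ s * M := Nat.mul_le_mul_left _ (Nat.mul_div_le _ _)
    calc 3 * s * (M / 3 + 1) = s * (3 * (M / 3)) + 3 * s := by ring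
      _ ≤ m := by omega
  refine comp_divMod hu h hm h₁ h₂ hs₁ hd₁ hs₂ hd₂ (g := 3 * s + 2) (by omega)
    (F := fun z => blockSum (fun k => z (Sum.inl k)) + Nat.ofBits fun r => z (Sum.inr r))
    (fun w hw => ?_) (fun z => ?_) (by omega)
  · exact (((compN_blockSum hu hs hw h3).comap ⟨Sum.inl, Sum.inl_injective⟩).add hu hw
      (hu.register hw ⟨Sum.inr, Sum.inr_injective⟩)).mono (by norm_num)
  · have h4 := blockSum_lt hs fun k => z (Sum.inl k)
    have h5 : Nat.ofBits (fun r => z (Sum.inr r)) < 2 ^ (n + s) := Nat.ofBits_lt_two_pow _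
    have h6 : 2 ^ (s * M + 3 * s + 1) ≤ 2 ^ (n + 3 * s + 1) :=
      Nat.pow_le_pow_right (by norm_num) (by omega)
    have h7 : 2 ^ (n + s) ≤ 2 ^ (n + 3 * s + 1) := Nat.pow_le_pow_right (by norm_num) (by omega)
    rw [show n + (3 * s + 2) = n + 3 * s + 1 + 1 by ring, pow_succ]
    omega

/-- The last arithmetic step. The summand `2 ^ (n + 3 s + 2)` keeps the difference from being truncated,
without changing the last `n + s` digits. -/
theorem comp_recombine (hu : CostUnit u t m r) {s : ℕ} (hs : 1 ≤ s) (hN : N < 2 ^ n)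
    (h₁ : HasMulCircuit n N s₁ d₁) (hs₁ : s₁ ≤ u) (hd₁ : d₁ ≤ t)
    (hm : 4 * n ≤ m) (hsn : 3 * s + 6 ≤ n) (hM : s * M ≤ n) :
    CompN u t (n + s) (fun z : Fin n ⊕ ((Fin (M + 1) × Fin (3 * s)) ⊕ Fin (3 * s + 3)) → Bool =>
      2 ^ (n + 3 * s + 2) + (Nat.ofBits (fun i => z (Sum.inl i)) +
        N * Nat.ofBits (fun i => z (Sum.inr (Sum.inr i)))) - blockSum fun k => z (Sum.inr (Sum.inl k)))
      (10 ^ 15) := by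
  have h3 : 3 * s * (M / 3 + 1) ≤ m := by
    have : s * (3 * (M / 3)) ≤ s * M := Nat.mul_le_mul_left _ (Nat.mul_div_le _ _)
    calc 3 * s * (M / 3 + 1) = s * (3 * (M / 3)) + 3 * s := by ring
      _ ≤ m := by omega
  have hsN : N.size ≤ n := Nat.size_le.2 hN
  have hw : n + s ≤ m := by omega
  have h4 := hu.register (w := n) (by omega)
    (V := Fin n ⊕ ((Fin (M + 1) × Fin (3 * s)) ⊕ Fin (3 * s + 3)))
    (⟨fun k => Sum.inr (Sum.inr k), Sum.inr_injective.comp Sum.inr_injective⟩ : Fin (3 * s + 3) ↪ _)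
  have h5 := hu.register hw (V := Fin n ⊕ ((Fin (M + 1) × Fin (3 * s)) ⊕ Fin (3 * s + 3)))
    (⟨Sum.inl, Sum.inl_injective⟩ : Fin n ↪ _)
  have h6 := (compN_blockSum (M := M) hu hs hw h3).comap
    (V' := Fin n ⊕ ((Fin (M + 1) × Fin (3 * s)) ⊕ Fin (3 * s + 3)))
    ⟨fun k => Sum.inr (Sum.inl k), Sum.inr_injective.comp Sum.inl_injective⟩
  have h7 := h5.add hu hw (h4.mul hu hw h₁ (by omega) hs₁ hd₁ fun z =>
    (Nat.ofBits_lt_two_pow _).trans_le (Nat.pow_le_pow_right (by norm_num) (by omega)))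
  refine (((hu.const hw (2 ^ (n + 3 * s + 2))).add hu hw h7).sub hu hw h6 fun z => ?_).mono
    (by norm_num)
  refine ((blockSum_lt hs _).le.trans ?_).trans (Nat.le_add_right _ _)
  exact Nat.pow_le_pow_right (by norm_num) (by omega)

/-- The leading digits of an approximation to `x / N`, for `x < N`. -/
def quotientHigh (a n e x : ℕ) : ℕ := (a * x - x) / 2 ^ (e - n) % 2 ^ n

/-- The remainder after the leading digits, up to its last four digits. -/
def quotientRest (N a n e x : ℕ) : ℕ := (x * 2 ^ n - N * quotientHigh a n e x) / 2 ^ 4 % 2 ^ n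

theorem mul_quotientHigh_le (h : RecipApprox N a n e) (x : ℕ) :
    N * quotientHigh a n e x ≤ x * 2 ^ n :=
  (Nat.mul_le_mul_left _ (Nat.mod_le _ _)).trans
    (h.mul_quotient_le (by have := h.le_e; have := h.five_le; omega) x)

theorem quotientHigh_eq (h : RecipApprox N a n e) {x : ℕ} (hx : x < N) :
    quotientHigh a n e x = (a * x - x) / 2 ^ (e - n) := by
  refine Nat.mod_eq_of_lt ?_
  have h1 := h.mul_quotient_le (b := n) (by have := h.le_e; have := h.five_le; omega) x
  refine Nat.lt_of_mul_lt_mul_left (a := N) (h1.trans_lt ?_)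
  exact Nat.mul_lt_mul_of_pos_right hx (by positivity)

/-- Two rounds of multiplication by the reciprocal give `x / N` with twice as many digits. -/
theorem abs_quotient_sub_le (h : RecipApprox N a n e) {x : ℕ} (hx : x < N) :
    |(quotientHigh a n e x : ℝ) / 2 ^ n + (a * quotientRest N a n e x : ℕ) / 2 ^ (e + n - 4) - x / N|
      ≤ 2 ^ 7 / 2 ^ (2 * n) := by
  have hn := h.five_le
  have he := h.le_e
  have h1 := mul_quotientHigh_le h x
  have h2 := h.lt_mul_quotient (b := n) (by omega) x (hx.trans h.N_lt)
  rw [← quotientHigh_eq h hx] at h2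
  rw [quotientRest]
  generalize quotientHigh a n e x = q at h1 h2 ⊢
  obtain ⟨z, hz⟩ := Nat.exists_eq_add_of_le h1
  have hpos : 0 < 2 ^ n := by positivity
  have h3 : z < 9 * N := by
    refine Nat.lt_of_mul_lt_mul_left (a := 2 ^ n) ?_
    rw [hz] at h2
    nlinarith
  rw [hz, Nat.add_sub_cancel_left]
  have hN2 := h.N_lt
  rw [Nat.mod_eq_of_lt (by omega : z / 2 ^ 4 < 2 ^ n)]
  obtain ⟨ρ, y, hρ, hzy⟩ : ∃ ρ y, ρ < 16 ∧ z = 16 * y + ρ := ⟨z % 16, z / 16, by omega, by omega⟩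
  have h4 : z / 2 ^ 4 = y := by omega
  rw [h4]
  have hNpos : (0 : ℝ) < N := by exact_mod_cast h.N_pos
  have hP : (0 : ℝ) < 2 ^ n := by positivity
  have hE : (0 : ℝ) < 2 ^ e := by positivity
  have h5 : (2 : ℝ) ^ (e + n - 4) = 2 ^ e * 2 ^ n / 16 := by
    rw [eq_div_iff (by norm_num), show (16 : ℝ) = 2 ^ 4 by norm_num, ← pow_add, ← pow_add]
    congr 1; omega
  have h6 : (x : ℝ) * 2 ^ n = N * q + (16 * y + ρ) := by rw [hzy] at hz; exact_mod_cast hz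
  have h7 : (x : ℝ) / N = q / 2 ^ n + (16 * y + ρ) / (N * 2 ^ n) := by
    field_simp; linarith
  have h8 : (q : ℝ) / 2 ^ n + (a * y : ℕ) / 2 ^ (e + n - 4) - x / N =
      (16 * y * (N * a - 2 ^ e) - ρ * 2 ^ e) / (N * 2 ^ e * 2 ^ n) := by
    rw [h7, h5]; push_cast; field_simp; ring
  have h9 : |(N : ℝ) * a - 2 ^ e| ≤ N := by
    have g1 : (N : ℝ) * a ≤ 2 ^ e + N := by exact_mod_cast h.mul_le
    have g2 : (2 : ℝ) ^ e ≤ N * a + N := by exact_mod_cast h.le_mul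
    rw [abs_le]; constructor <;> linarith
  have h10 : (2 : ℝ) ^ n * 2 ^ n ≤ 4 * 2 ^ e := by
    rw [← pow_add, show (4 : ℝ) = 2 ^ 2 by norm_num, ← pow_add]
    exact pow_le_pow_right₀ (by norm_num) (by omega)
  have h11 : (2 : ℝ) ^ n ≤ 2 * N := by
    have : 2 ^ n ≤ 2 * N := by
      have := h.le_N
      rw [show n = n - 1 + 1 by omega, pow_succ]; omega
    exact_mod_cast this
  have h12 : (16 : ℝ) * y ≤ 9 * N := by exact_mod_cast (by omega : 16 * y ≤ 9 * N)
  have h13 : (N : ℝ) ≤ 2 ^ n := by exact_mod_cast hN2.le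
  have h14 : (ρ : ℝ) ≤ 16 := by exact_mod_cast hρ.le
  rw [h8, abs_div, abs_of_pos (show (0 : ℝ) < N * 2 ^ e * 2 ^ n by positivity),
    div_le_div_iff₀ (by positivity) (by positivity), two_mul, pow_add]
  have h15 : |16 * (y : ℝ) * (N * a - 2 ^ e) - ρ * 2 ^ e| ≤ 9 * N * N + 16 * 2 ^ e := by
    refine (abs_sub _ _).trans ?_
    rw [abs_mul, abs_of_nonneg (show (0 : ℝ) ≤ 16 * y by positivity),
      abs_of_nonneg (show (0 : ℝ) ≤ ρ * 2 ^ e by positivity)]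
    gcongr
  calc |16 * (y : ℝ) * (N * a - 2 ^ e) - ρ * 2 ^ e| * (2 ^ n * 2 ^ n)
      ≤ (9 * N * N + 16 * 2 ^ e) * (2 ^ n * 2 ^ n) := by gcongr
    _ = 9 * N * N * (2 ^ n * 2 ^ n) + 16 * 2 ^ e * 2 ^ n * 2 ^ n := by ring
    _ ≤ 9 * N * 2 ^ n * (4 * 2 ^ e) + 16 * 2 ^ e * 2 ^ n * (2 * N) := by gcongr
    _ ≤ 2 ^ 7 * (N * 2 ^ e * 2 ^ n) := by
      have : (0 : ℝ) < N * 2 ^ e * 2 ^ n := by positivity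
      linarith

/-- The bits of `x`, with the weights of a fraction with denominator `2 ^ c`. -/
theorem sum_toNat_div_two_pow (w c x : ℕ) (hw : w ≤ c + 1) :
    ∑ i : Fin w, ((bits w x i).toNat : ℝ) / 2 ^ (c - i) = (x % 2 ^ w : ℕ) / 2 ^ c := by
  rw [← ofBits_bits, ofBits_eq_sum, Nat.cast_sum, Finset.sum_div]
  refine Finset.sum_congr rfl fun i _ => ?_
  rw [show (2 : ℝ) ^ c = 2 ^ (c - i) * 2 ^ (i : ℕ) by rw [← pow_add]; congr 1; omega]
  push_cast
  field_simp

/-- The first arithmetic step: binary digits of an approximation to `x / N`. -/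
theorem comp_quotientDigits (hu : CostUnit u t m r) (h : RecipApprox N a n e) (hm : 4 * n ≤ m)
    (h₁ : HasMulCircuit n N s₁ d₁) (h₂ : HasMulCircuit n a s₂ d₂) (hs₁ : s₁ ≤ u) (hd₁ : d₁ ≤ t)
    (hs₂ : s₂ ≤ u) (hd₂ : d₂ ≤ t) :
    Comp (fun x : Fin n → Bool => Sum.elim (bits n (quotientHigh a n e (Nat.ofBits x)))
      (bits (2 * n) (a * quotientRest N a n e (Nat.ofBits x)))) (10 ^ 15 * u) (10 ^ 15 * t) := by
  have hn := h.five_le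
  have he1 := h.le_e
  have he2 := h.e_lt
  have hsN : N.size ≤ n := Nat.size_le.2 h.N_lt
  have hsa : a.size ≤ n := Nat.size_le.2 h.a_lt
  have h1 : ∀ w, w ≤ m → CompN u t w (fun x : Fin n → Bool => Nat.ofBits x) 3 := fun w hw =>
    hu.register hw (Function.Embedding.refl _)
  have h2 : CompN u t n (fun x : Fin n → Bool => quotientHigh a n e (Nat.ofBits x)) _ :=
    ((((h1 n (by omega)).mul hu (by omega : n + (e - n) ≤ m) h₂ (by omega) hs₂ hd₂
      fun x => Nat.ofBits_lt_two_pow x).sub hu (by omega) (h1 _ (by omega)) fun x =>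
        Nat.le_mul_of_pos_left _ h.a_pos).shiftRight hu (by omega) (e - n)).congr fun x => by
          rw [quotientHigh, Nat.mod_mod]
  have h3 : CompN u t n (fun x : Fin n → Bool => quotientRest N a n e (Nat.ofBits x)) _ :=
    ((((h1 (n + 4) (by omega)).shiftLeft hu (by omega) n).sub hu (by omega)
      (h2.mul hu (by omega) h₁ (by omega) hs₁ hd₁ fun x => Nat.mod_lt _ (by positivity))
      fun x => mul_quotientHigh_le h _).shiftRight hu (by omega) 4).congr fun x => by
        rw [quotientRest, Nat.mod_mod]
  have h4 := h3.mul hu (by omega : 2 * n ≤ m) h₂ (by omega) hs₂ hd₂ fun x =>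
    Nat.mod_lt _ (by positivity)
  refine (Comp.sumElim h2 h4).mono ?_ ?_
  · rw [← add_mul]; exact Nat.mul_le_mul_right _ (by norm_num)
  · rw [← add_mul]; exact Nat.mul_le_mul_right _ (by norm_num)

end Circuits

/-! ### Choice of the parameters -/

/-- The total error for stride `s` is of order `√(n / 2 ^ s)`. -/
theorem error_le {n s N M P : ℕ} {ε : ℝ} (hs : 1 ≤ s) (hn : 4 * s + 13 ≤ n) (hM : s * M ≤ n)
    (hMn : M + 1 ≤ n) (hP : P = n + s) (hN : N < 2 ^ n) (hε : ε = 2 ^ 7 / 2 ^ (2 * n)) (hns : n ≤ 2 ^ s) :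
    2 * Real.pi * (((M + 1) * (3 * s) + P : ℕ) * (2 / 2 ^ s) + (2 ^ (s * M + 3 * s + 1) + 2 ^ P) * ε) +
      Real.sqrt (3 * (64 * (M + 1) / 2 ^ s)) + (Real.sqrt (2 * (N / 2 ^ P)) + N / 2 ^ P) ≤
    102 * Real.sqrt (n / 2 ^ s) := by
  have hA : (0 : ℝ) < 2 ^ s := by positivity
  set δ : ℝ := n / 2 ^ s with hδ
  have hn1 : (1 : ℝ) ≤ n := by exact_mod_cast (by omega : 1 ≤ n)
  have hδ1 : δ ≤ 1 := by
    rw [hδ, div_le_one hA]; exact_mod_cast hns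
  have hδ0 : 0 ≤ δ := by positivity
  have hδs : δ ≤ Real.sqrt δ := by
    refine Real.le_sqrt_of_sq_le ?_
    nlinarith
  have hinv : 1 / 2 ^ s ≤ δ := by rw [hδ]; gcongr
  have h1 : (((M + 1) * (3 * s) + P : ℕ) : ℝ) * (2 / 2 ^ s) ≤ 12 * δ := by
    have : (((M + 1) * (3 * s) + P : ℕ) : ℝ) ≤ 6 * n := by
      have : (M + 1) * (3 * s) + P ≤ 6 * n := by
        have : (M + 1) * (3 * s) = 3 * (s * M) + 3 * s := by ring
        omega
      exact_mod_cast this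
    calc (((M + 1) * (3 * s) + P : ℕ) : ℝ) * (2 / 2 ^ s) ≤ 6 * n * (2 / 2 ^ s) := by gcongr
      _ = 12 * δ := by rw [hδ]; ring
  have h2 : ((2 : ℝ) ^ (s * M + 3 * s + 1) + 2 ^ P) * ε ≤ 1 / 2 * δ := by
    have g1 : (2 : ℝ) ^ (s * M + 3 * s + 1) ≤ 2 ^ (n + 3 * s + 1) :=
      pow_le_pow_right₀ (by norm_num) (by omega)
    have g2 : (2 : ℝ) ^ P ≤ 2 ^ (n + 3 * s + 1) := pow_le_pow_right₀ (by norm_num) (by omega)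
    have g3 : (2 : ℝ) ^ (n + 4 * s + 10) ≤ 2 ^ (2 * n) := pow_le_pow_right₀ (by norm_num) (by omega)
    calc ((2 : ℝ) ^ (s * M + 3 * s + 1) + 2 ^ P) * ε
        ≤ (2 ^ (n + 3 * s + 1) + 2 ^ (n + 3 * s + 1)) * (2 ^ 7 / 2 ^ (n + 4 * s + 10)) := by
          rw [hε]; gcongr
      _ = 1 / 2 * (1 / 2 ^ s) := by
          simp only [pow_add, show 4 * s = 3 * s + s by ring]
          field_simp
          norm_num
      _ ≤ 1 / 2 * δ := by gcongr
  have h3 : Real.sqrt (3 * (64 * (M + 1) / 2 ^ s)) ≤ 14 * Real.sqrt δ := by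
    have : (14 : ℝ) * Real.sqrt δ = Real.sqrt (14 ^ 2 * δ) := by
      rw [Real.sqrt_mul (by norm_num), Real.sqrt_sq (by norm_num)]
    rw [this]
    refine Real.sqrt_le_sqrt ?_
    have hM1 : (M : ℝ) + 1 ≤ n := by exact_mod_cast hMn
    calc 3 * (64 * ((M : ℝ) + 1) / 2 ^ s) ≤ 3 * (64 * n / 2 ^ s) := by gcongr
      _ = 192 * δ := by rw [hδ]; ring
      _ ≤ 14 ^ 2 * δ := by nlinarith
  have h4 : (N : ℝ) / 2 ^ P ≤ δ := by
    refine le_trans ?_ hinv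
    have : (N : ℝ) ≤ 2 ^ n := by exact_mod_cast hN.le
    rw [hP, pow_add, div_le_div_iff₀ (by positivity) hA]
    nlinarith
  have h5 : Real.sqrt (2 * (N / 2 ^ P)) ≤ 2 * Real.sqrt δ := by
    have : (2 : ℝ) * Real.sqrt δ = Real.sqrt (2 ^ 2 * δ) := by
      rw [Real.sqrt_mul (by norm_num), Real.sqrt_sq (by norm_num)]
    rw [this]
    exact Real.sqrt_le_sqrt (by linarith)
  have h6 : 2 * Real.pi ≤ 6.3 := by have := Real.pi_lt_d2; linarith
  calc _ ≤ 6.3 * (12 * δ + 1 / 2 * δ) + 14 * Real.sqrt δ + (2 * Real.sqrt δ + δ) := by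
        gcongr
        rw [hε]; positivity
    _ ≤ 102 * Real.sqrt δ := by linarith

/-- The algorithm for large `n`, with stride `s`. -/
theorem exists_approximatesQFT_of_recipApprox {N a n e s s₁ d₁ s₂ d₂ u t r : ℕ}
    (hu : CostUnit u t (4 * n) r) (h : RecipApprox N a n e)
    (h₁ : HasMulCircuit n N s₁ d₁) (h₂ : HasMulCircuit n a s₂ d₂) (hs₁ : s₁ ≤ u) (hd₁ : d₁ ≤ t)
    (hs₂ : s₂ ≤ u) (hd₂ : d₂ ≤ t) (hs : 2 ≤ s) (hn : 4 * s + 13 ≤ n) (hns : n ≤ 2 ^ s) {ε : ℝ}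
    (hε : 102 * Real.sqrt (n / 2 ^ s) < ε) :
    ∃ (c : ℕ) (C : Circuit (Fin n ⊕ Fin c)), C.size ≤ 10 ^ 16 * u + 100 * (n * s) ∧
      C.depth ≤ 10 ^ 16 * t + 30 * s ∧ ApproximatesQFT N C ε := by
  have he := h.le_e
  obtain ⟨M, hM1, hM2⟩ : ∃ M, s * M ≤ n ∧ n ≤ s * (M + 1) :=
    ⟨n / s, Nat.mul_div_le n s, (Nat.lt_mul_div_succ n (by omega)).le⟩
  have hMn : M + 1 ≤ n := by
    have : 2 * M ≤ s * M := Nat.mul_le_mul_right _ hs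
    omega
  have hsM : s * (M + 1) = s * M + s := by ring
  have hτ : ∀ κ : Fin (M + 1) × Fin (3 * s) → Bool,
      blockSum κ + 2 ^ (n + s) ≤ N * 2 ^ (3 * s + 3) := by
    intro κ
    have g1 := blockSum_lt (by omega) κ
    have g2 : 2 ^ (s * M + 3 * s + 1) ≤ 2 ^ (n + 3 * s + 1) :=
      Nat.pow_le_pow_right (by norm_num) (by omega)
    have g3 : 2 ^ (n + s) ≤ 2 ^ (n + 3 * s + 1) := Nat.pow_le_pow_right (by norm_num) (by omega)
    have g4 : 2 ^ (n - 1) * 2 ^ (3 * s + 3) ≤ N * 2 ^ (3 * s + 3) := Nat.mul_le_mul_right _ h.le_N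
    rw [← pow_add, show n - 1 + (3 * s + 3) = n + 3 * s + 1 + 1 by omega, pow_succ] at g4
    omega
  let c : Fin n ⊕ Fin (2 * n) → ℕ := Sum.elim (fun i => n - i) fun i => e + n - 4 - i
  let p : Fin n ⊕ Fin (2 * n) → Fin 2 := Sum.elim (fun _ => 0) fun _ => 1
  have hcp : ∀ ω ω', c ω = c ω' → p ω = p ω' → ω = ω' := by
    rintro (i | i) (i' | i') hc hp
    · simp only [c, Sum.elim_inl] at hc
      congr 1; ext; omega
    · simp [p] at hp
    · simp [p] at hp
    · simp only [c, Sum.elim_inr] at hc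
      congr 1; ext; omega
  obtain ⟨c, C, h1, h2, η, hη, h3⟩ := approximatesQFT_of_comp (s := s) (M := M) (n := n) (N := N)
    (P := n + s) (τ := 3 * s + 3) hs h.N_pos h.N_lt.le
    (h.N_lt.le.trans (Nat.pow_le_pow_right (by norm_num) hM2))
    (h.N_lt.trans_le (Nat.pow_le_pow_right (by norm_num) (by omega))) hτ
    _ c p hcp
    (comp_quotientDigits hu h le_rfl h₁ h₂ hs₁ hd₁ hs₂ hd₂)
    (ε := 2 ^ 7 / 2 ^ (2 * n)) (by positivity) (fun x hx => by
      rw [Fintype.sum_sum_type]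
      simp only [c, Sum.elim_inl, Sum.elim_inr]
      rw [sum_toNat_div_two_pow n n _ (by omega),
        sum_toNat_div_two_pow (2 * n) (e + n - 4) _ (by omega),
        Nat.mod_eq_of_lt (show quotientHigh a n e (Nat.ofBits x) < 2 ^ n
          from Nat.mod_lt _ (by positivity)),
        Nat.mod_eq_of_lt (show a * quotientRest N a n e (Nat.ofBits x) < 2 ^ (2 * n) from ?_)]
      · exact abs_quotient_sub_le h hx
      · rw [two_mul, pow_add]
        exact Nat.mul_lt_mul_of_lt_of_le h.a_lt (Nat.mod_lt _ (by positivity)).le (by positivity))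
    (compN_decode hu (by omega) h.N_lt h₁ hs₁ hd₁ le_rfl (by omega) (by omega))
    (comp_divMod_blockSum hu (by omega) h h₁ h₂ hs₁ hd₁ hs₂ hd₂ le_rfl (by omega) hM1) _
    (comp_recombine hu (by omega) h.N_lt h₁ hs₁ hd₁ le_rfl (by omega) hM1) (fun x κ t hκ => by
      change bits _ (2 ^ (n + 3 * s + 2) + (Nat.ofBits x + N * Nat.ofBits t) - blockSum κ) = _
      refine bits_congr ?_
      rw [Nat.add_sub_assoc hκ, show n + 3 * s + 2 = n + s + (2 * s + 2) by ring, pow_add,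
        Nat.mul_add_mod])
  refine ⟨c, C, h1.trans ?_, h2.trans ?_, η, hη, fun α hα => (h3 α hα).trans_lt
    ((error_le (by omega) hn hM1 hMn rfl h.N_lt rfl hns).trans_lt hε)⟩
  · have g1 : ((M + 1) * (3 * s) + (n + s)) * (1 + s * 2) ≤ 6 * n * (2 * s + 1) := by
      rw [show 1 + s * 2 = 2 * s + 1 by ring]
      refine Nat.mul_le_mul_right _ ?_
      rw [show (M + 1) * (3 * s) = 3 * (s * (M + 1)) by ring]
      omega
    have g2 : (2 * (3 * s) + 2) * (3 * s) * (M + 1) ≤ (6 * s + 2) * (4 * n) := by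
      rw [show (2 * (3 * s) + 2) * (3 * s) * (M + 1) = (6 * s + 2) * (3 * (s * (M + 1))) by ring]
      exact Nat.mul_le_mul_left _ (by omega)
    have g3 : 2 * n ≤ n * s := by rw [mul_comm]; exact Nat.mul_le_mul_left _ hs
    have g4 : 6 * n * (2 * s + 1) = 12 * (n * s) + 6 * n := by ring
    have g5 : (6 * s + 2) * (4 * n) = 24 * (n * s) + 8 * n := by ring
    rw [g4] at g1
    rw [g5] at g2
    generalize (2 * (3 * s) + 2) * (3 * s) * (M + 1) = x2 at *
    generalize ((M + 1) * (3 * s) + (n + s)) * (1 + s * 2) = x1 at *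
    omega
  · omega

/-- Without regard to size and depth, the transform can be approximated arbitrarily well: a single
block suffices. -/
theorem exists_approximatesQFT {N n : ℕ} (hN1 : 1 ≤ N) (hN : N ≤ 2 ^ n) {ε : ℝ} (hε : 0 < ε) :
    ∃ (c : ℕ) (C : Circuit (Fin n ⊕ Fin c)), ApproximatesQFT N C ε := by
  have hlim : Filter.Tendsto (fun s : ℕ => 2 * Real.pi * ((4 * s + n) * (2 / 2 ^ s) + 1 / 2 ^ s) +
      Real.sqrt (192 / 2 ^ s) + (Real.sqrt (2 * (1 / 2 ^ s)) + 1 / 2 ^ s) : ℕ → ℝ) Filter.atTop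
      (nhds 0) := by
    have g1 : Filter.Tendsto (fun s : ℕ => 1 / (2 : ℝ) ^ s) Filter.atTop (nhds 0) := by
      simpa using tendsto_pow_const_div_const_pow_of_one_lt 0 (one_lt_two (α := ℝ))
    have g2 : Filter.Tendsto (fun s : ℕ => (s : ℝ) / (2 : ℝ) ^ s) Filter.atTop (nhds 0) := by
      simpa using tendsto_pow_const_div_const_pow_of_one_lt 1 (one_lt_two (α := ℝ))
    have g3 := ((((g2.const_mul 8).add (g1.const_mul (2 * (n : ℝ) + 1))).const_mul (2 * Real.pi)).add
      (Real.continuous_sqrt.continuousAt.tendsto.comp (g1.const_mul 192))).add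
      ((Real.continuous_sqrt.continuousAt.tendsto.comp (g1.const_mul 2)).add g1)
    simp only [mul_zero, add_zero, Real.sqrt_zero] at g3
    refine g3.congr fun s => ?_
    simp only [Function.comp]
    congr 3
    · ring
    · ring
  obtain ⟨s, hs2, hsn, hsε⟩ := ((Filter.eventually_ge_atTop 2).and ((Filter.eventually_ge_atTop n).and
    (hlim.eventually (gt_mem_nhds hε)))).exists
  set E := 4 * s + n + 2 with hE
  let f : (Fin n → Bool) → Fin E → Bool := fun x => bits E (Nat.ofBits x * 2 ^ E / N)
  let g : (Fin n ⊕ ((Fin (0 + 1) × Fin (3 * s)) ⊕ Fin (3 * s + n + 2)) → Bool) → Fin (n + s) → Bool :=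
    fun z => bits (n + s) (Nat.ofBits (fun i => z (Sum.inl i)) +
      N * Nat.ofBits (fun i => z (Sum.inr (Sum.inr i))) - blockSum fun k => z (Sum.inr (Sum.inl k)))
  obtain ⟨S₁, D₁, hf⟩ := exists_comp f
  obtain ⟨S₂, D₂, hdec⟩ := exists_comp fun κ : Fin (0 + 1) × Fin (3 * s) → Bool => bits n (decode N κ)
  obtain ⟨S₃, D₃, hdiv⟩ := exists_comp fun z : (Fin (0 + 1) × Fin (3 * s)) ⊕ Fin (n + s) → Bool =>
    Sum.elim (bits n ((blockSum (fun k => z (Sum.inl k)) + Nat.ofBits fun r => z (Sum.inr r)) % N))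
      (bits (3 * s + n + 2) ((blockSum (fun k => z (Sum.inl k)) + Nat.ofBits fun r => z (Sum.inr r)) / N))
  obtain ⟨S₄, D₄, hg⟩ := exists_comp g
  have hτ : ∀ κ : Fin (0 + 1) × Fin (3 * s) → Bool,
      blockSum κ + 2 ^ (n + s) ≤ N * 2 ^ (3 * s + n + 2) := by
    intro κ
    have g1 := blockSum_lt (by omega) κ
    have k1 : 2 ^ (s * 0 + 3 * s + 1) ≤ 2 ^ (3 * s + n + 1) :=
      Nat.pow_le_pow_right (by norm_num) (by omega)
    have k2 : 2 ^ (n + s) ≤ 2 ^ (3 * s + n + 1) := Nat.pow_le_pow_right (by norm_num) (by omega)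
    have k3 : 2 ^ (3 * s + n + 2) ≤ N * 2 ^ (3 * s + n + 2) := Nat.le_mul_of_pos_left _ hN1
    rw [show 3 * s + n + 2 = 3 * s + n + 1 + 1 by ring, pow_succ] at k3 ⊢
    omega
  have hfε : ∀ x, Nat.ofBits x < N →
      |∑ i : Fin E, ((f x i).toNat : ℝ) / 2 ^ (E - (i : ℕ)) - Nat.ofBits x / N| ≤ 1 / 2 ^ E := by
    intro x hx
    have hNr : (0 : ℝ) < N := by exact_mod_cast hN1
    have k1 : Nat.ofBits x * 2 ^ E / N < 2 ^ E := by
      rw [Nat.div_lt_iff_lt_mul hN1, mul_comm]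
      exact Nat.mul_lt_mul_of_pos_left hx (by positivity)
    rw [sum_toNat_div_two_pow E E _ (by omega), Nat.mod_eq_of_lt k1]
    have k2 : ((Nat.ofBits x * 2 ^ E / N : ℕ) : ℝ) * N ≤ Nat.ofBits x * 2 ^ E := by
      exact_mod_cast Nat.div_mul_le_self _ _
    have k3 : (Nat.ofBits x * 2 ^ E : ℝ) ≤ ((Nat.ofBits x * 2 ^ E / N : ℕ) : ℝ) * N + N := by
      exact_mod_cast (Nat.lt_div_mul_add hN1).le
    generalize ((Nat.ofBits x * 2 ^ E / N : ℕ) : ℝ) = q at *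
    have k4 : q / 2 ^ E - (Nat.ofBits x : ℝ) / N = (q * N - Nat.ofBits x * 2 ^ E) / (N * 2 ^ E) := by
      field_simp
    rw [k4, abs_div, abs_of_pos (show (0 : ℝ) < N * 2 ^ E by positivity),
      div_le_div_iff₀ (by positivity) (by positivity), one_mul]
    refine mul_le_mul_of_nonneg_right ?_ (by positivity)
    rw [abs_le]
    constructor <;> linarith
  obtain ⟨c, C, -, -, η, hη, h3⟩ := approximatesQFT_of_comp (s := s) (M := 0) (n := n) (N := N)
    (P := n + s) (τ := 3 * s + n + 2) hs2 hN1 hN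
    (hN.trans (Nat.pow_le_pow_right (by norm_num) (by omega)))
    (hN.trans_lt (Nat.pow_lt_pow_right (by norm_num) (by omega))) hτ
    (Ω := Fin E) f (fun i => E - i) (fun _ => 0) (fun i i' h _ => by ext; omega)
    hf (ε := 1 / 2 ^ E) (by positivity) hfε hdec hdiv g hg (fun _ _ _ _ => rfl)
  refine ⟨c, C, η, hη, fun α hα => (h3 α hα).trans_lt (lt_of_le_of_lt ?_ hsε)⟩
  have g1 : (N : ℝ) / 2 ^ (n + s) ≤ 1 / 2 ^ s := by
    have : (N : ℝ) ≤ 2 ^ n := by exact_mod_cast hN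
    rw [pow_add, div_le_div_iff₀ (by positivity) (by positivity)]
    have : (0 : ℝ) < 2 ^ s := by positivity
    nlinarith
  have g2 : ((2 : ℝ) ^ (s * 0 + 3 * s + 1) + 2 ^ (n + s)) * (1 / 2 ^ E) ≤ 1 / 2 ^ s := by
    have k1 : (2 : ℝ) ^ (s * 0 + 3 * s + 1) ≤ 2 ^ (3 * s + n + 1) :=
      pow_le_pow_right₀ (by norm_num) (by omega)
    have k2 : (2 : ℝ) ^ (n + s) ≤ 2 ^ (3 * s + n + 1) := pow_le_pow_right₀ (by norm_num) (by omega)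
    have k3 : (2 : ℝ) ^ E = 2 * 2 ^ (3 * s + n + 1) * 2 ^ s := by
      rw [← pow_succ', ← pow_add]; congr 1; omega
    rw [mul_one_div, div_le_div_iff₀ (by positivity) (by positivity), k3]
    have : (0 : ℝ) < 2 ^ s := by positivity
    nlinarith
  have g3 : (((0 + 1) * (3 * s) + (n + s) : ℕ) : ℝ) = 4 * s + n := by push_cast; ring
  rw [g3]
  have g4 : 3 * (64 * (((0 : ℕ) : ℝ) + 1) / 2 ^ s) = 192 / 2 ^ s := by push_cast; ring
  rw [g4]
  gcongr

/-- For `N = 1` nothing has to be done. -/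
theorem exists_approximatesQFT_one {n : ℕ} {ε : ℝ} (hε : 0 < ε) :
    ∃ (c : ℕ) (C : Circuit (Fin n ⊕ Fin c)), C.size = 0 ∧ C.depth = 0 ∧ ApproximatesQFT 1 C ε := by
  refine ⟨0, ⟨[], by simp⟩, rfl, rfl, ket fun _ => false, by simp [ket], fun α _ => ?_⟩
  have : qft α = α := by
    ext k
    simp [qft, Subsingleton.elim k 0]
  rw [this]
  simpa [Circuit.run] using hε

/-- A stride of `c` times the number of digits of `n` makes the error smaller than `1 / p n`. -/
theorem exists_two_pow_size_bound (p : Polynomial ℝ) :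
    ∃ c : ℕ, 2 ≤ c ∧ ∀ n : ℕ, 1 ≤ n → 102 ^ 2 * n * p.eval (n : ℝ) ^ 2 < 2 ^ (c * n.size) := by
  set B : ℝ := ∑ i ∈ Finset.range (p.natDegree + 1), |p.coeff i| with hB
  have hp : ∀ n : ℕ, 1 ≤ n → |p.eval (n : ℝ)| ≤ B * n ^ p.natDegree := by
    intro n hn
    rw [Polynomial.eval_eq_sum_range, hB, Finset.sum_mul]
    refine (Finset.abs_sum_le_sum_abs _ _).trans (Finset.sum_le_sum fun i hi => ?_)
    rw [abs_mul, abs_of_nonneg (show (0 : ℝ) ≤ (n : ℝ) ^ i by positivity)]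
    refine mul_le_mul_of_nonneg_left (pow_le_pow_right₀ (by exact_mod_cast hn) ?_) (abs_nonneg _)
    have := Finset.mem_range.1 hi
    omega
  obtain ⟨b, hb⟩ := pow_unbounded_of_one_lt (102 ^ 2 * B ^ 2) (one_lt_two (α := ℝ))
  refine ⟨b + 2 * p.natDegree + 2, by omega, fun n hn => ?_⟩
  have h1 : (1 : ℝ) ≤ n := by exact_mod_cast hn
  have h2 : (n : ℝ) ≤ 2 ^ n.size := by exact_mod_cast (Nat.lt_size_self n).le
  have h3 : 1 ≤ n.size := Nat.size_pos.2 hn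
  have h4 : p.eval (n : ℝ) ^ 2 ≤ (B * n ^ p.natDegree) ^ 2 := by
    rw [← sq_abs]
    exact pow_le_pow_left₀ (abs_nonneg _) (hp n hn) 2
  calc 102 ^ 2 * (n : ℝ) * p.eval (n : ℝ) ^ 2 ≤ 102 ^ 2 * n * (B * n ^ p.natDegree) ^ 2 := by gcongr
    _ = 102 ^ 2 * B ^ 2 * (n : ℝ) ^ (2 * p.natDegree + 1) := by ring
    _ < 2 ^ b * (n : ℝ) ^ (2 * p.natDegree + 1) := by gcongr
    _ ≤ (2 ^ n.size) ^ b * (2 ^ n.size) ^ (2 * p.natDegree + 1) := by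
      gcongr
      exact le_self_pow₀ (by norm_num) (by omega)
    _ = 2 ^ ((b + 2 * p.natDegree + 1) * n.size) := by
      rw [← pow_add, ← pow_mul]; congr 1; ring
    _ ≤ 2 ^ ((b + 2 * p.natDegree + 2) * n.size) :=
      pow_le_pow_right₀ (by norm_num) (Nat.mul_le_mul_right _ (by omega))

/-- A stride of logarithmic size is small enough for the algorithm, if `n` is large. -/
theorem exists_size_le (c : ℕ) : ∃ n₀ : ℕ, ∀ n, n₀ ≤ n → 4 * (c * n.size) + 13 ≤ n := by
  have h := tendsto_pow_const_div_const_pow_of_one_lt 1 (one_lt_two (α := ℝ))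
  have h1 : (0 : ℝ) < 1 / (8 * c + 26) := by positivity
  obtain ⟨l, hl⟩ := Filter.eventually_atTop.1 (h.eventually (gt_mem_nhds h1))
  refine ⟨2 ^ l, fun n hn => ?_⟩
  have h2 : l < n.size := Nat.lt_size.2 hn
  have h3 := hl n.size h2.le
  rw [pow_one, div_lt_div_iff₀ (by positivity) (by positivity), one_mul] at h3
  have h4 : n.size * (8 * c + 26) < 2 ^ n.size := by exact_mod_cast h3
  have h5 : 2 ^ (n.size - 1) ≤ n := Nat.lt_size.1 (by omega)
  have h6 : 2 ^ n.size = 2 * 2 ^ (n.size - 1) := by rw [← pow_succ']; congr 1; omega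
  have h7 : n.size * (8 * c + 26) = 8 * (c * n.size) + 26 * n.size := by ring
  omega

theorem size_le_two_mul_logb {n : ℕ} (hn : 2 ≤ n) :
    (n.size : ℝ) ≤ 2 * Real.logb 2 n ∧ 1 ≤ Real.logb 2 n := by
  have hn0 : (0 : ℝ) < n := by exact_mod_cast (by omega : 0 < n)
  have h1 : (1 : ℝ) ≤ Real.logb 2 n := by
    rw [Real.le_logb_iff_rpow_le one_lt_two hn0, Real.rpow_one]; exact_mod_cast hn
  have hs : 1 ≤ n.size := Nat.size_pos.2 (by omega)
  have h2 : ((n.size - 1 : ℕ) : ℝ) ≤ Real.logb 2 n := by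
    rw [Real.le_logb_iff_rpow_le one_lt_two hn0, Real.rpow_natCast]
    exact_mod_cast (Nat.lt_size.1 (by omega) : 2 ^ (n.size - 1) ≤ n)
  push_cast [Nat.cast_sub hs] at h2
  exact ⟨by linarith, h1⟩

/-- Finitely many values of `N` have a common bound for size and depth. -/
theorem exists_bound_of_lt {ε : ℕ → ℝ} (hε : ∀ n, 1 ≤ n → 0 < ε n) (X : ℕ) :
    ∃ B : ℕ, ∀ N, 1 ≤ N → N < X → ∃ (c : ℕ) (C : Circuit (Fin N.size ⊕ Fin c)),
      C.size ≤ B ∧ C.depth ≤ B ∧ ApproximatesQFT N C (ε N.size) := by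
  induction X with
  | zero => exact ⟨0, fun N _ h => (Nat.not_lt_zero _ h).elim⟩
  | succ X ih =>
    obtain ⟨B, hB⟩ := ih
    rcases Nat.eq_zero_or_pos X with rfl | hX
    · exact ⟨0, fun N h h' => by omega⟩
    obtain ⟨c, C, hC⟩ := exists_approximatesQFT hX (Nat.lt_size_self X).le
      (hε X.size (Nat.size_pos.2 hX))
    refine ⟨B + C.size + C.depth, fun N h h' => ?_⟩
    rcases Nat.lt_succ_iff_lt_or_eq.1 h' with h' | rfl
    · obtain ⟨c', C', h1, h2, h3⟩ := hB N h h'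
      exact ⟨c', C', by omega, by omega, h3⟩
    · exact ⟨c, C, by omega, by omega, hC⟩

end QuantumCircuit

end

theorem mainTheorem6 (p : Polynomial ℝ) (hp : ∀ n : ℕ, 1 ≤ n → 0 < p.eval (n : ℝ)) :
    ∃ K : ℝ, 0 < K ∧ ∀ N n : ℕ, 1 ≤ N → n = N.size →
      ∀ m e : ℕ, QuantumCircuit.IsBitApprox n m e (1 / (N : ℝ)) →
      ∀ s₁ d₁ s₂ d₂ : ℕ,
        QuantumCircuit.HasMulCircuit n N s₁ d₁ → QuantumCircuit.HasMulCircuit n m s₂ d₂ →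
        ∃ (c : ℕ) (C : QuantumCircuit.Circuit (Fin n ⊕ Fin c)),
          (C.size : ℝ) ≤ K * (s₁ + s₂ + n * Real.logb 2 n) ∧
          (C.depth : ℝ) ≤ K * (d₁ + d₂ + Real.logb 2 n) ∧
          QuantumCircuit.ApproximatesQFT N C (1 / p.eval (n : ℝ)) := by
  have hε : ∀ n : ℕ, 1 ≤ n → 0 < 1 / p.eval (n : ℝ) := fun n hn => one_div_pos.2 (hp n hn)
  obtain ⟨k, hk, hkp⟩ := QuantumCircuit.exists_two_pow_size_bound p
  obtain ⟨n₀, hn₀⟩ := QuantumCircuit.exists_size_le k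
  obtain ⟨B, hB⟩ := QuantumCircuit.exists_bound_of_lt hε (2 ^ n₀)
  refine ⟨10 ^ 18 + 200 * k + B, by positivity, fun N n hN hn m e hm s₁ d₁ s₂ d₂ h₁ h₂ => ?_⟩
  have hn1 : 1 ≤ n := hn ▸ Nat.size_pos.2 hN
  rcases Nat.lt_or_ge n 2 with hlt | hn2
  · -- Only `N = 1` has a single digit.
    have h1 : n = 1 := by omega
    have h2 : N < 2 ^ 1 := Nat.size_le.1 (by omega)
    obtain rfl : N = 1 := by omega
    obtain ⟨c, C, hs, hd, hC⟩ := QuantumCircuit.exists_approximatesQFT_one (n := n) (hε n hn1)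
    refine ⟨c, C, ?_, ?_, hC⟩
    · rw [hs, h1, Nat.cast_one, Real.logb_one]
      push_cast
      positivity
    · rw [hd, h1, Nat.cast_one, Real.logb_one]
      push_cast
      positivity
  obtain ⟨hl1, hl2⟩ := QuantumCircuit.size_le_two_mul_logb hn2
  set l := Real.logb 2 n with hl
  have hn2r : (2 : ℝ) ≤ n := by exact_mod_cast hn2
  have hs0 : (0 : ℝ) ≤ s₁ + s₂ := by positivity
  have hd0 : (0 : ℝ) ≤ d₁ + d₂ := by positivity
  have hnl : 1 ≤ n * l := by nlinarith
  rcases Nat.lt_or_ge n n₀ with hlt | hge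
  · have h1 : N < 2 ^ n₀ := (Nat.size_le.1 hn.symm.le).trans_le
      (Nat.pow_le_pow_right (by norm_num) hlt.le)
    obtain ⟨c, C, hs, hd, hC⟩ := hB N hN h1
    subst hn
    have hsr : (C.size : ℝ) ≤ B := by exact_mod_cast hs
    have hdr : (C.depth : ℝ) ≤ B := by exact_mod_cast hd
    refine ⟨c, C, hsr.trans ?_, hdr.trans ?_, hC⟩
    · calc (B : ℝ) ≤ 10 ^ 18 + 200 * k + B := le_add_of_nonneg_left (by positivity)
        _ ≤ _ := le_mul_of_one_le_right (by positivity) (by linarith)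
    · calc (B : ℝ) ≤ 10 ^ 18 + 200 * k + B := le_add_of_nonneg_left (by positivity)
        _ ≤ _ := le_mul_of_one_le_right (by positivity) (by linarith)
  · have hbig := hn₀ n hge
    have hsz : 1 ≤ n.size := Nat.size_pos.2 hn1
    have hnsz : n < 2 ^ n.size := Nat.lt_size_self n
    have hks : 2 ≤ k * n.size := hk.trans (Nat.le_mul_of_pos_right _ hsz)
    have hu : QuantumCircuit.CostUnit (s₁ + s₂ + 4 * n * (n.size + 2)) (d₁ + d₂ + (n.size + 2))
        (4 * n) (n.size + 2) :=
      ⟨by omega, by rw [pow_add]; omega, Nat.le_add_left _ _, Nat.le_add_left _ _⟩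
    obtain ⟨c, C, hs, hd, hC⟩ := QuantumCircuit.exists_approximatesQFT_of_recipApprox
      (s := k * n.size) hu (QuantumCircuit.RecipApprox.of_isBitApprox (by omega) hn hm) h₁ h₂
      (by omega) (by omega) (by omega) (by omega) hks hbig
      (hnsz.le.trans (Nat.pow_le_pow_right (by norm_num) (Nat.le_mul_of_pos_left _ (by omega))))
      (ε := 1 / p.eval (n : ℝ)) (by
        rw [lt_div_iff₀ (hp n hn1)]
        refine lt_of_pow_lt_pow_left₀ 2 (by norm_num) ?_
        rw [mul_pow, mul_pow, Real.sq_sqrt (by positivity), one_pow]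
        have := hkp n hn1
        calc 102 ^ 2 * ((n : ℝ) / 2 ^ (k * n.size)) * p.eval (n : ℝ) ^ 2
            = 102 ^ 2 * n * p.eval (n : ℝ) ^ 2 / 2 ^ (k * n.size) := by ring
          _ < 1 := by rw [div_lt_one (by positivity)]; exact this)
    have hsr : (C.size : ℝ) ≤ 10 ^ 16 * (s₁ + s₂ + 4 * n * (n.size + 2)) + 100 * (n * (k * n.size)) := by
      exact_mod_cast hs
    have hdr : (C.depth : ℝ) ≤ 10 ^ 16 * (d₁ + d₂ + (n.size + 2)) + 30 * (k * n.size) := by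
      exact_mod_cast hd
    have hk0 : (0 : ℝ) ≤ k := by positivity
    have hB0 : (0 : ℝ) ≤ B := by positivity
    refine ⟨c, C, hsr.trans ?_, hdr.trans ?_, hC⟩
    · calc (10 : ℝ) ^ 16 * (s₁ + s₂ + 4 * n * (n.size + 2)) + 100 * (n * (k * n.size))
          ≤ 10 ^ 16 * (s₁ + s₂ + 4 * n * (2 * l + 2 * l)) + 100 * (n * (k * (2 * l))) := by
            gcongr; linarith
        _ = 10 ^ 16 * (s₁ + s₂) + (16 * 10 ^ 16 + 200 * k) * (n * l) := by ring
        _ ≤ (10 ^ 18 + 200 * k + B) * (s₁ + s₂) + (10 ^ 18 + 200 * k + B) * (n * l) := by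
            exact add_le_add (mul_le_mul_of_nonneg_right (by linarith) (by linarith))
              (mul_le_mul_of_nonneg_right (by linarith) (by linarith))
        _ = _ := by ring
    · calc (10 : ℝ) ^ 16 * (d₁ + d₂ + (n.size + 2)) + 30 * (k * n.size)
          ≤ 10 ^ 16 * (d₁ + d₂ + (2 * l + 2 * l)) + 30 * (k * (2 * l)) := by
            gcongr; linarith
        _ = 10 ^ 16 * (d₁ + d₂) + (4 * 10 ^ 16 + 60 * k) * l := by ring
        _ ≤ (10 ^ 18 + 200 * k + B) * (d₁ + d₂) + (10 ^ 18 + 200 * k + B) * l := by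
            exact add_le_add (mul_le_mul_of_nonneg_right (by linarith) (by linarith))
              (mul_le_mul_of_nonneg_right (by linarith) (by linarith))
        _ = _ := by ring
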